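/- **Theorem 2.1.** Let $\lambda,\mu:\mathbb{Z}^+\to[0,\infty)$, where $\mathbb{Z}^+=\{0,1,2,\dots\}$, satisfy $\lambda(x)>0$ for all $x\ge 0$, $\mu(0)=0$ and $\mu(x)>0$ for all $x\ge 1$, and suppose that $$\lim_{x\to\infty}\frac{\lambda(x)}{P_l x^l}=\lim_{x\to\infty}\frac{\mu(x)}{Q_m x^m}=1$$ for some real constants $P_l,Q_m>0$ and $l,m\ge 0$ with $\max(l,m)>0$. Let $\xi(t)$, $t\ge 0$, be the birth-death process on $\mathbb{Z}^+\cup\{\infty\}$ started at $0$ with birth rates $\lambda$ and death rates $\mu$: it stays in a state $x\in\mathbb{Z}^+$ for an exponentially distributed time with parameter $h(x)=\lambda(x)+\mu(x)$ and then jumps to $x+1$ with probability $\lambda(x)/h(x)$ and to $x-1$ with probability $\mu(x)/h(x)$, the holding times being conditionally independent given the sequence of visited states, which is a Markov chain; if infinitely many jumps accumulate at a finite time (explosion), the process equals $\infty$ from that time on. For $T>0$ put $\xi_T(t)=\xi(tT)/T$, $0\le t\le 1$. Let $\mathbb{D}[0,1]$ be the set of real-valued right-continuous functions with left limits on $[0,1]$,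 and for $f\in\mathbb{D}[0,1]$ and $\varepsilon>0$ let $U_\varepsilon(f)=\{g\in\mathbb{D}[0,1]:\sup_{t\in[0,1]}|f(t)-g(t)|<\varepsilon\}$. Let $F$ be the set of continuous $f:[0,1]\to\mathbb{R}$ with $f(0)=0$ and $f(t)>0$ for $0<t\le 1$. Say that $\xi_T$ satisfies the local large deviation principle on $F$ with rate functional $I\ge 0$ and normalising function $\psi>0$, $\psi(T)\to\infty$ as $T\to\infty$, if for every $f\in F$ $$\lim_{\varepsilon\downarrow 0}\limsup_{T\to\infty}\frac{1}{\psi(T)}\ln\mathbf{P}(\xi_T\in U_\varepsilon(f))=\lim_{\varepsilon\downarrow 0}\liminf_{T\to\infty}\frac{1}{\psi(T)}\ln\mathbf{P}(\xi_T\in U_\varepsilon(f))=-I(f),$$ with $\ln 0=-\infty$. Then $\xi_T$ satisfies the local large deviation principle on $F$, as follows: (a) if $l>m$, with $\psi(T)=T^{l+1}$ and $I(f)=P_l\int_0^1 f(t)^l\,dt$; (b) if $l=m$ and $P_l\ne Q_m$, with $\psi(T)=T^{l+1}$ and $I(f)=(\sqrt{P_l}-\sqrt{Q_m})^2\int_0^1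 f(t)^l\,dt$; (c) if $l<m$, with $\psi(T)=T^{m+1}$ and $I(f)=Q_m\int_0^1 f(t)^m\,dt$. -/

import Mathlib

open MeasureTheory Filter Topology
open scoped ENNReal

/-- Transition probabilities of the jump chain of a birth-death process with birth rates `lam` and
death rates `mu`: from `x` to `x + 1` with probability `lam x / (lam x + mu x)` and from `x` to
`x - 1` with probability `mu x / (lam x + mu x)`. -/
noncomputable def bdJumpProb (lam mu : ℕ → ℝ) (x y : ℕ) : ℝ :=
  if y = x + 1 then lam x / (lam x + mu x)
  else if y + 1 = x then mu x / (lam x + mu x)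
  else 0

/-- `Y` and `S` are the successive states and the successive holding times of a birth-death process
started at `0`: `Y` is a Markov chain with transition probabilities `bdJumpProb lam mu` started at
`0` and, given `Y`, the holding times `S i` are independent, exponentially distributed with
parameter `lam (Y i) + mu (Y i)`. The joint law of `(Y, S)` is given by its finite-dimensional
distributions. -/
structure IsBDJumpHold {Ω : Type*} [MeasurableSpace Ω] (P : Measure Ω) (lam mu : ℕ → ℝ)
    (Y : ℕ → Ω → ℕ) (S : ℕ → Ω → ℝ) : Prop where
  measurable_state : ∀ i, Measurable (Y i)
  measurable_hold : ∀ i, Measurable (S i)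
  law : ∀ (n : ℕ) (y : ℕ → ℕ) (s : ℕ → ℝ), y 0 = 0 → (∀ i, 0 ≤ s i) →
    P {ω | ∀ i ≤ n, Y i ω = y i ∧ s i < S i ω} =
      ENNReal.ofReal ((∏ i ∈ Finset.range n, bdJumpProb lam mu (y i) (y (i + 1))) *
        ∏ i ∈ Finset.range (n + 1), Real.exp (-(lam (y i) + mu (y i)) * s i))
  start : ∀ᵐ ω ∂P, Y 0 ω = 0

/-- `xi` is a birth-death process on `ℕ ∪ {∞}` started at `0`, with birth rates `lam` and death
rates `mu`, absorbed at `∞` from its (possible) explosion time on: almost surely, it sits in the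
state `Y n` between the `n`-th and the `(n+1)`-st jump time (the jump times being the partial sums
of the holding times), and at `∞` after all jump times. Only times `t ≥ 0` matter. -/
def IsBirthDeathProcess {Ω : Type*} [MeasurableSpace Ω] (P : Measure Ω) (lam mu : ℕ → ℝ)
    (xi : ℝ → Ω → ℕ∞) : Prop :=
  ∃ (Y : ℕ → Ω → ℕ) (S : ℕ → Ω → ℝ), IsBDJumpHold P lam mu Y S ∧
    ∀ᵐ ω ∂P, ∀ t : ℝ, 0 ≤ t →
      (∀ n : ℕ, ∑ i ∈ Finset.range n, S i ω ≤ t → t < ∑ i ∈ Finset.range (n + 1), S i ω →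
        xi t ω = (Y n ω : ℕ∞)) ∧
      ((∀ n : ℕ, ∑ i ∈ Finset.range n, S i ω ≤ t) → xi t ω = ⊤)

/-- The scaled path `t ↦ xi (t T) / T` on `[0,1]`, with value `∞` after explosion. -/
noncomputable def scaledPath {Ω : Type*} (xi : ℝ → Ω → ℕ∞) (T : ℝ) (ω : Ω) (t : unitInterval) :
    EReal :=
  ((xi ((t : ℝ) * T) ω : ℝ≥0∞) : EReal) / (T : EReal)

/-- `g ∈ 𝔻[0,1]`: right-continuous with (finite) left limits. -/
def IsCadlag01 (g : unitInterval → ℝ) : Prop :=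
  ∀ t, ContinuousWithinAt g (Set.Ioi t) t ∧ ∃ a : ℝ, Tendsto g (𝓝[<] t) (𝓝 a)

/-- The open ball `U_ε(f)` of `𝔻[0,1]` for the uniform distance. The supremum is taken in `[0,∞]`,
so that no convention about unbounded suprema enters. -/
def cadlagBall (f : unitInterval → ℝ) (ε : ℝ) : Set (unitInterval → ℝ) :=
  {g | IsCadlag01 g ∧ (⨆ t, edist (f t) (g t)) < ENNReal.ofReal ε}

/-- `P(zeta_T ∈ U_ε(f))`, for an extended-real valued path `zeta_T` (paths with an infinite value
do not belong to `𝔻[0,1]`). -/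
noncomputable def ballProb {Ω : Type*} [MeasurableSpace Ω] (P : Measure Ω)
    (zeta : ℝ → Ω → unitInterval → EReal) (f : unitInterval → ℝ) (ε T : ℝ) : ℝ≥0∞ :=
  P {ω | ∃ g ∈ cadlagBall f ε, ∀ t, zeta T ω t = (g t : EReal)}

/-- The family `zeta_T` satisfies the local large deviation principle on `G ⊆ 𝔻[0,1]` with rate
functional `I` and normalising function `ψ`. Logarithms and upper/lower limits are taken in
`[-∞,∞]` (`ENNReal.log 0 = -∞`). -/
structure SatisfiesLLDP {Ω : Type*} [MeasurableSpace Ω] (P : Measure Ω)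
    (zeta : ℝ → Ω → unitInterval → EReal) (G : Set (unitInterval → ℝ))
    (I : (unitInterval → ℝ) → ℝ) (ψ : ℝ → ℝ) : Prop where
  subset_cadlag : ∀ f ∈ G, IsCadlag01 f
  rate_nonneg : ∀ f ∈ G, 0 ≤ I f
  norm_pos : ∀ T, 0 < T → 0 < ψ T
  norm_tendsto : Tendsto ψ atTop atTop
  limsup_tendsto : ∀ f ∈ G, Tendsto
    (fun ε : ℝ => limsup (fun T : ℝ => ENNReal.log (ballProb P zeta f ε T) / (ψ T : EReal)) atTop)
    (𝓝[>] 0) (𝓝 ((-(I f) : ℝ) : EReal))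
  liminf_tendsto : ∀ f ∈ G, Tendsto
    (fun ε : ℝ => liminf (fun T : ℝ => ENNReal.log (ballProb P zeta f ε T) / (ψ T : EReal)) atTop)
    (𝓝[>] 0) (𝓝 ((-(I f) : ℝ) : EReal))

/-- Continuous functions on `[0,1]` that vanish at `0` and are positive on `(0,1]`. -/
def positivePaths : Set (unitInterval → ℝ) :=
  {f | Continuous f ∧ f 0 = 0 ∧ ∀ t, 0 < t → 0 < f t}

/-! Let k = max(l, m). Both rates are then asymptotic to p x^k and q x^k, where the rate of lower
order gets the coefficient 0 (`HasPowerRates`). The three cases are thus a single statement, with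
constant (√p - √q)² (`HasPowerRates.satisfiesLLDP`).

Near height T y the rates are of order T^k, and the process runs for time T, which gives the
normalisation T^(k+1). Reaching another site at distance O(T) within one unit of time has
probability at least exp(-O(T log T + T^k)). Since k > 0 this is negligible
(`eventually_move_cost`), so only the heights of f matter and its slopes do not. Staying near a
height forces births and deaths to balance. The cheapest way is to replace both rates by their
geometric mean, at cost λ + μ - 2√(λμ) per unit of time, that is about (√p - √q)² (T y)^k.

The whole analysis uses the backward equation of the process. Conditioning on successive holding
times and jumps gives a Feynman-Kac formula: the expectation of a product of sojourn weights is an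
iterate of an explicit integral operator (`lintegral_next_step`, `sum_lintegral_fkTerm`).

Upper bound. Multiply birth rates by r and divide death rates by r. The density of the tilted
process is r^ξ(T) times the exponential of an additive functional, and its mean is at most 1 because
x ↦ r^x is a fixed point of the backward operator (`fkIter_tilt_le`). On the tube around f the
density is at least exp(c T^(k+1) ∫ (f - ε)₊^k), up to an exponential error that is small relative
to T^(k+1), and Markov's inequality concludes (`ballProb_le`). The parameter r is nearly optimal; if
p or q is 0 the optimum is approached only as r tends to ∞ or to 0 (`exists_tilt_upper`).

Lower bound. The probability of remaining in the tube dominates the minimal solution of a backward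
equation, and that solution dominates every bounded subsolution supported in the tube
(`le_fkLimit_of_subsolution`). Two explicit subsolutions suffice: a Poisson-like one for travelling
to a site (`fkLimit_move_lower`), and a tilted parabola for staying in a window of fixed width W,
whose cost exceeds the optimum by a term of order 1/W (`fkLimit_stay_lower`). Alternating them over
K time cells produces a Riemann sum for ∫ f^k (`fkLimit_grid_lower`). -/

open ProbabilityTheory (expMeasure)

/-! ### Product measures and exponential laws -/

/-- Upper orthants form a π-system that generates the product σ-algebra, and countably many of them
cover the space. They are the only events whose probability `IsBDJumpHold.law` prescribes. -/
theorem measure_ext_of_boxes {N : ℕ} {μ ν : Measure (Fin N → ℝ)} [IsFiniteMeasure μ]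
    (h : ∀ s : Fin N → ℝ, μ (Set.univ.pi fun i => Set.Ioi (s i)) =
      ν (Set.univ.pi fun i => Set.Ioi (s i))) : μ = ν := by
  have hC : ∀ _ : Fin N, IsCountablySpanning (Set.range (Set.Ioi : ℝ → Set ℝ)) := fun _ =>
    ⟨fun n : ℕ => Set.Ioi (-(n : ℝ)), fun n => ⟨_, rfl⟩, by
      ext x
      simp only [Set.mem_iUnion, Set.mem_Ioi, Set.mem_univ, iff_true]
      obtain ⟨n, hn⟩ := exists_nat_gt (-x)
      exact ⟨n, by linarith⟩⟩
  refine Measure.ext_of_generateFrom_of_iUnion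
    (Set.univ.pi '' Set.univ.pi fun _ : Fin N => Set.range (Set.Ioi : ℝ → Set ℝ))
    (fun n : ℕ => Set.univ.pi fun _ => Set.Ioi (-(n : ℝ))) ?_ ?_ ?_ ?_ ?_ ?_
  · rw [← generateFrom_pi_eq hC]
    congr 1
    funext i
    rw [← borel_eq_generateFrom_Ioi]
    exact BorelSpace.measurable_eq
  · refine IsPiSystem.pi fun _ => ?_
    rw [← Set.image_univ]
    exact isPiSystem_image_Ioi Set.univ
  · ext x
    simp only [Set.mem_iUnion, Set.mem_univ_pi, Set.mem_Ioi, Set.mem_univ, iff_true]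
    obtain ⟨n, hn⟩ := exists_nat_gt (∑ i, |x i|)
    refine ⟨n, fun i => ?_⟩
    have h1 : |x i| ≤ ∑ i, |x i| :=
      Finset.single_le_sum (fun i _ => abs_nonneg (x i)) (Finset.mem_univ i)
    linarith [neg_abs_le (x i)]
  · intro n
    exact ⟨fun _ => Set.Ioi (-(n : ℝ)), fun i _ => ⟨_, rfl⟩, rfl⟩
  · intro n
    exact measure_ne_top _ _
  · rintro _ ⟨t, ht, rfl⟩
    choose s hs using fun i => ht i (Set.mem_univ i)
    have : t = fun i => Set.Ioi (s i) := by funext i; exact (hs i).symm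
    rw [this]
    exact h s

theorem expMeasure_Ioi {r : ℝ} (hr : 0 < r) (s : ℝ) :
    expMeasure r (Set.Ioi s) = ENNReal.ofReal (Real.exp (-r * max s 0)) := by
  have := ProbabilityTheory.isProbabilityMeasure_expMeasure hr
  have h1 : expMeasure r (Set.Iic s) = ENNReal.ofReal (1 - Real.exp (-r * max s 0)) := by
    have := ProbabilityTheory.cdf_expMeasure_eq hr s
    rw [ProbabilityTheory.cdf_eq_real, measureReal_def] at this
    rw [← ENNReal.ofReal_toReal (measure_ne_top (expMeasure r) (Set.Iic s)), this]
    congr 1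
    split_ifs with h
    · rw [max_eq_left h]; ring_nf
    · rw [max_eq_right (not_le.1 h).le]; simp
  rw [← Set.compl_Iic, prob_compl_eq_one_sub measurableSet_Iic, h1, ← ENNReal.ofReal_one,
    ← ENNReal.ofReal_sub _ (by
      rw [sub_nonneg]
      exact Real.exp_le_one_iff.2 (by nlinarith [le_max_right s 0]))]
  congr 1
  ring

theorem lintegral_expMeasure (r : ℝ) (f : ℝ → ℝ≥0∞) :
    ∫⁻ s, f s ∂expMeasure r =
      ∫⁻ s in Set.Ioi 0, ENNReal.ofReal (r * Real.exp (-r * s)) * f s := by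
  have h0 : expMeasure r = volume.withDensity (ProbabilityTheory.exponentialPDF r) := rfl
  have hm : Measurable (ProbabilityTheory.exponentialPDF r) :=
    (ProbabilityTheory.measurable_exponentialPDFReal r).ennreal_ofReal
  rw [h0, lintegral_withDensity_eq_lintegral_mul_non_measurable _ hm
    (ae_of_all _ fun x => ENNReal.ofReal_lt_top), ← lintegral_indicator measurableSet_Ioi]
  refine lintegral_congr_ae ?_
  have : ∀ᵐ x : ℝ, x ≠ 0 := by simp [ae_iff]
  filter_upwards [this] with x hx
  by_cases h : 0 < x
  · rw [Set.indicator_of_mem (Set.mem_Ioi.2 h), Pi.mul_apply,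
      ProbabilityTheory.exponentialPDF_of_nonneg h.le]
    simp
  · rw [Set.indicator_of_notMem (by simpa using h), Pi.mul_apply,
      ProbabilityTheory.exponentialPDF_of_neg (lt_of_le_of_ne (not_lt.1 h) hx), zero_mul]

/-- An independent coordinate may be drawn afresh. This puts the integral over the last holding time
innermost. -/
theorem lintegral_pi_resample {N : ℕ} (μ : Fin N → Measure ℝ) [∀ i, IsProbabilityMeasure (μ i)]
    (i : Fin N) {f : (Fin N → ℝ) → ℝ≥0∞} (hf : Measurable f) :
    ∫⁻ x, f x ∂Measure.pi μ = ∫⁻ x, ∫⁻ s, f (Function.update x i s) ∂μ i ∂Measure.pi μ := by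
  rw [← lmarginal_singleton]
  refine lintegral_eq_of_lmarginal_eq {i} hf (hf.lmarginal μ) ?_
  funext x
  rw [lmarginal_singleton, lmarginal_singleton]
  simp

theorem lintegral_eq_tsum_fiber {Ω ι : Type*} [MeasurableSpace Ω] [Countable ι]
    (P : Measure Ω) {Z : Ω → ι} (hZ : ∀ z, MeasurableSet {ω | Z ω = z}) (f : Ω → ℝ≥0∞) :
    ∫⁻ ω, f ω ∂P = ∑' z, ∫⁻ ω in {ω | Z ω = z}, f ω ∂P := by
  rw [← lintegral_iUnion hZ, ← setLIntegral_univ]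
  · congr 2
    ext ω
    simp
  · intro a b hab
    refine Set.disjoint_left.2 fun ω h1 h2 => hab ?_
    exact h1.symm.trans h2

/-! ### The jump chain -/

section Jump
variable {lam mu : ℕ → ℝ}

theorem bdJumpProb_nonneg (hlam : ∀ x, 0 < lam x) (hmu : ∀ x, 0 ≤ mu x) (x y : ℕ) :
    0 ≤ bdJumpProb lam mu x y := by
  have := hlam x
  have := hmu x
  unfold bdJumpProb
  split_ifs <;> positivity

/-- At x = 0 the truncated x - 1 is a spurious state, but its coefficient vanishes with `mu 0`. -/
theorem tsum_bdJumpProb (hmu0 : mu 0 = 0) (x : ℕ) (f : ℕ → ℝ≥0∞) :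
    ∑' y, ENNReal.ofReal (bdJumpProb lam mu x y) * f y =
      ENNReal.ofReal (lam x / (lam x + mu x)) * f (x + 1) +
        ENNReal.ofReal (mu x / (lam x + mu x)) * f (x - 1) := by
  rcases Nat.eq_zero_or_pos x with rfl | hx
  · rw [tsum_eq_single 1]
    · simp [bdJumpProb, hmu0]
    · intro y hy
      simp [bdJumpProb, hy]
  · rw [tsum_eq_sum (s := {x + 1, x - 1}), Finset.sum_pair (by omega)]
    · congr 2
      · simp [bdJumpProb]
      · simp [bdJumpProb, Nat.sub_add_cancel hx, show x - 1 ≠ x + 1 by omega]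
    · intro y hy
      simp only [Finset.mem_insert, Finset.mem_singleton, not_or] at hy
      simp [bdJumpProb, hy.1, show y + 1 ≠ x by omega]

theorem tsum_bdJumpProb_one (hlam : ∀ x, 0 < lam x) (hmu : ∀ x, 0 ≤ mu x) (hmu0 : mu 0 = 0)
    (x : ℕ) : ∑' y, ENNReal.ofReal (bdJumpProb lam mu x y) = 1 := by
  have := tsum_bdJumpProb (lam := lam) hmu0 x (fun _ => 1)
  simp only [mul_one] at this
  have h1 := hlam x
  have h2 := hmu x
  rw [this, ← ENNReal.ofReal_add (by positivity) (by positivity), ← add_div, div_self (by positivity),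
    ENNReal.ofReal_one]

end Jump

/-! ### Joint law of states and holding times -/

section Law
variable {Ω : Type*} [MeasurableSpace Ω] {P : Measure Ω}
  {lam mu : ℕ → ℝ} {Y : ℕ → Ω → ℕ} {S : ℕ → Ω → ℝ}

def statePrefix (Y : ℕ → Ω → ℕ) (n : ℕ) (y : ℕ → ℕ) : Set Ω := {ω | ∀ i ≤ n, Y i ω = y i}

/-- Lets a finite tuple be used where a sequence is expected; the padding value is never seen by
functions of the first N entries. -/
def extendZero {α : Type*} [Zero α] {N : ℕ} (z : Fin N → α) (i : ℕ) : α :=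
  if h : i < N then z ⟨i, h⟩ else 0

theorem measurableSet_statePrefix (H : IsBDJumpHold P lam mu Y S) (n : ℕ) (y : ℕ → ℕ) :
    MeasurableSet (statePrefix Y n y) := by
  have : statePrefix Y n y = ⋂ i, ⋂ _ : i ≤ n, Y i ⁻¹' {y i} := by
    ext ω; simp [statePrefix]
  rw [this]
  exact MeasurableSet.iInter fun i => MeasurableSet.iInter fun _ =>
    H.measurable_state i (measurableSet_singleton _)

theorem fiber_eq_statePrefix {α : Type*} {Y : ℕ → α → ℕ} (n : ℕ) (z : Fin (n + 1) → ℕ) :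
    {ω | (fun i : Fin (n + 1) => Y i ω) = z} = statePrefix Y n (extendZero z) := by
  ext ω
  simp only [Set.mem_ofPred_eq, statePrefix, funext_iff]
  constructor
  · intro h i hi
    rw [extendZero, dif_pos (Nat.lt_succ_of_le hi)]
    exact h ⟨i, _⟩
  · intro h i
    rw [h i (Nat.le_of_lt_succ i.2), extendZero, dif_pos i.2]

theorem measure_statePrefix_eq_zero (H : IsBDJumpHold P lam mu Y S) {n : ℕ} {y : ℕ → ℕ}
    (hy : y 0 ≠ 0) : P (statePrefix Y n y) = 0 := by
  refine measure_mono_null ?_ (ae_iff.1 H.start)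
  intro ω hω h
  exact hy ((hω 0 (Nat.zero_le n)).symm.trans h)

theorem measure_statePrefix_pos (H : IsBDJumpHold P lam mu Y S) (n : ℕ) (y : ℕ → ℕ)
    (hy : y 0 = 0) : P (statePrefix Y n y ∩ {ω | ∀ i ≤ n, 0 < S i ω}) =
      ENNReal.ofReal (∏ i ∈ Finset.range n, bdJumpProb lam mu (y i) (y (i + 1))) := by
  have := H.law n y 0 hy (fun i => le_rfl)
  simp only [Pi.zero_apply, mul_zero, Real.exp_zero, Finset.prod_const_one, mul_one] at this
  rw [← this]
  congr 1
  ext ω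
  simp only [statePrefix, Set.mem_inter_iff, Set.mem_ofPred_eq]
  exact ⟨fun h i hi => ⟨h.1 i hi, h.2 i hi⟩, fun h => ⟨fun i hi => (h i hi).1, fun i hi => (h i hi).2⟩⟩

variable [IsProbabilityMeasure P]

/-- Taking all thresholds 0 in `law` gives the mass of a state prefix together with positive holding
times. Summing over the next state shows that requiring one more positive holding time loses no
mass, because the jump probabilities sum to 1. -/
theorem ae_hold_pos (hlam : ∀ x, 0 < lam x) (hmu : ∀ x, 0 ≤ mu x) (hmu0 : mu 0 = 0)
    (H : IsBDJumpHold P lam mu Y S) : ∀ᵐ ω ∂P, ∀ i, 0 < S i ω := by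
  have hposm : ∀ n, MeasurableSet {ω | ∀ i ≤ n, 0 < S i ω} := by
    intro n
    have : {ω | ∀ i ≤ n, 0 < S i ω} = ⋂ i, ⋂ _ : i ≤ n, S i ⁻¹' Set.Ioi 0 := by
      ext ω; simp
    rw [this]
    exact MeasurableSet.iInter fun i => MeasurableSet.iInter fun _ =>
      H.measurable_hold i measurableSet_Ioi
  have key : ∀ n, ∀ᵐ ω ∂P, ∀ i ≤ n, 0 < S i ω := by
    intro n
    induction n with
    | zero =>
      have h1 := measure_statePrefix_pos H 0 0 rfl
      simp only [Finset.range_zero, Finset.prod_empty, ENNReal.ofReal_one] at h1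
      have h2 : P {ω | ∀ i ≤ 0, 0 < S i ω} = 1 :=
        le_antisymm prob_le_one (h1 ▸ measure_mono Set.inter_subset_right)
      exact (prob_compl_eq_zero_iff (hposm 0)).2 h2
    | succ n ih =>
      have hz : ∀ z : Fin (n + 1) → ℕ, ∀ᵐ ω ∂P, (fun i : Fin (n + 1) => Y i ω) = z →
          ∀ i ≤ n + 1, 0 < S i ω := by
        intro z
        set y := extendZero z with hydef
        by_cases hy : y 0 = 0
        swap
        · have := measure_statePrefix_eq_zero H (n := n) hy
          rw [← fiber_eq_statePrefix] at this
          filter_upwards [compl_mem_ae_iff.2 this] with ω hω h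
          exact absurd h hω
        have e1 := measure_statePrefix_pos H n y hy
        have e2 : P (statePrefix Y n y ∩ {ω | ∀ i ≤ n + 1, 0 < S i ω}) =
            ENNReal.ofReal (∏ i ∈ Finset.range n, bdJumpProb lam mu (y i) (y (i + 1))) := by
          have hd : ∀ y', P (statePrefix Y n y ∩ {ω | ∀ i ≤ n + 1, 0 < S i ω} ∩ {ω | Y (n + 1) ω = y'})
              = ENNReal.ofReal (∏ i ∈ Finset.range n, bdJumpProb lam mu (y i) (y (i + 1))) *
                ENNReal.ofReal (bdJumpProb lam mu (y n) y') := by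
            intro y'
            have h3 := measure_statePrefix_pos H (n + 1) (Function.update y (n + 1) y')
              (by simp [Function.update_of_ne, hy])
            rw [Finset.prod_range_succ, ENNReal.ofReal_mul (Finset.prod_nonneg fun i _ =>
              bdJumpProb_nonneg hlam hmu _ _)] at h3
            rw [Finset.prod_congr rfl (g := fun i => bdJumpProb lam mu (y i) (y (i + 1)))] at h3
            · rw [Function.update_self, Function.update_of_ne (by omega)] at h3
              rw [← h3]
              congr 1
              ext ω
              simp only [statePrefix, Set.mem_inter_iff, Set.mem_ofPred_eq]
              constructor
              · rintro ⟨⟨a, b⟩, c⟩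
                refine ⟨fun i hi => ?_, b⟩
                rcases Nat.lt_or_ge n i with h | h
                · obtain rfl : i = n + 1 := by omega
                  simpa using c
                · rw [Function.update_of_ne (by omega)]
                  exact a i h
              · rintro ⟨a, b⟩
                refine ⟨⟨fun i hi => ?_, b⟩, ?_⟩
                · rw [a i (by omega), Function.update_of_ne (by omega)]
                · simpa using a (n + 1) le_rfl
            · intro i hi
              have := Finset.mem_range.1 hi
              rw [Function.update_of_ne (by omega), Function.update_of_ne (by omega)]
          have hsum : P (statePrefix Y n y ∩ {ω | ∀ i ≤ n + 1, 0 < S i ω}) =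
              ∑' y', P (statePrefix Y n y ∩ {ω | ∀ i ≤ n + 1, 0 < S i ω} ∩ {ω | Y (n + 1) ω = y'}) := by
            rw [← measure_iUnion]
            · congr 1
              ext ω
              simp
            · intro a b hab
              refine Set.disjoint_left.2 fun ω h1 h2 => hab ?_
              exact (h1.2 : Y (n + 1) ω = a).symm.trans h2.2
            · intro y'
              exact ((measurableSet_statePrefix H n y).inter (hposm _)).inter
                (H.measurable_state _ (measurableSet_singleton y'))
          rw [hsum, tsum_congr hd, ENNReal.tsum_mul_left, tsum_bdJumpProb_one hlam hmu hmu0, mul_one]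
        -- The two nested events have equal finite mass, so their difference is null.
        have e3 : P ((statePrefix Y n y ∩ {ω | ∀ i ≤ n, 0 < S i ω}) \
            (statePrefix Y n y ∩ {ω | ∀ i ≤ n + 1, 0 < S i ω})) = 0 := by
          rw [measure_sdiff _ ((measurableSet_statePrefix H n y).inter (hposm _)).nullMeasurableSet
            (measure_ne_top _ _), e1, e2, tsub_self]
          exact Set.inter_subset_inter_right _ fun ω h i hi => h i (by omega)
        filter_upwards [compl_mem_ae_iff.2 e3, ih] with ω h1 h2 h3
        have h4 : ω ∈ statePrefix Y n y := by
          rw [hydef, ← fiber_eq_statePrefix]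
          exact h3
        by_contra hcon
        exact h1 ⟨⟨h4, h2⟩, fun h => hcon h.2⟩
      rw [← ae_all_iff] at hz
      filter_upwards [hz] with ω h
      exact h _ rfl
  filter_upwards [ae_all_iff.2 key] with ω h i
  exact h i i le_rfl

/-- `law` covers only nonnegative thresholds. Almost sure positivity of the holding times lets every
negative corner of a box be replaced by 0, and `expMeasure_Ioi` does the same on the exponential
side. -/
theorem map_hold_eq (hlam : ∀ x, 0 < lam x) (hmu : ∀ x, 0 ≤ mu x) (hmu0 : mu 0 = 0)
    (H : IsBDJumpHold P lam mu Y S) {n : ℕ} {y : ℕ → ℕ} {A : Set Ω} {c : ℝ}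
    (hc : 0 ≤ c)
    (hbox : ∀ s : ℕ → ℝ, (∀ i, 0 ≤ s i) → P (A ∩ {ω | ∀ i ≤ n, s i < S i ω}) =
      ENNReal.ofReal (c * ∏ i ∈ Finset.range (n + 1), Real.exp (-(lam (y i) + mu (y i)) * s i))) :
    (P.restrict A).map (fun ω (i : Fin (n + 1)) => S i ω) =
      ENNReal.ofReal c • Measure.pi fun i : Fin (n + 1) => expMeasure (lam (y i) + mu (y i)) := by
  have hr : ∀ x, 0 < lam x + mu x := fun x => add_pos_of_pos_of_nonneg (hlam x) (hmu x)
  have : ∀ i : Fin (n + 1), IsProbabilityMeasure (expMeasure (lam (y i) + mu (y i))) :=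
    fun i => ProbabilityTheory.isProbabilityMeasure_expMeasure (hr _)
  have hSm : Measurable (fun ω (i : Fin (n + 1)) => S i ω) :=
    measurable_pi_lambda _ fun i => H.measurable_hold i
  refine measure_ext_of_boxes fun s => ?_
  have hbm : MeasurableSet (Set.univ.pi fun i => Set.Ioi (s i)) :=
    MeasurableSet.univ_pi fun i => measurableSet_Ioi
  rw [Measure.map_apply hSm hbm, Measure.restrict_apply (hSm hbm), Measure.smul_apply, Measure.pi_pi,
    smul_eq_mul]
  have h1 := hbox (fun i => max (extendZero s i) 0) (fun i => le_max_right _ _)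
  have h2 : P ((fun ω (i : Fin (n + 1)) => S i ω) ⁻¹' (Set.univ.pi fun i => Set.Ioi (s i)) ∩ A) =
      P (A ∩ {ω | ∀ i ≤ n, max (extendZero s i) 0 < S i ω}) := by
    refine measure_congr ?_
    filter_upwards [ae_hold_pos hlam hmu hmu0 H] with ω hω
    refine propext ⟨fun h => ⟨h.2, fun i hi => ?_⟩, fun h => ⟨fun i _ => ?_, h.1⟩⟩
    · have := h.1 ⟨i, Nat.lt_succ_of_le hi⟩ (Set.mem_univ _)
      refine max_lt ?_ (hω i)
      rw [extendZero, dif_pos (Nat.lt_succ_of_le hi)]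
      exact this
    · have := (max_lt_iff.1 (h.2 i (Nat.le_of_lt_succ i.2))).1
      rwa [extendZero, dif_pos i.2] at this
  rw [h2, h1, ENNReal.ofReal_mul hc, ENNReal.ofReal_prod_of_nonneg fun i _ => (Real.exp_pos _).le,
    ← Fin.prod_univ_eq_prod_range
      (fun i => ENNReal.ofReal (Real.exp (-(lam (y i) + mu (y i)) * max (extendZero s i) 0)))]
  congr 1
  refine Finset.prod_congr rfl fun i _ => ?_
  rw [expMeasure_Ioi (hr _), extendZero, dif_pos i.2]

theorem map_hold_statePrefix (hlam : ∀ x, 0 < lam x) (hmu : ∀ x, 0 ≤ mu x) (hmu0 : mu 0 = 0)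
    (H : IsBDJumpHold P lam mu Y S) (n : ℕ) {y : ℕ → ℕ} (hy : y 0 = 0) :
    (P.restrict (statePrefix Y n y)).map (fun ω (i : Fin (n + 1)) => S i ω) =
      ENNReal.ofReal (∏ i ∈ Finset.range n, bdJumpProb lam mu (y i) (y (i + 1))) •
        Measure.pi fun i : Fin (n + 1) => expMeasure (lam (y i) + mu (y i)) := by
  refine map_hold_eq hlam hmu hmu0 H
    (Finset.prod_nonneg fun i _ => bdJumpProb_nonneg hlam hmu _ _) fun s hs => ?_
  rw [← H.law n y s hy hs]
  congr 1
  ext ω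
  simp only [statePrefix, Set.mem_inter_iff, Set.mem_ofPred_eq]
  exact ⟨fun h i hi => ⟨h.1 i hi, h.2 i hi⟩, fun h => ⟨fun i hi => (h i hi).1, fun i hi => (h i hi).2⟩⟩

/-- Apply `law` with one more state and threshold 0 for its holding time: that constraint is almost
surely void. Hence, given the prefix, the next jump is independent of the holding times so far. -/
theorem map_hold_statePrefix_succ (hlam : ∀ x, 0 < lam x) (hmu : ∀ x, 0 ≤ mu x) (hmu0 : mu 0 = 0)
    (H : IsBDJumpHold P lam mu Y S) (n : ℕ) {y : ℕ → ℕ} (hy : y 0 = 0) (y' : ℕ) :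
    (P.restrict (statePrefix Y n y ∩ {ω | Y (n + 1) ω = y'})).map
        (fun ω (i : Fin (n + 1)) => S i ω) =
      ENNReal.ofReal ((∏ i ∈ Finset.range n, bdJumpProb lam mu (y i) (y (i + 1))) *
        bdJumpProb lam mu (y n) y') •
        Measure.pi fun i : Fin (n + 1) => expMeasure (lam (y i) + mu (y i)) := by
  refine map_hold_eq hlam hmu hmu0 H
    (mul_nonneg (Finset.prod_nonneg fun i _ => bdJumpProb_nonneg hlam hmu _ _)
      (bdJumpProb_nonneg hlam hmu _ _)) fun s hs => ?_
  set z := Function.update y (n + 1) y' with hz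
  set s' := Function.update s (n + 1) 0 with hs'
  have hzi : ∀ i ≤ n, z i = y i := fun i hi => Function.update_of_ne (by omega) _ _
  have hsi : ∀ i ≤ n, s' i = s i := fun i hi => Function.update_of_ne (by omega) _ _
  have hzn : z (n + 1) = y' := Function.update_self _ _ _
  have hsn : s' (n + 1) = 0 := Function.update_self _ _ _
  have hp1 : ∏ i ∈ Finset.range n, bdJumpProb lam mu (z i) (z (i + 1)) =
      ∏ i ∈ Finset.range n, bdJumpProb lam mu (y i) (y (i + 1)) :=
    Finset.prod_congr rfl fun i hi => by
      have := Finset.mem_range.1 hi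
      rw [hzi i (by omega), hzi (i + 1) (by omega)]
  have hp2 : ∏ i ∈ Finset.range (n + 1), Real.exp (-(lam (z i) + mu (z i)) * s' i) =
      ∏ i ∈ Finset.range (n + 1), Real.exp (-(lam (y i) + mu (y i)) * s i) :=
    Finset.prod_congr rfl fun i hi => by
      have := Finset.mem_range.1 hi
      rw [hzi i (by omega), hsi i (by omega)]
  have h1 := H.law (n + 1) z s' (by rw [hzi 0 (Nat.zero_le _), hy]) (fun i => by
    by_cases h : i = n + 1
    · rw [h, hsn]
    · rw [hs', Function.update_of_ne h]; exact hs i)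
  rw [Finset.prod_range_succ, Finset.prod_range_succ _ (n + 1), hsn, hzn, hzi n le_rfl, mul_zero,
    Real.exp_zero, mul_one, hp1, hp2] at h1
  rw [← h1]
  refine measure_congr ?_
  filter_upwards [ae_hold_pos hlam hmu hmu0 H] with ω hω
  refine propext ⟨fun h i hi => ?_, fun h => ⟨⟨fun i hi => ?_, ?_⟩, fun i hi => ?_⟩⟩
  · obtain ⟨⟨a, b⟩, c⟩ := h
    rcases Nat.lt_or_ge n i with h | h
    · obtain rfl : i = n + 1 := by omega
      rw [hzn, hsn]
      exact ⟨b, hω _⟩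
    · rw [hzi i h, hsi i h]
      exact ⟨a i h, c i h⟩
  · rw [← hzi i hi]; exact (h i (by omega)).1
  · rw [← hzn]; exact (h (n + 1) le_rfl).1
  · rw [← hsi i hi]; exact (h i (by omega)).2

/-- Given the first `n + 1` states and the first `n` holding times, the next holding time is
exponential and the next state is drawn independently from the jump chain. -/
theorem lintegral_next_step (hlam : ∀ x, 0 < lam x) (hmu : ∀ x, 0 ≤ mu x) (hmu0 : mu 0 = 0)
    (H : IsBDJumpHold P lam mu Y S) (n : ℕ) (Φ : (ℕ → ℕ) → (ℕ → ℝ) → ℝ → ℕ → ℝ≥0∞)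
    (hmeas : ∀ y y', Measurable fun q : (ℕ → ℝ) × ℝ => Φ y q.1 q.2 y')
    (hdep : ∀ y z σ σ', (∀ i ≤ n, y i = z i) → (∀ i < n, σ i = σ' i) → Φ y σ = Φ z σ') :
    ∫⁻ ω, Φ (fun i => Y i ω) (fun i => S i ω) (S n ω) (Y (n + 1) ω) ∂P =
      ∫⁻ ω, ∫⁻ s, ∑' y', ENNReal.ofReal (bdJumpProb lam mu (Y n ω) y') *
        Φ (fun i => Y i ω) (fun i => S i ω) s y' ∂expMeasure (lam (Y n ω) + mu (Y n ω)) ∂P := by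
  have hr : ∀ x, 0 < lam x + mu x := fun x => add_pos_of_pos_of_nonneg (hlam x) (hmu x)
  have hfib : ∀ z : Fin (n + 1) → ℕ, MeasurableSet {ω | (fun i : Fin (n + 1) => Y i ω) = z} :=
    fun z => by rw [fiber_eq_statePrefix]; exact measurableSet_statePrefix H _ _
  rw [lintegral_eq_tsum_fiber P hfib, lintegral_eq_tsum_fiber P hfib]
  refine tsum_congr fun z => ?_
  rw [fiber_eq_statePrefix]
  set y : ℕ → ℕ := extendZero z with hydef
  by_cases hy : y 0 = 0
  swap
  · rw [setLIntegral_measure_zero _ _ (measure_statePrefix_eq_zero H hy),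
      setLIntegral_measure_zero _ _ (measure_statePrefix_eq_zero H hy)]
  have : ∀ x, IsProbabilityMeasure (expMeasure (lam x + mu x)) :=
    fun x => ProbabilityTheory.isProbabilityMeasure_expMeasure (hr _)
  have hAm := measurableSet_statePrefix H n y
  set c : ℝ := ∏ i ∈ Finset.range n, bdJumpProb lam mu (y i) (y (i + 1)) with hc
  have hc0 : 0 ≤ c := Finset.prod_nonneg fun i _ => bdJumpProb_nonneg hlam hmu _ _
  have hSm : Measurable (fun ω (i : Fin (n + 1)) => S i ω) :=
    measurable_pi_lambda _ fun i => H.measurable_hold i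
  have hext : Measurable (extendZero : (Fin (n + 1) → ℝ) → ℕ → ℝ) := by
    refine measurable_pi_lambda _ fun i => ?_
    unfold extendZero
    by_cases h : i < n + 1
    · simp only [h, dif_pos]; exact measurable_pi_apply _
    · simp only [h, dif_neg, not_false_iff]; exact measurable_const
  set π : Measure (Fin (n + 1) → ℝ) :=
    Measure.pi fun i : Fin (n + 1) => expMeasure (lam (y i) + mu (y i)) with hπ
  have hextS : ∀ ω, ∀ i < n, S i ω = extendZero (fun i : Fin (n + 1) => S i ω) i := by
    intro ω i hi
    rw [extendZero, dif_pos (by omega)]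
  have hpiece : ∀ y', ∫⁻ ω in statePrefix Y n y ∩ {ω | Y (n + 1) ω = y'},
      Φ (fun i => Y i ω) (fun i => S i ω) (S n ω) (Y (n + 1) ω) ∂P =
      ENNReal.ofReal (c * bdJumpProb lam mu (y n) y') *
        ∫⁻ σ, ∫⁻ s, Φ y (extendZero σ) s y' ∂expMeasure (lam (y n) + mu (y n)) ∂π := by
    intro y'
    have hm1 : Measurable fun σ : Fin (n + 1) → ℝ => Φ y (extendZero σ) (σ (Fin.last n)) y' :=
      (hmeas y y').comp (hext.prodMk (measurable_pi_apply _))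
    have e1 : ∫⁻ ω in statePrefix Y n y ∩ {ω | Y (n + 1) ω = y'},
        Φ (fun i => Y i ω) (fun i => S i ω) (S n ω) (Y (n + 1) ω) ∂P =
        ∫⁻ ω in statePrefix Y n y ∩ {ω | Y (n + 1) ω = y'},
          (fun σ : Fin (n + 1) → ℝ => Φ y (extendZero σ) (σ (Fin.last n)) y')
            (fun i => S i ω) ∂P := by
      refine setLIntegral_congr_fun (hAm.inter (H.measurable_state _ (measurableSet_singleton y')))
        fun ω hω => ?_
      have h2 : Y (n + 1) ω = y' := hω.2
      simp only [h2, Fin.val_last]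
      rw [hdep _ y _ _ hω.1 (hextS ω)]
    rw [e1, ← lintegral_map hm1 hSm, map_hold_statePrefix_succ hlam hmu hmu0 H n hy y',
      lintegral_smul_measure, smul_eq_mul, lintegral_pi_resample _ (Fin.last n) hm1]
    congr 1
    refine lintegral_congr fun σ => ?_
    simp only [Fin.val_last]
    refine lintegral_congr fun s => ?_
    -- `Φ` reads only the holding times before index n through its second argument, so the resampled
    -- last coordinate enters only as `s`.
    rw [Function.update_self, hdep y y _ (extendZero σ) (fun _ _ => rfl)]
    intro i hi
    rw [extendZero, extendZero, dif_pos (by omega), dif_pos (by omega), Function.update_of_ne]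
    exact fun h => absurd (congrArg Fin.val h) (by simp; omega)
  have hmsum : Measurable fun q : (ℕ → ℝ) × ℝ =>
      ∑' y', ENNReal.ofReal (bdJumpProb lam mu (y n) y') * Φ y q.1 q.2 y' :=
    Measurable.tsum fun y' => (hmeas y y').const_mul _
  have hrhs : ∫⁻ ω in statePrefix Y n y, ∫⁻ s, ∑' y', ENNReal.ofReal (bdJumpProb lam mu (Y n ω) y') *
        Φ (fun i => Y i ω) (fun i => S i ω) s y' ∂expMeasure (lam (Y n ω) + mu (Y n ω)) ∂P =
      ENNReal.ofReal c * ∫⁻ σ, ∫⁻ s, ∑' y', ENNReal.ofReal (bdJumpProb lam mu (y n) y') *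
        Φ y (extendZero σ) s y' ∂expMeasure (lam (y n) + mu (y n)) ∂π := by
    have hm2 : Measurable fun σ : Fin (n + 1) → ℝ =>
        ∫⁻ s, ∑' y', ENNReal.ofReal (bdJumpProb lam mu (y n) y') *
        Φ y (extendZero σ) s y' ∂expMeasure (lam (y n) + mu (y n)) :=
      (hmsum.comp ((hext.comp measurable_fst).prodMk measurable_snd)).lintegral_prod_right'
    have e1 : ∫⁻ ω in statePrefix Y n y, ∫⁻ s, ∑' y', ENNReal.ofReal (bdJumpProb lam mu (Y n ω) y') *
        Φ (fun i => Y i ω) (fun i => S i ω) s y' ∂expMeasure (lam (Y n ω) + mu (Y n ω)) ∂P =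
        ∫⁻ ω in statePrefix Y n y, (fun σ : Fin (n + 1) → ℝ =>
        ∫⁻ s, ∑' y', ENNReal.ofReal (bdJumpProb lam mu (y n) y') *
        Φ y (extendZero σ) s y' ∂expMeasure (lam (y n) + mu (y n))) (fun i => S i ω) ∂P := by
      refine setLIntegral_congr_fun hAm fun ω hω => ?_
      have h2 : Y n ω = y n := hω n le_rfl
      simp only [h2]
      rw [hdep _ y _ _ hω (hextS ω)]
    rw [e1, ← lintegral_map hm2 hSm, map_hold_statePrefix hlam hmu hmu0 H n hy,
      lintegral_smul_measure, smul_eq_mul]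
  rw [hrhs, lintegral_eq_tsum_fiber (P.restrict (statePrefix Y n y)) (Z := Y (n + 1))
    (fun y' => H.measurable_state _ (measurableSet_singleton y'))]
  have e2 : ∀ y', ∫⁻ ω in {ω | Y (n + 1) ω = y'},
      Φ (fun i => Y i ω) (fun i => S i ω) (S n ω) (Y (n + 1) ω) ∂P.restrict (statePrefix Y n y) =
      ENNReal.ofReal c * (ENNReal.ofReal (bdJumpProb lam mu (y n) y') *
        ∫⁻ σ, ∫⁻ s, Φ y (extendZero σ) s y' ∂expMeasure (lam (y n) + mu (y n)) ∂π) := by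
    intro y'
    have hms : MeasurableSet {ω | Y (n + 1) ω = y'} :=
      H.measurable_state _ (measurableSet_singleton y')
    rw [Measure.restrict_restrict hms, Set.inter_comm]
    rw [hpiece y', ENNReal.ofReal_mul hc0, mul_assoc]
  rw [tsum_congr e2, ENNReal.tsum_mul_left]
  congr 1
  have hm3 : ∀ y', Measurable fun q : (Fin (n + 1) → ℝ) × ℝ =>
      ENNReal.ofReal (bdJumpProb lam mu (y n) y') * Φ y (extendZero q.1) q.2 y' := fun y' =>
    ((hmeas y y').comp ((hext.comp measurable_fst).prodMk measurable_snd)).const_mul _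
  have e3 : ∀ σ : Fin (n + 1) → ℝ,
      ∫⁻ s, ∑' y', ENNReal.ofReal (bdJumpProb lam mu (y n) y') *
        Φ y (extendZero σ) s y' ∂expMeasure (lam (y n) + mu (y n)) =
      ∑' y', ∫⁻ s, ENNReal.ofReal (bdJumpProb lam mu (y n) y') *
        Φ y (extendZero σ) s y' ∂expMeasure (lam (y n) + mu (y n)) := fun σ =>
    lintegral_tsum fun y' => ((hm3 y').comp measurable_prodMk_left).aemeasurable
  rw [lintegral_congr e3, lintegral_tsum fun y' => ((hm3 y').lintegral_prod_right').aemeasurable]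
  refine tsum_congr fun y' => ?_
  have hm4 : Measurable fun q : (Fin (n + 1) → ℝ) × ℝ => Φ y (extendZero q.1) q.2 y' :=
    (hmeas y y').comp ((hext.comp measurable_fst).prodMk measurable_snd)
  rw [← lintegral_const_mul _ hm4.lintegral_prod_right']
  refine lintegral_congr fun σ => ?_
  exact (lintegral_const_mul _ (hm4.comp measurable_prodMk_left)).symm

end Law

/-! ### Backward operator and Feynman-Kac formula -/

/-- Iterates of the backward (Feynman-Kac) integral operator of a birth-death process on `[t, T]`,
with multiplicative weights `m` of the sojourns and terminal weight `e`. -/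
noncomputable def fkIter (lam mu : ℕ → ℝ) (m : ℕ → ℝ → ℝ → ℝ≥0∞) (e : ℕ → ℝ≥0∞) (T : ℝ) :
    ℕ → ℕ → ℝ → ℝ≥0∞
  | 0, _, _ => 0
  | n + 1, x, t => m x t T * e x * ENNReal.ofReal (Real.exp (-(lam x + mu x) * (T - t))) +
      ∫⁻ s in Set.Ioc t T, ENNReal.ofReal (Real.exp (-(lam x + mu x) * (s - t))) * m x t s *
        (ENNReal.ofReal (lam x) * fkIter lam mu m e T n (x + 1) s +
          ENNReal.ofReal (mu x) * fkIter lam mu m e T n (x - 1) s)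

/-- The product of the weights of the first `i` sojourns. -/
noncomputable def pathWeight (m : ℕ → ℝ → ℝ → ℝ≥0∞) (y : ℕ → ℕ) (σ : ℕ → ℝ) (i : ℕ) : ℝ≥0∞ :=
  ∏ j ∈ Finset.range i, m (y j) (∑ a ∈ Finset.range j, σ a) (∑ a ∈ Finset.range (j + 1), σ a)

open Classical in
/-- The weight of a path with exactly `i` jumps up to time `T`, zero for the other paths. -/
noncomputable def fkTerm (m : ℕ → ℝ → ℝ → ℝ≥0∞) (e : ℕ → ℝ≥0∞) (T : ℝ) (y : ℕ → ℕ) (σ : ℕ → ℝ)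
    (i : ℕ) : ℝ≥0∞ :=
  if ∑ a ∈ Finset.range i, σ a ≤ T ∧ T < ∑ a ∈ Finset.range (i + 1), σ a then
    pathWeight m y σ i * (m (y i) (∑ a ∈ Finset.range i, σ a) T * e (y i)) else 0

section FK
variable {lam mu : ℕ → ℝ} {m : ℕ → ℝ → ℝ → ℝ≥0∞} {e : ℕ → ℝ≥0∞} {T : ℝ}

theorem measurable_fkIter (hm : ∀ x, Measurable fun q : ℝ × ℝ => m x q.1 q.2) (n x : ℕ) :
    Measurable (fkIter lam mu m e T n x) := by
  induction n generalizing x with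
  | zero => exact measurable_const
  | succ n ih =>
    have h1 : Measurable fun t => m x t T :=
      (hm x).comp (measurable_id.prodMk measurable_const)
    have h2 : Measurable fun t : ℝ => ENNReal.ofReal (Real.exp (-(lam x + mu x) * (T - t))) := by
      fun_prop
    have h3 : Measurable fun q : ℝ × ℝ =>
        ENNReal.ofReal (Real.exp (-(lam x + mu x) * (q.2 - q.1))) * m x q.1 q.2 *
        (ENNReal.ofReal (lam x) * fkIter lam mu m e T n (x + 1) q.2 +
          ENNReal.ofReal (mu x) * fkIter lam mu m e T n (x - 1) q.2) := by
      refine Measurable.mul (Measurable.mul (by fun_prop) (hm x)) (Measurable.add ?_ ?_)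
      · exact ((ih (x + 1)).comp measurable_snd).const_mul _
      · exact ((ih (x - 1)).comp measurable_snd).const_mul _
    -- The domain of integration depends on t, so it is encoded as a jointly measurable set in (t,
    -- s).
    have hs : MeasurableSet {q : ℝ × ℝ | q.1 < q.2 ∧ q.2 ≤ T} :=
      (measurableSet_lt measurable_fst measurable_snd).inter
        (measurableSet_le measurable_snd measurable_const)
    have h4 := (h3.indicator hs).lintegral_prod_right' (ν := volume)
    have h5 : fkIter lam mu m e T (n + 1) x = fun t =>
        m x t T * e x * ENNReal.ofReal (Real.exp (-(lam x + mu x) * (T - t))) +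
        ∫⁻ s, Set.indicator {q : ℝ × ℝ | q.1 < q.2 ∧ q.2 ≤ T} (fun q : ℝ × ℝ =>
        ENNReal.ofReal (Real.exp (-(lam x + mu x) * (q.2 - q.1))) * m x q.1 q.2 *
        (ENNReal.ofReal (lam x) * fkIter lam mu m e T n (x + 1) q.2 +
          ENNReal.ofReal (mu x) * fkIter lam mu m e T n (x - 1) q.2)) (t, s) := by
      funext t
      rw [fkIter, ← lintegral_indicator measurableSet_Ioc]
      rfl
    rw [h5]
    exact ((h1.mul_const _).mul h2).add h4

theorem measurable_pathWeight (hm : ∀ x, Measurable fun q : ℝ × ℝ => m x q.1 q.2) (y : ℕ → ℕ)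
    (i : ℕ) : Measurable fun σ => pathWeight m y σ i := by
  unfold pathWeight
  refine Finset.measurable_prod _ fun j _ => ?_
  have h1 : ∀ j, Measurable fun σ : ℕ → ℝ => ∑ a ∈ Finset.range j, σ a :=
    fun j => Finset.measurable_sum _ fun a _ => measurable_pi_apply a
  exact (hm (y j)).comp ((h1 j).prodMk (h1 (j + 1)))

theorem fkIter_mono (n x : ℕ) (t : ℝ) :
    fkIter lam mu m e T n x t ≤ fkIter lam mu m e T (n + 1) x t := by
  induction n generalizing x t with
  | zero => exact zero_le
  | succ n ih =>
    rw [fkIter, fkIter]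
    gcongr
    · exact ih _ _
    · exact ih _ _

-- Either the sojourn outlives T, with reward `a`, or a jump occurs at time t + s. The factor r of
-- the exponential density cancels the denominator of the jump probabilities, which turns them into
-- the rates `lam x` and `mu x`.
open Classical in
theorem lintegral_one_step (hlam : ∀ x, 0 < lam x) (hmu : ∀ x, 0 ≤ mu x) (hmu0 : mu 0 = 0)
    (u : ℕ → ℝ → ℝ≥0∞) (w : ℝ → ℝ≥0∞) (a : ℝ≥0∞) (x : ℕ) {t : ℝ} (ht : t ≤ T) :
    ∫⁻ s, ∑' y', ENNReal.ofReal (bdJumpProb lam mu x y') *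
        (if T < t + s then a else w (t + s) * u y' (t + s)) ∂expMeasure (lam x + mu x) =
      a * ENNReal.ofReal (Real.exp (-(lam x + mu x) * (T - t))) +
      ∫⁻ s in Set.Ioc t T, ENNReal.ofReal (Real.exp (-(lam x + mu x) * (s - t))) * w s *
        (ENNReal.ofReal (lam x) * u (x + 1) s + ENNReal.ofReal (mu x) * u (x - 1) s) := by
  have hr : 0 < lam x + mu x := add_pos_of_pos_of_nonneg (hlam x) (hmu x)
  set r := lam x + mu x with hrdef
  set g : ℝ → ℝ≥0∞ := fun s => ENNReal.ofReal (lam x / r) * u (x + 1) s +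
    ENNReal.ofReal (mu x / r) * u (x - 1) s with hg
  have h1 : ∀ s, ∑' y', ENNReal.ofReal (bdJumpProb lam mu x y') *
      (if T < t + s then a else w (t + s) * u y' (t + s)) =
      (Set.Ioi (T - t)).indicator (fun _ => a) s +
      (Set.Iic (T - t)).indicator (fun s => w (t + s) * g (t + s)) s := by
    intro s
    by_cases hs : T < t + s
    · have h2 : s ∈ Set.Ioi (T - t) := Set.mem_Ioi.2 (by linarith)
      have h3 : s ∉ Set.Iic (T - t) := fun h => absurd (Set.mem_Iic.1 h) (by linarith)
      rw [Set.indicator_of_mem h2, Set.indicator_of_notMem h3]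
      simp only [hs, if_true]
      rw [ENNReal.tsum_mul_right, tsum_bdJumpProb_one hlam hmu hmu0, one_mul, add_zero]
    · have h2 : s ∉ Set.Ioi (T - t) := fun h => hs (by linarith [Set.mem_Ioi.1 h])
      have h3 : s ∈ Set.Iic (T - t) := Set.mem_Iic.2 (by linarith)
      rw [Set.indicator_of_notMem h2, Set.indicator_of_mem h3]
      simp only [hs, if_false]
      rw [tsum_bdJumpProb hmu0 x (fun y' => w (t + s) * u y' (t + s))]
      simp only [hg, zero_add]
      ring
  rw [lintegral_congr h1, lintegral_add_left (measurable_const.indicator measurableSet_Ioi),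
    lintegral_indicator_const measurableSet_Ioi, expMeasure_Ioi hr, max_eq_left (by linarith)]
  congr 1
  rw [lintegral_expMeasure, ← lintegral_indicator measurableSet_Ioi,
    ← lintegral_indicator measurableSet_Ioc]
  refine Eq.trans ?_ (lintegral_add_right_eq_self _ t)
  refine lintegral_congr fun s => ?_
  have hmem : s + t ∈ Set.Ioc t T ↔ s ∈ Set.Ioi (0 : ℝ) ∧ s ∈ Set.Iic (T - t) := by
    simp only [Set.mem_Ioc, Set.mem_Ioi, Set.mem_Iic]
    constructor <;> rintro ⟨h, h'⟩ <;> constructor <;> linarith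
  by_cases hs : s + t ∈ Set.Ioc t T
  · rw [Set.indicator_of_mem hs, Set.indicator_of_mem (hmem.1 hs).1,
      Set.indicator_of_mem (hmem.1 hs).2]
    have h5 : ENNReal.ofReal (r * Real.exp (-r * s)) =
        ENNReal.ofReal r * ENNReal.ofReal (Real.exp (-r * s)) := ENNReal.ofReal_mul hr.le
    have h6 : ENNReal.ofReal (lam x) = ENNReal.ofReal r * ENNReal.ofReal (lam x / r) := by
      rw [← ENNReal.ofReal_mul hr.le, mul_div_cancel₀ _ hr.ne']
    have h7 : ENNReal.ofReal (mu x) = ENNReal.ofReal r * ENNReal.ofReal (mu x / r) := by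
      rw [← ENNReal.ofReal_mul hr.le, mul_div_cancel₀ _ hr.ne']
    rw [h5, h6, h7, add_sub_cancel_right, add_comm t s]
    simp only [hg]
    ring
  · rw [Set.indicator_of_notMem hs]
    by_cases h0 : s ∈ Set.Ioi (0 : ℝ)
    · rw [Set.indicator_of_mem h0, Set.indicator_of_notMem fun h => hs (hmem.2 ⟨h0, h⟩), mul_zero]
    · rw [Set.indicator_of_notMem h0]

variable {Ω : Type*} [MeasurableSpace Ω] {P : Measure Ω}
  {Y : ℕ → Ω → ℕ} {S : ℕ → Ω → ℝ}

/-- The state prefixes are countable, so it suffices that `F` is measurable in the holding times for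
each frozen prefix. -/
theorem measurable_comp_path (H : IsBDJumpHold P lam mu Y S) (n : ℕ) (F : (ℕ → ℕ) → (ℕ → ℝ) → ℝ≥0∞)
    (hF : ∀ y, Measurable (F y)) (hdep : ∀ y z, (∀ i ≤ n, y i = z i) → F y = F z) :
    Measurable fun ω => F (fun i => Y i ω) (fun i => S i ω) := by
  have h1 : Measurable fun q : (Fin (n + 1) → ℕ) × (ℕ → ℝ) => F (extendZero q.1) q.2 :=
    measurable_from_prod_countable_right fun z => hF (extendZero z)
  have h2 : (fun ω => F (fun i => Y i ω) (fun i => S i ω)) =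
      (fun q : (Fin (n + 1) → ℕ) × (ℕ → ℝ) => F (extendZero q.1) q.2) ∘
        fun ω => (fun i : Fin (n + 1) => Y i ω, fun i => S i ω) := by
    funext ω
    simp only [Function.comp]
    rw [hdep _ (extendZero fun i : Fin (n + 1) => Y i ω)]
    intro i hi
    rw [extendZero, dif_pos (by omega)]
  rw [h2]
  have h3 : Measurable fun ω (i : Fin (n + 1)) => Y i ω :=
    measurable_pi_lambda _ fun i => H.measurable_state i
  have h4 : Measurable fun ω i => S i ω := measurable_pi_lambda _ fun i => H.measurable_hold i
  exact h1.comp (h3.prodMk h4)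

theorem pathWeight_congr {y z : ℕ → ℕ} {σ σ' : ℕ → ℝ} {i : ℕ} (h : ∀ j < i, y j = z j)
    (h' : ∀ j < i, σ j = σ' j) : pathWeight m y σ i = pathWeight m z σ' i := by
  unfold pathWeight
  refine Finset.prod_congr rfl fun j hj => ?_
  have hj' := Finset.mem_range.1 hj
  have hs : ∀ k ≤ i, ∑ a ∈ Finset.range k, σ a = ∑ a ∈ Finset.range k, σ' a := fun k hk =>
    Finset.sum_congr rfl fun a ha => h' a (by have := Finset.mem_range.1 ha; omega)
  rw [h j hj', hs j (by omega), hs (j + 1) (by omega)]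

theorem measurable_sum_range (n : ℕ) : Measurable fun σ : ℕ → ℝ => ∑ a ∈ Finset.range n, σ a :=
  Finset.measurable_sum _ fun a _ => measurable_pi_apply a

theorem measurable_fkTerm (hm : ∀ x, Measurable fun q : ℝ × ℝ => m x q.1 q.2) (y : ℕ → ℕ)
    (i : ℕ) : Measurable fun σ => fkTerm m e T y σ i := by
  unfold fkTerm
  refine Measurable.ite ?_ ?_ measurable_const
  · exact (measurableSet_le (measurable_sum_range i) measurable_const).inter
      (measurableSet_lt measurable_const (measurable_sum_range (i + 1)))
  · exact (measurable_pathWeight hm y i).mul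
      (((hm (y i)).comp ((measurable_sum_range i).prodMk measurable_const)).mul_const _)

theorem measurable_fkTerm_path (hm : ∀ x, Measurable fun q : ℝ × ℝ => m x q.1 q.2)
    (H : IsBDJumpHold P lam mu Y S) (i : ℕ) :
    Measurable fun ω => fkTerm m e T (fun j => Y j ω) (fun j => S j ω) i := by
  refine measurable_comp_path H i (fun y σ => fkTerm m e T y σ i)
    (fun y => measurable_fkTerm hm y i) fun y z h => ?_
  funext σ
  unfold fkTerm
  rw [h i le_rfl, pathWeight_congr (fun j hj => h j hj.le) (fun _ _ => rfl)]

variable [IsProbabilityMeasure P]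

-- After i jumps the expected weight still to come is the k-th iterate at the current state and jump
-- time. One step of the chain splits off the paths with exactly i jumps by T and leaves the same
-- expression with k - 1 and i + 1.
open Classical in
theorem lintegral_pathWeight_fkIter (hlam : ∀ x, 0 < lam x) (hmu : ∀ x, 0 ≤ mu x) (hmu0 : mu 0 = 0)
    (hm : ∀ x, Measurable fun q : ℝ × ℝ => m x q.1 q.2)
    (H : IsBDJumpHold P lam mu Y S) (k i : ℕ) :
    ∫⁻ ω, (if ∑ a ∈ Finset.range i, S a ω ≤ T then
        pathWeight m (fun j => Y j ω) (fun j => S j ω) i *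
          fkIter lam mu m e T k (Y i ω) (∑ a ∈ Finset.range i, S a ω) else 0) ∂P =
      ∑ j ∈ Finset.range k,
        ∫⁻ ω, fkTerm m e T (fun j => Y j ω) (fun j => S j ω) (i + j) ∂P := by
  induction k generalizing i with
  | zero => simp [fkIter]
  | succ k ih =>
    -- The integrand with the next holding time and the next state as separate arguments, the form
    -- needed for `lintegral_next_step`.
    set Φ : (ℕ → ℕ) → (ℕ → ℝ) → ℝ → ℕ → ℝ≥0∞ := fun y σ s y' =>
      if ∑ a ∈ Finset.range i, σ a ≤ T then
        pathWeight m y σ i * (if T < ∑ a ∈ Finset.range i, σ a + s then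
          m (y i) (∑ a ∈ Finset.range i, σ a) T * e (y i)
        else m (y i) (∑ a ∈ Finset.range i, σ a) (∑ a ∈ Finset.range i, σ a + s) *
          fkIter lam mu m e T k y' (∑ a ∈ Finset.range i, σ a + s)) else 0 with hΦ
    have hτ : Measurable fun q : (ℕ → ℝ) × ℝ => ∑ a ∈ Finset.range i, q.1 a :=
      (measurable_sum_range i).comp measurable_fst
    have hτs : Measurable fun q : (ℕ → ℝ) × ℝ => ∑ a ∈ Finset.range i, q.1 a + q.2 :=
      hτ.add measurable_snd
    have hmeas : ∀ y y', Measurable fun q : (ℕ → ℝ) × ℝ => Φ y q.1 q.2 y' := by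
      intro y y'
      refine Measurable.ite (measurableSet_le hτ measurable_const) ?_ measurable_const
      refine ((measurable_pathWeight hm y i).comp measurable_fst).mul ?_
      refine Measurable.ite (measurableSet_lt measurable_const hτs) ?_ ?_
      · exact ((hm (y i)).comp (hτ.prodMk measurable_const)).mul_const _
      · exact ((hm (y i)).comp (hτ.prodMk hτs)).mul ((measurable_fkIter hm k y').comp hτs)
    have hdep : ∀ y z σ σ', (∀ j ≤ i, y j = z j) → (∀ j < i, σ j = σ' j) → Φ y σ = Φ z σ' := by
      intro y z σ σ' h1 h2
      have hs : ∑ a ∈ Finset.range i, σ a = ∑ a ∈ Finset.range i, σ' a :=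
        Finset.sum_congr rfl fun a ha => h2 a (Finset.mem_range.1 ha)
      simp only [hΦ, hs, h1 i le_rfl, pathWeight_congr (fun j hj => h1 j (le_of_lt hj)) h2]
    have hstep := lintegral_next_step hlam hmu hmu0 H i Φ hmeas hdep
    have hR : ∀ ω, ∫⁻ s, ∑' y', ENNReal.ofReal (bdJumpProb lam mu (Y i ω) y') *
        Φ (fun i => Y i ω) (fun i => S i ω) s y' ∂expMeasure (lam (Y i ω) + mu (Y i ω)) =
        if ∑ a ∈ Finset.range i, S a ω ≤ T then
        pathWeight m (fun j => Y j ω) (fun j => S j ω) i *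
          fkIter lam mu m e T (k + 1) (Y i ω) (∑ a ∈ Finset.range i, S a ω) else 0 := by
      intro ω
      by_cases hle : ∑ a ∈ Finset.range i, S a ω ≤ T
      · simp only [hΦ, hle, if_true]
        rw [fkIter, ← lintegral_one_step hlam hmu hmu0 (fkIter lam mu m e T k)
          (fun s => m (Y i ω) (∑ a ∈ Finset.range i, S a ω) s) _ _ hle]
        rw [← lintegral_const_mul]
        · refine lintegral_congr fun s => ?_
          rw [← ENNReal.tsum_mul_left]
          refine tsum_congr fun y' => ?_
          rw [mul_left_comm]
        · refine Measurable.tsum fun y' => Measurable.const_mul ?_ _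
          have hts : Measurable fun s : ℝ => ∑ a ∈ Finset.range i, S a ω + s :=
            measurable_const.add measurable_id
          refine Measurable.ite (measurableSet_lt measurable_const hts) measurable_const ?_
          exact ((hm _).comp (measurable_const.prodMk hts)).mul
            ((measurable_fkIter hm k y').comp hts)
      · simp [hΦ, hle]
    rw [← lintegral_congr hR, ← hstep]
    -- Positivity of the holding time is used here: a jump time below T forces the preceding one
    -- below T, so the two alternatives are disjoint and exhaustive.
    have hL : ∀ᵐ ω ∂P, Φ (fun i => Y i ω) (fun i => S i ω) (S i ω) (Y (i + 1) ω) =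
        fkTerm m e T (fun j => Y j ω) (fun j => S j ω) i +
        if ∑ a ∈ Finset.range (i + 1), S a ω ≤ T then
        pathWeight m (fun j => Y j ω) (fun j => S j ω) (i + 1) *
          fkIter lam mu m e T k (Y (i + 1) ω) (∑ a ∈ Finset.range (i + 1), S a ω) else 0 := by
      filter_upwards [ae_hold_pos hlam hmu hmu0 H] with ω hω
      have hS := hω i
      simp only [hΦ, fkTerm, ← Finset.sum_range_succ (fun a => S a ω) i]
      have hlt : ∑ a ∈ Finset.range i, S a ω < ∑ a ∈ Finset.range (i + 1), S a ω := by
        rw [Finset.sum_range_succ]; linarith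
      by_cases h1 : ∑ a ∈ Finset.range (i + 1), S a ω ≤ T
      · have h2 : ∑ a ∈ Finset.range i, S a ω ≤ T := by linarith
        simp only [h1, h2, not_lt.2 h1, if_true, if_false, and_false, zero_add]
        rw [pathWeight, pathWeight, Finset.prod_range_succ, mul_assoc]
      · by_cases h2 : ∑ a ∈ Finset.range i, S a ω ≤ T
        · simp only [h1, h2, not_le.1 h1, if_true, if_false, and_self, add_zero]
        · simp [h1, h2]
    rw [lintegral_congr_ae hL, lintegral_add_left (measurable_fkTerm_path hm H i), ih (i + 1),
      Finset.sum_range_succ', add_comm, add_zero]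
    congr 1
    refine Finset.sum_congr rfl fun j _ => ?_
    rw [show i + 1 + j = i + (j + 1) by ring]

/-- The Feynman-Kac formula: the expected weight of the paths with fewer than `k` jumps. -/
theorem sum_lintegral_fkTerm (hlam : ∀ x, 0 < lam x) (hmu : ∀ x, 0 ≤ mu x) (hmu0 : mu 0 = 0)
    (hm : ∀ x, Measurable fun q : ℝ × ℝ => m x q.1 q.2) (hT : 0 ≤ T)
    (H : IsBDJumpHold P lam mu Y S) (k : ℕ) :
    ∑ j ∈ Finset.range k, ∫⁻ ω, fkTerm m e T (fun j => Y j ω) (fun j => S j ω) j ∂P =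
      fkIter lam mu m e T k 0 0 := by
  have h := lintegral_pathWeight_fkIter (e := e) (T := T) hlam hmu hmu0 hm H k 0
  simp only [zero_add] at h
  rw [← h]
  have h2 : ∀ᵐ ω ∂P, (if ∑ a ∈ Finset.range 0, S a ω ≤ T then
        pathWeight m (fun j => Y j ω) (fun j => S j ω) 0 *
          fkIter lam mu m e T k (Y 0 ω) (∑ a ∈ Finset.range 0, S a ω) else 0) =
      fkIter lam mu m e T k 0 0 := by
    filter_upwards [H.start] with ω hω
    simp [pathWeight, hω, hT]
  rw [lintegral_congr_ae h2]
  simp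

end FK

/-! ### Exponential tilting -/

section Upper
variable {lam mu : ℕ → ℝ}

/-- Difference of the total jump rates of the process and of the tilted process, whose birth rates
are multiplied and whose death rates are divided by `r`. -/
noncomputable def tiltRate (lam mu : ℕ → ℝ) (r : ℝ) (x : ℕ) : ℝ :=
  lam x + mu x - lam x * r - mu x / r

/-- Along a path from 0, each birth contributes r and each death 1/r to the density of the tilted
process. The product of these sojourn weights, times r to the power of the final state, is that
density. -/
noncomputable def tiltWeight (lam mu : ℕ → ℝ) (r : ℝ) (x : ℕ) (t u : ℝ) : ℝ≥0∞ :=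
  ENNReal.ofReal (Real.exp (tiltRate lam mu r x * (u - t)))

theorem setLIntegral_exp {a t b : ℝ} (ha : 0 ≤ a) (htb : t ≤ b) :
    ∫⁻ s in Set.Ioc t b, ENNReal.ofReal (a * Real.exp (-a * (s - t))) =
      ENNReal.ofReal (1 - Real.exp (-a * (b - t))) := by
  have hd : ∀ s : ℝ, HasDerivAt (fun s => -Real.exp (-a * (s - t)))
      (a * Real.exp (-a * (s - t))) s := by
    intro s
    have h1 : HasDerivAt (fun s : ℝ => -a * (s - t)) (-a * 1) s :=
      ((hasDerivAt_id s).sub_const t).const_mul (-a)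
    exact h1.exp.neg.congr_deriv (by ring)
  have hcont : Continuous fun s : ℝ => a * Real.exp (-a * (s - t)) := by fun_prop
  have hint := intervalIntegral.integral_eq_sub_of_hasDerivAt (a := t) (b := b)
    (fun s _ => hd s) (hcont.intervalIntegrable _ _)
  rw [← ofReal_integral_eq_lintegral_ofReal
    ((intervalIntegrable_iff_integrableOn_Ioc_of_le htb).1 (hcont.intervalIntegrable t b))
    (ae_of_all _ fun s => by positivity), ← intervalIntegral.integral_of_le htb, hint]
  simp [sub_eq_neg_add, add_comm]

/-- The function r^x is an exact fixed point: λ r^(x+1) + μ r^(x-1) is r^x times the tilted total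
rate a, and each sojourn weight turns the survival factor at rate λ + μ into the one at rate a. The
iterates start from 0 and the operator is monotone. -/
theorem fkIter_tilt_le (hlam : ∀ x, 0 < lam x) (hmu : ∀ x, 0 ≤ mu x) (hmu0 : mu 0 = 0) {r T : ℝ}
    (hr : 0 < r) (n x : ℕ) {t : ℝ} (ht : t ≤ T) :
    fkIter lam mu (tiltWeight lam mu r) (fun x => ENNReal.ofReal (r ^ x)) T n x t ≤
      ENNReal.ofReal (r ^ x) := by
  induction n generalizing x t with
  | zero => exact zero_le
  | succ n ih =>
    set a := lam x * r + mu x / r with ha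
    have ha0 : 0 ≤ a := by have := hlam x; have := hmu x; positivity
    have h1 : ∀ s, ENNReal.ofReal (Real.exp (-(lam x + mu x) * (s - t))) * tiltWeight lam mu r x t s =
        ENNReal.ofReal (Real.exp (-a * (s - t))) := by
      intro s
      rw [tiltWeight, ← ENNReal.ofReal_mul (Real.exp_pos _).le, ← Real.exp_add, tiltRate, ha]
      congr 2
      ring
    have h2 : ENNReal.ofReal (lam x) * ENNReal.ofReal (r ^ (x + 1)) +
        ENNReal.ofReal (mu x) * ENNReal.ofReal (r ^ (x - 1)) =
        ENNReal.ofReal a * ENNReal.ofReal (r ^ x) := by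
      rw [← ENNReal.ofReal_mul (hlam x).le, ← ENNReal.ofReal_mul (hmu x), ← ENNReal.ofReal_mul ha0,
        ← ENNReal.ofReal_add (mul_nonneg (hlam x).le (pow_nonneg hr.le _))
          (mul_nonneg (hmu x) (pow_nonneg hr.le _))]
      congr 1
      rcases Nat.eq_zero_or_pos x with rfl | hx
      · simp [ha, hmu0]
      · obtain ⟨y, rfl⟩ : ∃ y, x = y + 1 := ⟨x - 1, by omega⟩
        simp only [Nat.add_sub_cancel, ha]
        field_simp
        ring
    rw [fkIter]
    calc _ ≤ ENNReal.ofReal (r ^ x) * ENNReal.ofReal (Real.exp (-a * (T - t))) +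
          ∫⁻ s in Set.Ioc t T, ENNReal.ofReal (a * Real.exp (-a * (s - t))) *
            ENNReal.ofReal (r ^ x) := by
          refine add_le_add (le_of_eq ?_) (setLIntegral_mono' measurableSet_Ioc fun s hs => ?_)
          · rw [← h1 T]; ring
          · rw [h1 s, ENNReal.ofReal_mul ha0, mul_comm (ENNReal.ofReal a), mul_assoc, ← h2]
            gcongr
            · exact ih _ hs.2
            · exact ih _ hs.2
      _ ≤ ENNReal.ofReal (r ^ x) * ENNReal.ofReal (Real.exp (-a * (T - t))) +
          ENNReal.ofReal (1 - Real.exp (-a * (T - t))) * ENNReal.ofReal (r ^ x) := by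
          rw [lintegral_mul_const _ (by fun_prop)]
          rw [setLIntegral_exp ha0 ht]
      _ = ENNReal.ofReal (r ^ x) := by
          rw [mul_comm, ← add_mul, ← ENNReal.ofReal_add (Real.exp_pos _).le]
          · simp
          · rw [sub_nonneg, Real.exp_le_one_iff]
            nlinarith [mul_nonneg ha0 (sub_nonneg.2 ht)]

end Upper

/-! ### Minimal solution and comparison with subsolutions -/

section Lower
variable {lam mu : ℕ → ℝ} {m : ℕ → ℝ → ℝ → ℝ≥0∞} {e : ℕ → ℝ≥0∞} {T : ℝ}

/-- The minimal solution of the backward Feynman-Kac equation. -/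
noncomputable def fkLimit (lam mu : ℕ → ℝ) (m : ℕ → ℝ → ℝ → ℝ≥0∞) (e : ℕ → ℝ≥0∞) (T : ℝ)
    (x : ℕ) (t : ℝ) : ℝ≥0∞ := ⨆ n, fkIter lam mu m e T n x t

theorem fkLimit_eq (hm : ∀ x, Measurable fun q : ℝ × ℝ => m x q.1 q.2) (x : ℕ) (t : ℝ) :
    fkLimit lam mu m e T x t =
      m x t T * e x * ENNReal.ofReal (Real.exp (-(lam x + mu x) * (T - t))) +
      ∫⁻ s in Set.Ioc t T, ENNReal.ofReal (Real.exp (-(lam x + mu x) * (s - t))) * m x t s *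
        (ENNReal.ofReal (lam x) * fkLimit lam mu m e T (x + 1) s +
          ENNReal.ofReal (mu x) * fkLimit lam mu m e T (x - 1) s) := by
  have hmono : ∀ x t, Monotone fun n => fkIter lam mu m e T n x t := fun x t =>
    monotone_nat_of_le_succ fun n => fkIter_mono n x t
  have h1 : fkLimit lam mu m e T x t = ⨆ n, fkIter lam mu m e T (n + 1) x t :=
    ((hmono x t).iSup_nat_add 1).symm
  have hmx : ∀ t, Measurable fun s => m x t s := fun t =>
    (hm x).comp (measurable_const.prodMk measurable_id)
  rw [h1]
  simp_rw [fkIter]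
  rw [← ENNReal.add_iSup]
  congr 1
  rw [← lintegral_iSup]
  · refine lintegral_congr fun s => ?_
    rw [← ENNReal.mul_iSup, ← ENNReal.iSup_add_iSup_of_monotone, ← ENNReal.mul_iSup, ← ENNReal.mul_iSup]
    · rfl
    · exact fun a b hab => mul_le_mul_right (hmono _ _ hab) _
    · exact fun a b hab => mul_le_mul_right (hmono _ _ hab) _
  · intro n
    refine Measurable.mul (Measurable.mul (by fun_prop) (hmx t)) (Measurable.add ?_ ?_)
    · exact (measurable_fkIter hm n _).const_mul _
    · exact (measurable_fkIter hm n _).const_mul _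
  · intro a b hab s
    dsimp only
    gcongr
    · exact hmono _ _ hab
    · exact hmono _ _ hab

/-- Lack of memory: a sojourn that survives until b is restarted there. Only an inequality is
obtained, since the weight of the full sojourn is merely assumed to be at least that of its part
after b. -/
theorem restart_le_fkLimit (hm : ∀ x, Measurable fun q : ℝ × ℝ => m x q.1 q.2) {x : ℕ} {t b : ℝ}
    (htb : t ≤ b) (hbT : b ≤ T) (hK : ∀ w, b ≤ w → w ≤ T → m x b w ≤ m x t w) :
    ENNReal.ofReal (Real.exp (-(lam x + mu x) * (b - t))) * fkLimit lam mu m e T x b +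
      ∫⁻ s in Set.Ioc t b, ENNReal.ofReal (Real.exp (-(lam x + mu x) * (s - t))) * m x t s *
        (ENNReal.ofReal (lam x) * fkLimit lam mu m e T (x + 1) s +
          ENNReal.ofReal (mu x) * fkLimit lam mu m e T (x - 1) s) ≤
      fkLimit lam mu m e T x t := by
  have hexp : ∀ s, ENNReal.ofReal (Real.exp (-(lam x + mu x) * (b - t))) *
      ENNReal.ofReal (Real.exp (-(lam x + mu x) * (s - b))) =
      ENNReal.ofReal (Real.exp (-(lam x + mu x) * (s - t))) := by
    intro s
    rw [← ENNReal.ofReal_mul (Real.exp_pos _).le, ← Real.exp_add]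
    congr 2
    ring
  rw [fkLimit_eq hm x t, fkLimit_eq hm x b, mul_add, ← Set.Ioc_union_Ioc_eq_Ioc htb hbT,
    lintegral_union measurableSet_Ioc (Set.Ioc_disjoint_Ioc_of_le le_rfl), add_assoc,
    add_comm (∫⁻ s in Set.Ioc t b, _)]
  refine add_le_add ?_ (add_le_add_left ?_ _)
  · rw [← hexp T, mul_left_comm]
    gcongr
    exact hK T hbT le_rfl
  · rw [← lintegral_const_mul' _ _ ENNReal.ofReal_ne_top]
    refine setLIntegral_mono' measurableSet_Ioc fun s hs => ?_
    rw [← hexp s, ← mul_assoc, ← mul_assoc]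
    gcongr
    exact hK s hs.1.le hs.2

/-- Comparison: a bounded subsolution of the backward equation that vanishes outside of `D` lies
below the minimal solution, as long as sojourns in `D` carry full weight. -/
theorem le_fkLimit_of_subsolution (hlam : ∀ x, 0 < lam x) (hmu : ∀ x, 0 ≤ mu x)
    (hm : ∀ x, Measurable fun q : ℝ × ℝ => m x q.1 q.2)
    {D : Set ℕ} {a b H M : ℝ} (hbT : b ≤ T)
    (hone : ∀ x ∈ D, ∀ t s, a ≤ t → t ≤ s → s ≤ b → m x t s = 1)
    (hK : ∀ x ∈ D, ∀ t w, a ≤ t → t ≤ b → b ≤ w → w ≤ T → m x b w ≤ m x t w)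
    (φ φ' : ℕ → ℝ → ℝ) (hφ0 : ∀ x, ∀ t ∈ Set.Icc a b, 0 ≤ φ x t) (hφD : ∀ x ∉ D, ∀ t, φ x t = 0)
    (hφM : ∀ x, ∀ t ∈ Set.Icc a b, φ x t ≤ M)
    (hderiv : ∀ x ∈ D, ∀ t, HasDerivAt (φ x) (φ' x t) t) (hcont : ∀ x ∈ D, Continuous (φ' x))
    (hsub : ∀ x ∈ D, ∀ t ∈ Set.Icc a b,
      -φ' x t ≤ lam x * φ (x + 1) t + mu x * φ (x - 1) t - (lam x + mu x) * φ x t)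
    (hH : ∀ x ∈ D, lam x + mu x ≤ H) (hend : ∀ x ∈ D, ENNReal.ofReal (φ x b) ≤ fkLimit lam mu m e T x b)
    {x : ℕ} (hx : x ∈ D) {t : ℝ} (ht : t ∈ Set.Icc a b) :
    ENNReal.ofReal (φ x t) ≤ fkLimit lam mu m e T x t := by
  have hH0 : 0 ≤ H := (add_nonneg (hlam x).le (hmu x)).trans (hH x hx)
  have hM0 : 0 ≤ M := (hφ0 x t ht).trans (hφM x t ht)
  have hφc : ∀ x, Continuous (φ x) := by
    intro x
    by_cases h : x ∈ D
    · exact continuous_iff_continuousAt.2 fun t => (hderiv x h t).continuousAt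
    · rw [show φ x = fun _ => 0 from funext (hφD x h)]
      exact continuous_const
  -- A Picard argument: each use of the backward inequality integrates the error once more against a
  -- total rate at most H, so after n rounds only a term of the exponential series remains.
  have key : ∀ n : ℕ, ∀ x, ∀ t ∈ Set.Icc a b, ENNReal.ofReal (φ x t) ≤
      fkLimit lam mu m e T x t + ENNReal.ofReal (M * (H * (b - t)) ^ n / n.factorial) := by
    intro n
    induction n with
    | zero =>
      intro x t ht
      refine le_add_left (ENNReal.ofReal_le_ofReal ?_)
      simpa using hφM x t ht
    | succ n ih =>
      intro x t ht
      by_cases hx : x ∈ D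
      swap
      · rw [hφD x hx]; simp
      set h := lam x + mu x with hh
      have hh0 : 0 ≤ h := add_nonneg (hlam x).le (hmu x)
      set G : ℝ → ℝ := fun s => Real.exp (-h * (s - t)) *
        (lam x * φ (x + 1) s + mu x * φ (x - 1) s) with hG
      have hGc : Continuous G := by
        have := hφc (x + 1)
        have := hφc (x - 1)
        fun_prop
      have hG0 : ∀ s ∈ Set.Ioc t b, 0 ≤ G s := by
        intro s hs
        have hs' : s ∈ Set.Icc a b := ⟨ht.1.trans hs.1.le, hs.2⟩
        have := hφ0 (x + 1) s hs'
        have := hφ0 (x - 1) s hs'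
        have := (hlam x).le
        have := hmu x
        positivity
      -- Variation of constants: integrate the derivative of exp(-h(s - t)) φ(x, s) over [t, b] and
      -- use the subsolution inequality.
      have hreal : φ x t ≤ Real.exp (-h * (b - t)) * φ x b + ∫ s in t..b, G s := by
        have hd : ∀ s ∈ Set.uIcc t b, HasDerivAt (fun s => Real.exp (-h * (s - t)) * φ x s)
            (Real.exp (-h * (s - t)) * (φ' x s - h * φ x s)) s := by
          intro s _
          have h1 : HasDerivAt (fun s : ℝ => -h * (s - t)) (-h * 1) s :=
            ((hasDerivAt_id s).sub_const t).const_mul (-h)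
          exact (h1.exp.mul (hderiv x hx s)).congr_deriv (by ring)
        have hc : Continuous fun s => Real.exp (-h * (s - t)) * (φ' x s - h * φ x s) := by
          have := hcont x hx
          have := hφc x
          fun_prop
        have hint := intervalIntegral.integral_eq_sub_of_hasDerivAt hd (hc.intervalIntegrable _ _)
        have hmono : ∫ s in t..b, -(Real.exp (-h * (s - t)) * (φ' x s - h * φ x s)) ≤
            ∫ s in t..b, G s := by
          refine intervalIntegral.integral_mono_on ht.2 (hc.neg.intervalIntegrable _ _)
            (hGc.intervalIntegrable _ _) fun s hs => ?_
          have := hsub x hx s ⟨ht.1.trans hs.1, hs.2⟩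
          rw [hG, ← mul_neg]
          exact mul_le_mul_of_nonneg_left (by linarith) (Real.exp_pos _).le
        rw [intervalIntegral.integral_neg, hint] at hmono
        simp only [sub_self, mul_zero, Real.exp_zero, one_mul] at hmono
        linarith
      have hGl : ENNReal.ofReal (∫ s in t..b, G s) = ∫⁻ s in Set.Ioc t b, ENNReal.ofReal (G s) := by
        rw [intervalIntegral.integral_of_le ht.2, ofReal_integral_eq_lintegral_ofReal
          ((intervalIntegrable_iff_integrableOn_Ioc_of_le ht.2).1 (hGc.intervalIntegrable t b))
          ((ae_restrict_iff' measurableSet_Ioc).2 (ae_of_all _ hG0))]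
      set err : ℝ → ℝ := fun s => M * (H * (b - s)) ^ n / n.factorial with herr
      have herrI : ∫⁻ s in Set.Ioc t b, ENNReal.ofReal (H * err s) =
          ENNReal.ofReal (M * (H * (b - t)) ^ (n + 1) / (n + 1).factorial) := by
        have hd : ∀ s ∈ Set.uIcc t b, HasDerivAt
            (fun s => -(M * (H * (b - s)) ^ (n + 1) / (n + 1).factorial)) (H * err s) s := by
          intro s _
          have h1 : HasDerivAt (fun s : ℝ => H * (b - s)) (H * -1) s :=
            ((hasDerivAt_id s).const_sub b).const_mul H
          refine (((h1.pow (n + 1)).const_mul M).div_const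
            ((n + 1).factorial : ℝ)).neg.congr_deriv ?_
          rw [herr, Nat.factorial_succ]
          push_cast
          field_simp
        have hc : Continuous fun s => H * err s := by rw [herr]; fun_prop
        have hint := intervalIntegral.integral_eq_sub_of_hasDerivAt hd (hc.intervalIntegrable _ _)
        rw [← ofReal_integral_eq_lintegral_ofReal
          ((intervalIntegrable_iff_integrableOn_Ioc_of_le ht.2).1 (hc.intervalIntegrable t b))
          ((ae_restrict_iff' measurableSet_Ioc).2 (ae_of_all _ fun s hs => ?_)),
          ← intervalIntegral.integral_of_le ht.2, hint]
        · simp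
        · have : 0 ≤ b - s := sub_nonneg.2 hs.2
          simp only [herr, Pi.zero_apply]
          positivity
      refine le_trans ?_ (add_le_add_left (restart_le_fkLimit (e := e) hm ht.2 hbT
        (fun w h1 h2 => hK x hx t w ht.1 ht.2 h1 h2)) _)
      rw [← herrI]
      refine (ENNReal.ofReal_le_ofReal hreal).trans (ENNReal.ofReal_add_le.trans ?_)
      rw [add_assoc, hGl, ENNReal.ofReal_mul (Real.exp_pos _).le]
      refine add_le_add (mul_le_mul_right (hend x hx) _) ?_
      rw [← lintegral_add_right _ (by rw [herr]; fun_prop)]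
      refine setLIntegral_mono' measurableSet_Ioc fun s hs => ?_
      have hs' : s ∈ Set.Icc a b := ⟨ht.1.trans hs.1.le, hs.2⟩
      have he1 : ENNReal.ofReal (Real.exp (-h * (s - t))) ≤ 1 := by
        rw [← ENNReal.ofReal_one]
        refine ENNReal.ofReal_le_ofReal (Real.exp_le_one_iff.2 ?_)
        nlinarith [mul_nonneg hh0 (sub_nonneg.2 hs.1.le)]
      rw [hone x hx t s ht.1 hs.1.le hs.2, mul_one, hG, ENNReal.ofReal_mul (Real.exp_pos _).le,
        ENNReal.ofReal_add (mul_nonneg (hlam x).le (hφ0 _ s hs')) (mul_nonneg (hmu x) (hφ0 _ s hs')),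
        ENNReal.ofReal_mul (hlam x).le, ENNReal.ofReal_mul (hmu x)]
      calc _ ≤ ENNReal.ofReal (Real.exp (-h * (s - t))) *
            (ENNReal.ofReal (lam x) * (fkLimit lam mu m e T (x + 1) s + ENNReal.ofReal (err s)) +
            ENNReal.ofReal (mu x) * (fkLimit lam mu m e T (x - 1) s + ENNReal.ofReal (err s))) := by
            gcongr
            · exact ih _ s hs'
            · exact ih _ s hs'
        _ = ENNReal.ofReal (Real.exp (-h * (s - t))) *
            (ENNReal.ofReal (lam x) * fkLimit lam mu m e T (x + 1) s +
            ENNReal.ofReal (mu x) * fkLimit lam mu m e T (x - 1) s) +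
            ENNReal.ofReal (Real.exp (-h * (s - t))) * (ENNReal.ofReal h * ENNReal.ofReal (err s)) := by
            rw [hh, ENNReal.ofReal_add (hlam x).le (hmu x)]
            ring
        _ ≤ _ := by
            rw [ENNReal.ofReal_mul hH0]
            refine add_le_add_right ((mul_le_mul_left he1 _).trans ?_) _
            rw [one_mul]
            gcongr
            exact hH x hx
  have hlim : Tendsto (fun n : ℕ => fkLimit lam mu m e T x t +
      ENNReal.ofReal (M * (H * (b - t)) ^ n / n.factorial)) atTop
      (𝓝 (fkLimit lam mu m e T x t + ENNReal.ofReal 0)) := by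
    refine Tendsto.add tendsto_const_nhds ((ENNReal.continuous_ofReal.tendsto 0).comp ?_)
    have := (FloorSemiring.tendsto_pow_div_factorial_atTop (H * (b - t))).const_mul M
    rw [mul_zero] at this
    refine this.congr fun n => ?_
    ring
  rw [ENNReal.ofReal_zero, add_zero] at hlim
  exact ge_of_tendsto' hlim fun n => key n x t ht

end Lower

/-! ### Subsolutions inside a tube -/

section Tube

open Classical in
/-- Indicator of the sojourns that remain within distance `ρ` of the curve `F`. -/
noncomputable def tubeWeight (F : ℝ → ℝ) (ρ : ℝ) (x : ℕ) (t u : ℝ) : ℝ≥0∞ :=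
  if ∀ v, t ≤ v → v ≤ u → |(x : ℝ) - F v| ≤ ρ then 1 else 0

variable {F : ℝ → ℝ} {ρ : ℝ}

theorem measurable_tubeWeight (hF : Continuous F) (x : ℕ) :
    Measurable fun q : ℝ × ℝ => tubeWeight F ρ x q.1 q.2 := by
  classical
  refine Measurable.ite ?_ measurable_const measurable_const
  -- Writing v = t + θ(u - t) makes the condition an intersection of closed sets; for u < t it is
  -- vacuous.
  have h1 : {q : ℝ × ℝ | ∀ v, q.1 ≤ v → v ≤ q.2 → |(x : ℝ) - F v| ≤ ρ} =
      {q : ℝ × ℝ | q.2 < q.1} ∪ ⋂ θ : Set.Icc (0 : ℝ) 1,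
        {q : ℝ × ℝ | |(x : ℝ) - F (q.1 + θ * (q.2 - q.1))| ≤ ρ} := by
    ext ⟨t, u⟩
    simp only [Set.mem_ofPred_eq, Set.mem_union, Set.mem_iInter]
    constructor
    · intro h
      rcases lt_or_ge u t with htu | htu
      · exact Or.inl htu
      · refine Or.inr fun ⟨θ, hθ0, hθ1⟩ => h _ ?_ ?_
        · have := mul_nonneg hθ0 (sub_nonneg.2 htu); simp only; linarith
        · have := mul_nonneg (sub_nonneg.2 hθ1) (sub_nonneg.2 htu); simp only; linarith
    · rintro (h | h) v h1 h2
      · exact absurd (h1.trans h2) (not_le.2 h)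
      · rcases (h1.trans h2).eq_or_lt with heq | hlt
        · have := h ⟨0, by simp⟩
          simp only [zero_mul, add_zero] at this
          rwa [show v = t by linarith]
        · have := h ⟨(v - t) / (u - t), div_nonneg (by linarith) (by linarith),
            (div_le_one (by linarith)).2 (by linarith)⟩
          simp only [div_mul_cancel₀ (v - t) (sub_pos.2 hlt).ne'] at this
          rwa [add_sub_cancel] at this
  rw [h1]
  refine (measurableSet_lt measurable_snd measurable_fst).union ?_
  refine (isClosed_iInter fun θ => isClosed_le ?_ continuous_const).measurableSet
  fun_prop

theorem tubeWeight_eq_one {x : ℕ} {t u : ℝ} (h : ∀ v, t ≤ v → v ≤ u → |(x : ℝ) - F v| ≤ ρ) :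
    tubeWeight F ρ x t u = 1 := if_pos h

theorem tubeWeight_le_of_prefix {x : ℕ} {t b w : ℝ}
    (h : ∀ v, t ≤ v → v ≤ b → |(x : ℝ) - F v| ≤ ρ) :
    tubeWeight F ρ x b w ≤ tubeWeight F ρ x t w := by
  unfold tubeWeight
  split_ifs with h1 h2
  · exact le_rfl
  · refine absurd (fun v hv1 hv2 => ?_) h2
    rcases le_total v b with hb | hb
    · exact h v hv1 hb
    · exact h1 v hb hv2
  · exact zero_le
  · exact le_rfl

variable {lam mu : ℕ → ℝ} {e : ℕ → ℝ≥0∞} {T : ℝ}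

/-- Lower bound for travelling quickly to a given site `z`. -/
theorem fkLimit_move_lower (hlam : ∀ x, 0 < lam x) (hmu : ∀ x, 0 ≤ mu x) (hF : Continuous F)
    {c₀ : ℝ} (hc₀ : 0 < c₀) (hlc : ∀ x, c₀ ≤ lam x) (hmc : ∀ x, 1 ≤ x → c₀ ≤ mu x)
    {lo hi z : ℕ} (hz : z ∈ Set.Icc lo hi) {a b H A : ℝ} (hab : a ≤ b) (hbT : b ≤ T)
    (htube : ∀ x ∈ Set.Icc lo hi, ∀ v, a ≤ v → v ≤ b → |(x : ℝ) - F v| ≤ ρ)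
    (hH : ∀ x ∈ Set.Icc lo hi, lam x + mu x ≤ H) (hA : 0 ≤ A)
    (hend : ENNReal.ofReal A ≤ fkLimit lam mu (tubeWeight F ρ) e T z b) {x : ℕ}
    (hx : x ∈ Set.Icc lo hi) :
    ENNReal.ofReal (A * (Real.exp (-H * (b - a)) *
        ((c₀ * (b - a)) ^ (x - z + (z - x)) / (x - z + (z - x)).factorial))) ≤
      fkLimit lam mu (tubeWeight F ρ) e T x a := by
  classical
  set d : ℕ → ℕ := fun x => x - z + (z - x) with hd
  -- A direct journey to `z` takes d jumps, each at rate at least `c₀`, while H bounds the total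
  -- rate. The resulting Poisson-like weight is a subsolution because one jump towards `z` lowers d
  -- by 1 and stays inside [lo, hi].
  set φ : ℕ → ℝ → ℝ := fun x t => if x ∈ Set.Icc lo hi then
    A * (Real.exp (-H * (b - t)) * ((c₀ * (b - t)) ^ (d x) / (d x).factorial)) else 0 with hφ
  set φ' : ℕ → ℝ → ℝ := fun x t =>
    A * (H * Real.exp (-H * (b - t)) * ((c₀ * (b - t)) ^ (d x) / (d x).factorial) +
      Real.exp (-H * (b - t)) * (-(d x * (c₀ * (b - t)) ^ (d x - 1) * c₀) / (d x).factorial)) with hφ'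
  have hin : ∀ x ∈ Set.Icc lo hi, ∀ t, φ x t =
    A * (Real.exp (-H * (b - t)) * ((c₀ * (b - t)) ^ (d x) / (d x).factorial)) :=
    fun x hx t => if_pos hx
  have hφ0 : ∀ x, ∀ t ∈ Set.Icc a b, 0 ≤ φ x t := by
    intro x t ht
    have : 0 ≤ b - t := sub_nonneg.2 ht.2
    simp only [hφ]
    split_ifs <;> positivity
  have h0 := le_fkLimit_of_subsolution (e := e) (M := A * Real.exp (c₀ * (b - a))) hlam hmu
    (measurable_tubeWeight (ρ := ρ) hF)
    (D := Set.Icc lo hi) (a := a) (H := H) hbT ?_ ?_ φ φ' hφ0 ?_ ?_ ?_ ?_ ?_ hH ?_ hx ⟨le_rfl, hab⟩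
  · rwa [hin x hx] at h0
  · exact fun x hx t s h1 h2 h3 => tubeWeight_eq_one fun v hv1 hv2 =>
      htube x hx v (h1.trans hv1) (hv2.trans h3)
  · exact fun x hx t w h1 h2 _ _ => tubeWeight_le_of_prefix fun v hv1 hv2 =>
      htube x hx v (h1.trans hv1) hv2
  · exact fun x hx t => if_neg hx
  · intro x t ht
    have hbt : 0 ≤ b - t := sub_nonneg.2 ht.2
    have hH0 : 0 ≤ H := (add_nonneg (hlam z).le (hmu z)).trans (hH z hz)
    by_cases hx : x ∈ Set.Icc lo hi
    · rw [hin x hx]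
      refine mul_le_mul_of_nonneg_left ?_ hA
      have h1 : Real.exp (-H * (b - t)) ≤ 1 := Real.exp_le_one_iff.2 (by nlinarith)
      have h2 : (c₀ * (b - t)) ^ (d x) / (d x).factorial ≤ Real.exp (c₀ * (b - t)) :=
        Real.pow_div_factorial_le_exp _ (by positivity) _
      have h3 : Real.exp (c₀ * (b - t)) ≤ Real.exp (c₀ * (b - a)) :=
        Real.exp_le_exp.2 (by nlinarith [ht.1])
      calc _ ≤ 1 * ((c₀ * (b - t)) ^ (d x) / (d x).factorial) :=
            mul_le_mul_of_nonneg_right h1 (by positivity)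
        _ ≤ _ := by rw [one_mul]; exact h2.trans h3
    · rw [show φ x t = 0 from if_neg hx]
      positivity
  · intro x hx t
    rw [show φ x = fun t => A * (Real.exp (-H * (b - t)) *
      ((c₀ * (b - t)) ^ (d x) / (d x).factorial)) from funext (hin x hx)]
    have h1 : HasDerivAt (fun s : ℝ => -H * (b - s)) (-H * -1) t :=
      ((hasDerivAt_id t).const_sub b).const_mul (-H)
    have h2 : HasDerivAt (fun s : ℝ => c₀ * (b - s)) (c₀ * -1) t :=
      ((hasDerivAt_id t).const_sub b).const_mul c₀
    refine ((h1.exp.mul ((h2.pow (d x)).div_const ((d x).factorial : ℝ))).const_mul A).congr_deriv ?_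
    simp only [hφ', Pi.pow_apply]
    ring
  · intro x _
    simp only [hφ']
    fun_prop
  · intro x hx t ht
    have hbt : 0 ≤ b - t := sub_nonneg.2 ht.2
    have hl := hlam x
    have hm := hmu x
    have hHx := hH x hx
    have hp1 := hφ0 (x + 1) t ht
    have hp2 := hφ0 (x - 1) t ht
    set E := Real.exp (-H * (b - t)) with hE
    have hE0 : 0 < E := Real.exp_pos _
    have hX : 0 ≤ A * (E * ((c₀ * (b - t)) ^ (d x) / (d x).factorial)) := by positivity
    rcases Nat.eq_zero_or_pos (d x) with h0 | h0
    · simp only [hφ', h0, hin x hx, pow_zero, Nat.factorial_zero, Nat.cast_one, Nat.cast_zero, ← hE]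
      have : 0 ≤ A * E := by positivity
      nlinarith [mul_nonneg hl.le hp1, mul_nonneg hm hp2]
    · obtain ⟨k, hk⟩ : ∃ k, d x = k + 1 := ⟨d x - 1, by omega⟩
      have e1 : φ' x t = H * (A * (E * ((c₀ * (b - t)) ^ (d x) / (d x).factorial))) -
          c₀ * (A * (E * ((c₀ * (b - t)) ^ k / k.factorial))) := by
        simp only [hφ', hk, ← hE, Nat.factorial_succ, Nat.add_sub_cancel]
        push_cast
        field_simp
        ring
      have hX' : 0 ≤ A * (E * ((c₀ * (b - t)) ^ k / k.factorial)) := by positivity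
      have e2 : c₀ * (A * (E * ((c₀ * (b - t)) ^ k / k.factorial))) ≤
          lam x * φ (x + 1) t + mu x * φ (x - 1) t := by
        rcases lt_or_ge x z with hxz | hxz
        · have hx1 : x + 1 ∈ Set.Icc lo hi := ⟨hx.1.trans (Nat.le_succ x), hxz.trans_le hz.2⟩
          have hdk : d (x + 1) = k := by simp only [hd] at hk ⊢; omega
          rw [hin _ hx1, hdk]
          nlinarith [mul_nonneg hm hp2, mul_le_mul_of_nonneg_right (hlc x) hX']
        · have hne : z < x := by
            rcases hxz.eq_or_lt with h | h
            · simp [hd, h] at hk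
            · exact h
          have hx1 : x - 1 ∈ Set.Icc lo hi := ⟨hz.1.trans (by omega), (Nat.sub_le x 1).trans hx.2⟩
          have hdk : d (x - 1) = k := by simp only [hd] at hk ⊢; omega
          rw [hin _ hx1, hdk]
          nlinarith [mul_nonneg hl.le hp1, mul_le_mul_of_nonneg_right (hmc x (by omega)) hX']
      rw [e1, hin x hx, ← hE]
      nlinarith [mul_le_mul_of_nonneg_right hHx hX]
  · intro x hx
    rw [hin x hx]
    -- At the terminal time `φ` vanishes except at `z`, so the terminal bound is needed only there.
    rcases Nat.eq_zero_or_pos (d x) with h0 | h0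
    · have : x = z := by simp only [hd] at h0; omega
      subst this
      simpa [h0] using hend
    · simp [zero_pow h0.ne']

/-- Lower bound for staying in a window of length `W`, at the exponential cost of the difference
between the total jump rate and twice the geometric mean of the jump rates. -/
theorem fkLimit_stay_lower (hlam : ∀ x, 0 < lam x) (hmu : ∀ x, 0 ≤ mu x)
    (hF : Continuous F) {z W : ℕ} {a b r σ Θ A : ℝ} (hab : a ≤ b) (hbT : b ≤ T) (hr : 0 < r)
    (hΘ : 0 ≤ Θ)
    (htube : ∀ x ∈ Set.Icc z (z + W), ∀ v, a ≤ v → v ≤ b → |(x : ℝ) - F v| ≤ ρ)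
    (hσl : ∀ x ∈ Set.Icc z (z + W), σ ≤ lam x * r) (hσm : ∀ x ∈ Set.Icc z (z + W), σ * r ≤ mu x)
    (hσ : 0 ≤ σ)
    (hcost : ∀ x ∈ Set.Icc z (z + W), lam x + mu x - 2 * σ * (1 - 1 / (W + 1)) ≤ Θ) (hA : 0 ≤ A)
    (hend : ∀ x ∈ Set.Icc z (z + W),
      ENNReal.ofReal A ≤ fkLimit lam mu (tubeWeight F ρ) e T x b) :
    ENNReal.ofReal (A * (1 / ((W + 1) * max 1 r ^ W)) * Real.exp (-Θ * (b - a))) ≤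
      fkLimit lam mu (tubeWeight F ρ) e T z a := by
  classical
  -- Since s ≤ (W + 1)² and r^i ≤ max(1, r)^W on the window, this keeps `φ` below `A`.
  set C : ℝ := A / ((W + 1) ^ 2 * max 1 r ^ W) with hC
  have hR : 0 < max 1 r ^ W := by positivity
  have hC0 : 0 ≤ C := by positivity
  -- A discrete parabola that vanishes just outside the window (i = -1 and i = W + 1). Its second
  -- difference is -2 and it is at least W + 1 inside, so the sum of its neighbours is at least 2(1
  -- - 1/(W + 1)) s(i). The factor r^i in `φ` turns the birth and death rates into λr and μ/r, both
  -- at least σ.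
  set s : ℕ → ℝ := fun i => ((i : ℝ) + 1) * (W + 1 - i) with hs
  set φ : ℕ → ℝ → ℝ := fun x t => if x ∈ Set.Icc z (z + W) then
    C * r ^ (x - z) * s (x - z) * Real.exp (-Θ * (b - t)) else 0 with hφ
  have hin : ∀ x ∈ Set.Icc z (z + W), ∀ t, φ x t =
    C * r ^ (x - z) * s (x - z) * Real.exp (-Θ * (b - t)) := fun x hx t => if_pos hx
  have hs0 : ∀ i ≤ W, 0 ≤ s i := by
    intro i hi
    have : (i : ℝ) ≤ W := by exact_mod_cast hi
    exact mul_nonneg (by positivity) (by linarith)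
  have hφ0 : ∀ x t, 0 ≤ φ x t := by
    intro x t
    by_cases hx : x ∈ Set.Icc z (z + W)
    · rw [hin x hx]
      have := hs0 (x - z) (by have := hx.2; omega)
      positivity
    · rw [show φ x t = 0 from if_neg hx]
  have hA' : ∀ i ≤ W, C * r ^ i * s i ≤ A := by
    intro i hi
    have h1 : r ^ i ≤ max 1 r ^ W :=
      (pow_le_pow_left₀ hr.le (le_max_right 1 r) i).trans (pow_le_pow_right₀ (le_max_left 1 r) hi)
    have hi' : (i : ℝ) ≤ W := by exact_mod_cast hi
    have h2 : s i ≤ ((W : ℝ) + 1) ^ 2 := by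
      simp only [hs]
      nlinarith [Nat.cast_nonneg (α := ℝ) i]
    calc C * r ^ i * s i ≤ C * max 1 r ^ W * ((W : ℝ) + 1) ^ 2 := by
          have := hs0 i hi
          gcongr
      _ = A := by rw [hC]; field_simp
  have h0 := le_fkLimit_of_subsolution (e := e) (M := A) (φ' := fun x t => Θ * φ x t) hlam hmu
    (measurable_tubeWeight (ρ := ρ) hF)
    (D := Set.Icc z (z + W)) (a := a) (b := b) (x := z) (t := a)
    (H := 2 * σ * (1 - 1 / (W + 1)) + Θ) hbT ?_ ?_ φ
    (fun x t _ => hφ0 x t) ?_ ?_ ?_ ?_ ?_ ?_ ?_ ⟨le_rfl, Nat.le_add_right z W⟩ ⟨le_rfl, hab⟩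
  · rw [hin z ⟨le_rfl, Nat.le_add_right z W⟩] at h0
    refine le_trans (le_of_eq ?_) h0
    congr 2
    simp only [hC, hs, Nat.sub_self]
    field_simp
    simp
  · exact fun x hx t s h1 h2 h3 => tubeWeight_eq_one fun v hv1 hv2 =>
      htube x hx v (h1.trans hv1) (hv2.trans h3)
  · exact fun x hx t w h1 h2 _ _ => tubeWeight_le_of_prefix fun v hv1 hv2 =>
      htube x hx v (h1.trans hv1) hv2
  · exact fun x hx t => if_neg hx
  · intro x t ht
    by_cases hx : x ∈ Set.Icc z (z + W)
    · rw [hin x hx]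
      have h1 : Real.exp (-Θ * (b - t)) ≤ 1 :=
        Real.exp_le_one_iff.2 (by nlinarith [mul_nonneg hΘ (sub_nonneg.2 ht.2)])
      have h2 := hA' (x - z) (by have := hx.2; omega)
      calc _ ≤ A * 1 := mul_le_mul h2 h1 (Real.exp_pos _).le hA
        _ = A := mul_one A
    · rw [show φ x t = 0 from if_neg hx]
      exact hA
  · intro x hx t
    rw [show φ x = fun t => C * r ^ (x - z) * s (x - z) * Real.exp (-Θ * (b - t)) from
      funext (hin x hx)]
    have h1 : HasDerivAt (fun s : ℝ => -Θ * (b - s)) (-Θ * -1) t :=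
      ((hasDerivAt_id t).const_sub b).const_mul (-Θ)
    refine (h1.exp.const_mul _).congr_deriv ?_
    ring
  · intro x hx
    rw [show φ x = fun t => C * r ^ (x - z) * s (x - z) * Real.exp (-Θ * (b - t)) from
      funext (hin x hx)]
    fun_prop
  · intro x hx t _
    obtain ⟨i, rfl⟩ : ∃ i, x = z + i := ⟨x - z, by have := hx.1; omega⟩
    have hi : i ≤ W := by have := hx.2; omega
    have hi' : (i : ℝ) ≤ W := by exact_mod_cast hi
    set E := Real.exp (-Θ * (b - t)) with hE
    have hE0 : 0 < E := Real.exp_pos _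
    have hup : φ (z + i + 1) t = C * r ^ (i + 1) * (((i : ℝ) + 2) * (W - i)) * E := by
      rcases hi.eq_or_lt with h | h
      · rw [show φ (z + i + 1) t = 0 from if_neg fun h' => by have := h'.2; omega, h]
        simp
      · rw [hin _ ⟨by omega, by omega⟩, show z + i + 1 - z = i + 1 by omega]
        simp only [hs, hE]
        push_cast
        ring
    have hdown : σ * (C * r ^ i * ((i : ℝ) * (W + 2 - i)) * E) ≤ mu (z + i) * φ (z + i - 1) t := by
      -- At the lower edge the left side is 0, so neither leaving the window nor the truncated
      -- subtraction at z = 0 matters.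
      rcases Nat.eq_zero_or_pos i with rfl | h
      · have := mul_nonneg (hmu (z + 0)) (hφ0 (z + 0 - 1) t)
        simpa using this
      · obtain ⟨k, rfl⟩ : ∃ k, i = k + 1 := ⟨i - 1, by omega⟩
        rw [hin _ ⟨by omega, by omega⟩, show z + (k + 1) - 1 - z = k by omega]
        have h1 := hσm _ hx
        have h2 : 0 ≤ C * r ^ k * s k * E := by
          have := hs0 k (by omega)
          positivity
        have h3 := mul_le_mul_of_nonneg_right h1 h2
        refine le_trans (le_of_eq ?_) h3
        simp only [hs]
        push_cast
        ring
    have hupl : σ * (C * r ^ i * (((i : ℝ) + 2) * (W - i)) * E) ≤ lam (z + i) * φ (z + i + 1) t := by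
      rw [hup]
      have h2 : 0 ≤ C * r ^ i * (((i : ℝ) + 2) * (W - i)) * E := by
        have : (0 : ℝ) ≤ W - i := by linarith
        positivity
      refine (mul_le_mul_of_nonneg_right (hσl _ hx) h2).trans (le_of_eq ?_)
      ring
    have hc := hcost _ hx
    have hpos : 0 ≤ C * r ^ i * E := by positivity
    have hsW : (W : ℝ) + 1 ≤ s i := by
      simp only [hs]
      nlinarith [mul_nonneg (Nat.cast_nonneg (α := ℝ) i) (sub_nonneg.2 hi')]
    have hφx : φ (z + i) t = C * r ^ i * E * s i := by
      rw [hin _ hx, show z + i - z = i by omega]; ring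
    have hkey : 2 * σ * (1 - 1 / (W + 1)) * (C * r ^ i * E * s i) ≤
        σ * (C * r ^ i * (((i : ℝ) + 2) * (W - i)) * E) +
        σ * (C * r ^ i * ((i : ℝ) * (W + 2 - i)) * E) := by
      have h4 : 2 * (1 - 1 / ((W : ℝ) + 1)) * s i ≤
          ((i : ℝ) + 2) * (W - i) + (i : ℝ) * (W + 2 - i) := by
        have h5 : 1 ≤ 1 / ((W : ℝ) + 1) * s i := by
          rw [one_div_mul_eq_div, le_div_iff₀ (by positivity)]
          linarith
        have h6 : ((i : ℝ) + 2) * (W - i) + (i : ℝ) * (W + 2 - i) = 2 * s i - 2 := by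
          simp only [hs]; ring
        rw [h6]
        linarith
      have := mul_le_mul_of_nonneg_left h4 (mul_nonneg hσ hpos)
      linarith
    have hfin := mul_le_mul_of_nonneg_right hc (hφ0 (z + i) t)
    rw [hφx] at hfin ⊢
    linarith
  · intro x hx
    have := hcost x hx
    linarith
  · intro x hx
    refine le_trans (ENNReal.ofReal_le_ofReal ?_) (hend x hx)
    rw [hin x hx]
    simpa using hA' (x - z) (by have := hx.2; omega)

end Tube

/-! ### Sample paths and uniform balls -/

section Path

/-- `X` is the path with successive states `y` and holding times `σ`. -/
def IsJumpPath (y : ℕ → ℕ) (σ : ℕ → ℝ) (X : ℝ → ℕ∞) : Prop :=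
  ∀ t : ℝ, 0 ≤ t → (∀ n : ℕ, ∑ i ∈ Finset.range n, σ i ≤ t → t < ∑ i ∈ Finset.range (n + 1), σ i →
    X t = (y n : ℕ∞)) ∧ ((∀ n : ℕ, ∑ i ∈ Finset.range n, σ i ≤ t) → X t = ⊤)

theorem exists_sum_le_lt {σ : ℕ → ℝ} {v : ℝ} {n : ℕ} (hv : 0 ≤ v)
    (hn : v < ∑ i ∈ Finset.range (n + 1), σ i) :
    ∃ j ≤ n, ∑ i ∈ Finset.range j, σ i ≤ v ∧ v < ∑ i ∈ Finset.range (j + 1), σ i := by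
  induction n with
  | zero => exact ⟨0, le_rfl, by simpa using hv, hn⟩
  | succ n ih =>
    rcases lt_or_ge v (∑ i ∈ Finset.range (n + 1), σ i) with h | h
    · obtain ⟨j, hj, h'⟩ := ih h
      exact ⟨j, by omega, h'⟩
    · exact ⟨n + 1, le_rfl, h, hn⟩

/-- The variant with intervals open on the left, as left limits require. -/
theorem exists_sum_lt_le {σ : ℕ → ℝ} {v : ℝ} {n : ℕ} (hv : 0 < v)
    (hn : v ≤ ∑ i ∈ Finset.range (n + 1), σ i) :
    ∃ j ≤ n, ∑ i ∈ Finset.range j, σ i < v ∧ v ≤ ∑ i ∈ Finset.range (j + 1), σ i := by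
  induction n with
  | zero => exact ⟨0, le_rfl, by simpa using hv, hn⟩
  | succ n ih =>
    rcases le_or_gt v (∑ i ∈ Finset.range (n + 1), σ i) with h | h
    · obtain ⟨j, hj, h'⟩ := ih h
      exact ⟨j, by omega, h'⟩
    · exact ⟨n + 1, le_rfl, h, hn⟩

theorem sum_range_mono_of_pos {σ : ℕ → ℝ} (hσ : ∀ i, 0 < σ i) :
    Monotone fun n => ∑ i ∈ Finset.range n, σ i :=
  monotone_nat_of_le_succ fun n => by
    rw [Finset.sum_range_succ]
    linarith [hσ n]

theorem coe_natCast_div (k : ℕ) (T : ℝ) :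
    ((((k : ℕ∞) : ℝ≥0∞) : EReal) / (T : EReal)) = (((k : ℝ) / T : ℝ) : EReal) := by
  rw [EReal.coe_div]
  congr 1

theorem isCadlag01_of_isJumpPath {y : ℕ → ℕ} {σ : ℕ → ℝ} {X : ℝ → ℕ∞}
    (hX : IsJumpPath y σ X) {T : ℝ} (hT : 0 < T) {n : ℕ}
    (hn : T < ∑ i ∈ Finset.range (n + 1), σ i) :
    IsCadlag01 fun t : unitInterval => ((X (t * T)).toNat : ℝ) / T := by
  have hval : ∀ (s : unitInterval) (j : ℕ), ∑ i ∈ Finset.range j, σ i ≤ s * T →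
      (s : ℝ) * T < ∑ i ∈ Finset.range (j + 1), σ i → ((X (s * T)).toNat : ℝ) / T = y j / T := by
    intro s j h1 h2
    rw [(hX _ (mul_nonneg s.2.1 hT.le)).1 j h1 h2]
    simp
  have hc : Continuous fun s : unitInterval => (s : ℝ) * T := by fun_prop
  intro t
  have ht0 : 0 ≤ (t : ℝ) * T := mul_nonneg t.2.1 hT.le
  have htT : (t : ℝ) * T ≤ T := by nlinarith [t.2.2]
  constructor
  · obtain ⟨j, -, h1, h2⟩ := exists_sum_le_lt ht0 (htT.trans_lt hn)
    have hev : ∀ᶠ s : unitInterval in 𝓝[>] t, ((X (s * T)).toNat : ℝ) / T = y j / T := by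
      have h3 : ∀ᶠ s : unitInterval in 𝓝 t, (s : ℝ) * T < ∑ i ∈ Finset.range (j + 1), σ i :=
        hc.continuousAt.eventually_lt_const h2
      filter_upwards [nhdsWithin_le_nhds h3, self_mem_nhdsWithin] with s hs hst
      refine hval s j (h1.trans ?_) hs
      exact mul_le_mul_of_nonneg_right (le_of_lt hst) hT.le
    rw [ContinuousWithinAt, hval t j h1 h2]
    exact tendsto_const_nhds.congr' (hev.mono fun s hs => hs.symm)
  · rcases eq_or_lt_of_le t.2.1 with h0 | h0
    -- There is nothing to the left of 0, so any value serves as left limit.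
    · refine ⟨0, ?_⟩
      have : Set.Iio t = ∅ := by
        ext s
        simp only [Set.mem_Iio, Set.mem_empty_iff_false, iff_false, not_lt]
        exact Subtype.coe_le_coe.1 (h0 ▸ s.2.1)
      rw [this, nhdsWithin_empty]
      exact tendsto_bot
    · obtain ⟨j, -, h1, h2⟩ := exists_sum_lt_le (mul_pos h0 hT) (htT.trans hn.le)
      refine ⟨y j / T, tendsto_const_nhds.congr' ?_⟩
      have h3 : ∀ᶠ s : unitInterval in 𝓝 t, ∑ i ∈ Finset.range j, σ i < (s : ℝ) * T :=
        hc.continuousAt.eventually_const_lt h1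
      filter_upwards [nhdsWithin_le_nhds h3, self_mem_nhdsWithin] with s hs hst
      refine (hval s j hs.le (lt_of_lt_of_le ?_ h2)).symm
      exact mul_lt_mul_of_pos_right hst hT

/-- The curve `v ↦ T f (v / T)`. -/
noncomputable def scaledCurve (f : unitInterval → ℝ) (T v : ℝ) : ℝ :=
  T * f (Set.projIcc 0 1 zero_le_one (v / T))

theorem continuous_scaledCurve {f : unitInterval → ℝ} (hf : Continuous f) (T : ℝ) :
    Continuous (scaledCurve f T) := by
  unfold scaledCurve
  exact continuous_const.mul (hf.comp (continuous_projIcc.comp (continuous_id.div_const T)))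

theorem scaledCurve_mul (f : unitInterval → ℝ) {T : ℝ} (hT : 0 < T) (t : unitInterval) :
    scaledCurve f T (t * T) = T * f t := by
  rw [scaledCurve, mul_div_cancel_right₀ _ hT.ne', Set.projIcc_val]

/-- Pointwise distance at most δ bounds the supremum only by δ; the gap δ < ε makes it strictly
smaller than the radius. -/
theorem exists_mem_cadlagBall_of_tube {f : unitInterval → ℝ} {y : ℕ → ℕ} {σ : ℕ → ℝ} {X : ℝ → ℕ∞}
    (hX : IsJumpPath y σ X) {T ε δ : ℝ} (hT : 0 < T) (hδ : 0 ≤ δ) (hδε : δ < ε) {n : ℕ}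
    (hn : T < ∑ i ∈ Finset.range (n + 1), σ i)
    (htube : ∀ j ≤ n, ∀ v, ∑ i ∈ Finset.range j, σ i ≤ v → v < ∑ i ∈ Finset.range (j + 1), σ i →
      v ≤ T → |(y j : ℝ) - scaledCurve f T v| ≤ δ * T) :
    ∃ g ∈ cadlagBall f ε, ∀ t : unitInterval,
      ((X ((t : ℝ) * T) : ℝ≥0∞) : EReal) / (T : EReal) = (g t : EReal) := by
  refine ⟨_, ⟨isCadlag01_of_isJumpPath hX hT hn, ?_⟩, ?_⟩
  · refine lt_of_le_of_lt (iSup_le fun t => ?_)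
      ((ENNReal.ofReal_lt_ofReal_iff (hδ.trans_lt hδε)).2 hδε)
    have ht0 : 0 ≤ (t : ℝ) * T := mul_nonneg t.2.1 hT.le
    have htT : (t : ℝ) * T ≤ T := by nlinarith [t.2.2]
    obtain ⟨j, hj, h1, h2⟩ := exists_sum_le_lt ht0 (htT.trans_lt hn)
    have h3 := htube j hj _ h1 h2 htT
    rw [scaledCurve_mul f hT] at h3
    rw [edist_dist, Real.dist_eq, (hX _ ht0).1 j h1 h2]
    refine ENNReal.ofReal_le_ofReal ?_
    rw [ENat.toNat_natCast, abs_sub_comm]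
    have h4 : (y j : ℝ) / T - f t = (y j - T * f t) / T := by field_simp
    rw [h4, abs_div, abs_of_pos hT, div_le_iff₀ hT]
    exact h3
  · intro t
    have ht0 : 0 ≤ (t : ℝ) * T := mul_nonneg t.2.1 hT.le
    have htT : (t : ℝ) * T ≤ T := by nlinarith [t.2.2]
    obtain ⟨j, hj, h1, h2⟩ := exists_sum_le_lt ht0 (htT.trans_lt hn)
    rw [(hX _ ht0).1 j h1 h2, coe_natCast_div, ENat.toNat_natCast]

/-- Members of the ball are real-valued, so the path is finite at time T and some jump time exceeds
T; explosion by time T is thus excluded. -/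
theorem tube_of_exists_mem_cadlagBall {f : unitInterval → ℝ} {y : ℕ → ℕ} {σ : ℕ → ℝ} {X : ℝ → ℕ∞}
    (hX : IsJumpPath y σ X) {T ε : ℝ} (hT : 0 < T) (hε : 0 < ε)
    (hball : ∃ g ∈ cadlagBall f ε, ∀ t : unitInterval,
      ((X ((t : ℝ) * T) : ℝ≥0∞) : EReal) / (T : EReal) = (g t : EReal)) :
    ∃ n, (∑ i ∈ Finset.range n, σ i ≤ T ∧ T < ∑ i ∈ Finset.range (n + 1), σ i) ∧
      ∀ j v, 0 ≤ v → v ≤ T → ∑ i ∈ Finset.range j, σ i ≤ v → v < ∑ i ∈ Finset.range (j + 1), σ i →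
        |(y j : ℝ) - scaledCurve f T v| ≤ ε * T := by
  obtain ⟨g, ⟨-, hg⟩, hXg⟩ := hball
  have h1 : ∃ n, T < ∑ i ∈ Finset.range (n + 1), σ i := by
    by_contra! hcon
    have htop : X T = ⊤ := (hX T hT.le).2 fun n => by
      rcases n with _ | n
      · simpa using hT.le
      · exact hcon n
    have h2 := hXg 1
    rw [show (((1 : unitInterval) : ℝ) * T) = T by simp, htop] at h2
    rw [show (((⊤ : ℕ∞) : ℝ≥0∞) : EReal) = ⊤ by simp,
      EReal.top_div_of_pos_ne_top (by exact_mod_cast hT) (EReal.coe_ne_top T)] at h2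
    exact EReal.coe_ne_top _ h2.symm
  obtain ⟨n, hn⟩ := h1
  obtain ⟨j, -, hj⟩ := exists_sum_le_lt hT.le hn
  refine ⟨j, hj, fun j v hv0 hvT hj1 hj2 => ?_⟩
  set t : unitInterval := ⟨v / T, div_nonneg hv0 hT.le, (div_le_one hT).2 hvT⟩ with ht
  have htv : (t : ℝ) * T = v := div_mul_cancel₀ v hT.ne'
  have h2 := hXg t
  rw [htv, (hX v hv0).1 j hj1 hj2, coe_natCast_div, EReal.coe_eq_coe_iff] at h2
  have h3 := (le_iSup (fun t => edist (f t) (g t)) t).trans_lt hg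
  rw [edist_dist, ENNReal.ofReal_lt_ofReal_iff hε, Real.dist_eq, ← h2, abs_sub_comm] at h3
  rw [← htv, scaledCurve_mul f hT]
  have h4 : (y j : ℝ) - T * f t = ((y j : ℝ) / T - f t) * T := by field_simp
  rw [h4, abs_mul, abs_of_pos hT]
  exact mul_le_mul_of_nonneg_right h3.le hT.le

end Path

/-! ### From Feynman-Kac weights to ball probabilities -/

section Link
variable {Ω : Type*} [MeasurableSpace Ω] {P : Measure Ω} [IsProbabilityMeasure P]
  {lam mu : ℕ → ℝ} {Y : ℕ → Ω → ℕ} {S : ℕ → Ω → ℝ} {xi : ℝ → Ω → ℕ∞}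

theorem tube_of_fkTerm_ne_zero {F : ℝ → ℝ} {ρ : ℝ} {y : ℕ → ℕ} {σ : ℕ → ℝ} {n : ℕ} {T : ℝ}
    (h : fkTerm (tubeWeight F ρ) (fun _ => 1) T y σ n ≠ 0) :
    T < ∑ i ∈ Finset.range (n + 1), σ i ∧
      ∀ j ≤ n, ∀ v, ∑ i ∈ Finset.range j, σ i ≤ v → v < ∑ i ∈ Finset.range (j + 1), σ i →
      v ≤ T → |(y j : ℝ) - F v| ≤ ρ := by
  unfold fkTerm at h
  split_ifs at h with h1
  · refine ⟨h1.2, fun j hj v hv1 hv2 hvT => ?_⟩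
    have h2 := left_ne_zero_of_mul h
    have h3 := left_ne_zero_of_mul (right_ne_zero_of_mul h)
    rcases hj.eq_or_lt with rfl | hlt
    · unfold tubeWeight at h3
      split_ifs at h3 with h4
      · exact h4 v hv1 hvT
      · exact absurd rfl h3
    · have h4 := Finset.prod_ne_zero_iff.1 h2 j (Finset.mem_range.2 hlt)
      unfold tubeWeight at h4
      split_ifs at h4 with h5
      · exact h5 v hv1 hv2.le
      · exact absurd rfl h4
  · exact absurd rfl h

theorem fkTerm_tube_le_one {F : ℝ → ℝ} {ρ : ℝ} (y : ℕ → ℕ) (σ : ℕ → ℝ) (n : ℕ) (T : ℝ) :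
    fkTerm (tubeWeight F ρ) (fun _ => 1) T y σ n ≤ 1 := by
  have h1 : ∀ x t u, tubeWeight F ρ x t u ≤ 1 := by
    intro x t u
    unfold tubeWeight
    split_ifs <;> simp
  unfold fkTerm
  split_ifs
  · calc _ ≤ (1 : ℝ≥0∞) * (1 * 1) := by
          gcongr
          · exact Finset.prod_le_one' fun j _ => h1 _ _ _
          · exact h1 _ _ _
      _ = 1 := by simp
  · exact zero_le_one

/-- Jump times increase strictly, so at most one index brackets T. -/
theorem sum_fkTerm_tube_le_one {F : ℝ → ℝ} {ρ : ℝ} (y : ℕ → ℕ) {σ : ℕ → ℝ} (hσ : ∀ i, 0 < σ i)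
    (k : ℕ) (T : ℝ) :
    ∑ n ∈ Finset.range k, fkTerm (tubeWeight F ρ) (fun _ => 1) T y σ n ≤ 1 := by
  by_cases h : ∃ n, ∑ i ∈ Finset.range n, σ i ≤ T ∧ T < ∑ i ∈ Finset.range (n + 1), σ i
  · obtain ⟨n, hn1, hn2⟩ := h
    have h0 : ∀ j ≠ n, fkTerm (tubeWeight F ρ) (fun _ => 1) T y σ j = 0 := by
      intro j hj
      refine if_neg fun ⟨hj1, hj2⟩ => ?_
      have hmono := sum_range_mono_of_pos hσ
      rcases lt_or_gt_of_ne hj with h | h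
      · exact absurd (hmono (show j + 1 ≤ n by omega)) (by simp only; linarith)
      · exact absurd (hmono (show n + 1 ≤ j by omega)) (by simp only; linarith)
    calc _ ≤ ∑ j ∈ Finset.range k, if j = n then (1 : ℝ≥0∞) else 0 := by
          refine Finset.sum_le_sum fun j _ => ?_
          split_ifs with hj
          · exact fkTerm_tube_le_one y σ j T
          · exact (h0 j hj).le
      _ ≤ 1 := by
          rw [Finset.sum_ite_eq']
          split_ifs <;> simp
  · rw [Finset.sum_eq_zero]
    · exact zero_le_one
    · exact fun j _ => if_neg fun hj => h ⟨j, hj⟩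

/-- With indicator weights the k-th iterate is the probability of following the tube with fewer than
k jumps. The ball event need not be measurable, since only ∫ 1_E ≤ P(E) is used. -/
theorem fkLimit_tube_le_ballProb (hlam : ∀ x, 0 < lam x) (hmu : ∀ x, 0 ≤ mu x) (hmu0 : mu 0 = 0)
    (H : IsBDJumpHold P lam mu Y S)
    (hxi : ∀ᵐ ω ∂P, IsJumpPath (fun i => Y i ω) (fun i => S i ω) (fun t => xi t ω))
    {f : unitInterval → ℝ} (hf : Continuous f) {T ε δ : ℝ} (hT : 0 < T) (hδ : 0 ≤ δ) (hδε : δ < ε) :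
    fkLimit lam mu (tubeWeight (scaledCurve f T) (δ * T)) (fun _ => 1) T 0 0 ≤
      ballProb P (scaledPath xi) f ε T := by
  have hm := measurable_tubeWeight (ρ := δ * T) (continuous_scaledCurve hf T)
  refine iSup_le fun k => ?_
  rw [← sum_lintegral_fkTerm hlam hmu hmu0 hm hT.le H k,
    ← lintegral_finsetSum _ fun j _ => measurable_fkTerm_path hm H j]
  set E : Set Ω := {ω | ∃ g ∈ cadlagBall f ε, ∀ t, scaledPath xi T ω t = (g t : EReal)} with hE
  refine le_trans (lintegral_mono_ae (g := E.indicator 1) ?_) (lintegral_indicator_one_le E)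
  filter_upwards [hxi, ae_hold_pos hlam hmu hmu0 H] with ω hω hS
  by_cases hmem : ω ∈ E
  · rw [Set.indicator_of_mem hmem]
    exact sum_fkTerm_tube_le_one _ hS k T
  · rw [Set.indicator_of_notMem hmem, Finset.sum_eq_zero fun j _ => ?_]
    by_contra hne
    obtain ⟨h1, h2⟩ := tube_of_fkTerm_ne_zero hne
    exact hmem (exists_mem_cadlagBall_of_tube hω hT hδ hδε h1 h2)

/-- On each sojourn inside the tube the constant tilt rate dominates `G`, so the exponents add up to
at least ∫ G. The final factor r^(y n) costs at most exp(-|log r| N). -/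
theorem fkTerm_tilt_lower {F G : ℝ → ℝ} (hG : Continuous G) {r ρ N T : ℝ} (hr : 0 < r) (hT : 0 ≤ T)
    (hrate : ∀ x : ℕ, ∀ v, 0 ≤ v → v ≤ T → |(x : ℝ) - F v| ≤ ρ → G v ≤ tiltRate lam mu r x)
    (hN : ∀ x : ℕ, |(x : ℝ) - F T| ≤ ρ → (x : ℝ) ≤ N) {y : ℕ → ℕ} {σ : ℕ → ℝ} (hσ : ∀ i, 0 < σ i)
    {n : ℕ} (hn : ∑ i ∈ Finset.range n, σ i ≤ T ∧ T < ∑ i ∈ Finset.range (n + 1), σ i)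
    (htube : ∀ j v, 0 ≤ v → v ≤ T → ∑ i ∈ Finset.range j, σ i ≤ v →
      v < ∑ i ∈ Finset.range (j + 1), σ i → |(y j : ℝ) - F v| ≤ ρ) :
    ENNReal.ofReal (Real.exp ((∫ v in (0 : ℝ)..T, G v) - |Real.log r| * N)) ≤
      fkTerm (tiltWeight lam mu r) (fun x => ENNReal.ofReal (r ^ x)) T y σ n := by
  have hmono := sum_range_mono_of_pos hσ
  set τ : ℕ → ℝ := fun n => ∑ i ∈ Finset.range n, σ i with hτ
  have hτ0 : τ 0 = 0 := by simp [hτ]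
  have hpos : ∀ j, 0 ≤ τ j := fun j => hτ0 ▸ hmono (Nat.zero_le j)
  have hpiece : ∀ j ≤ n, ∀ b, τ j ≤ b → b ≤ τ (j + 1) → b ≤ T →
      ∫ v in τ j..b, G v ≤ tiltRate lam mu r (y j) * (b - τ j) := by
    intro j hj b h1 h2 h3
    calc ∫ v in τ j..b, G v ≤ ∫ v in τ j..b, tiltRate lam mu r (y j) := by
          refine intervalIntegral.integral_mono_on_of_le_Ioo h1 (hG.intervalIntegrable _ _)
            (by simp) fun v hv => ?_
          have hv0 : 0 ≤ v := (hpos j).trans hv.1.le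
          have hvT : v ≤ T := hv.2.le.trans h3
          exact hrate _ v hv0 hvT (htube j v hv0 hvT hv.1.le (hv.2.trans_le h2))
      _ = _ := by simp [mul_comm]
  have hsum : ∫ v in (0 : ℝ)..T, G v ≤
      (∑ j ∈ Finset.range n, tiltRate lam mu r (y j) * (τ (j + 1) - τ j)) +
        tiltRate lam mu r (y n) * (T - τ n) := by
    have h1 : ∑ j ∈ Finset.range n, ∫ v in τ j..τ (j + 1), G v = ∫ v in τ 0..τ n, G v :=
      intervalIntegral.sum_integral_adjacent_intervals fun j _ => hG.intervalIntegrable _ _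
    rw [hτ0] at h1
    rw [← intervalIntegral.integral_add_adjacent_intervals (hG.intervalIntegrable 0 (τ n))
      (hG.intervalIntegrable (τ n) T), ← h1]
    refine add_le_add (Finset.sum_le_sum fun j hj => ?_) (hpiece n le_rfl T hn.1 hn.2.le le_rfl)
    have hj' := Finset.mem_range.1 hj
    exact hpiece j hj'.le _ (hmono (Nat.le_succ j)) le_rfl ((hmono (show j + 1 ≤ n from hj')).trans hn.1)
  have hpow : Real.exp (-(|Real.log r| * N)) ≤ r ^ y n := by
    have h1 : (y n : ℝ) ≤ N := hN _ (htube n T hT le_rfl hn.1 hn.2)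
    rw [← Real.exp_log (pow_pos hr (y n)), Real.log_pow]
    refine Real.exp_le_exp.2 ?_
    have h2 := mul_le_mul_of_nonneg_left h1 (abs_nonneg (Real.log r))
    have h3 := mul_le_mul_of_nonneg_left (neg_abs_le (Real.log r)) (Nat.cast_nonneg (α := ℝ) (y n))
    linarith
  unfold fkTerm
  rw [if_pos hn]
  have hpw : pathWeight (tiltWeight lam mu r) y σ n = ENNReal.ofReal (Real.exp
      (∑ j ∈ Finset.range n, tiltRate lam mu r (y j) * (τ (j + 1) - τ j))) := by
    rw [Real.exp_sum, ENNReal.ofReal_prod_of_nonneg fun i _ => (Real.exp_pos _).le]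
    rfl
  rw [hpw, tiltWeight, ← ENNReal.ofReal_mul (Real.exp_pos _).le, ← ENNReal.ofReal_mul
    (Real.exp_pos _).le]
  refine ENNReal.ofReal_le_ofReal ?_
  calc _ ≤ Real.exp (((∑ j ∈ Finset.range n, tiltRate lam mu r (y j) * (τ (j + 1) - τ j)) +
        tiltRate lam mu r (y n) * (T - τ n)) + -(|Real.log r| * N)) :=
        Real.exp_le_exp.2 (by linarith)
    _ = Real.exp (∑ j ∈ Finset.range n, tiltRate lam mu r (y j) * (τ (j + 1) - τ j)) *
        (Real.exp (tiltRate lam mu r (y n) * (T - τ n)) * Real.exp (-(|Real.log r| * N))) := by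
        rw [Real.exp_add, Real.exp_add, mul_assoc]
    _ ≤ _ := by gcongr

/-- Markov's inequality for the total tilted density Z, whose mean is at most 1 and which is large
on the ball event. -/
theorem ballProb_le (hlam : ∀ x, 0 < lam x) (hmu : ∀ x, 0 ≤ mu x) (hmu0 : mu 0 = 0)
    (H : IsBDJumpHold P lam mu Y S)
    (hxi : ∀ᵐ ω ∂P, IsJumpPath (fun i => Y i ω) (fun i => S i ω) (fun t => xi t ω))
    {f : unitInterval → ℝ} {T ε r N : ℝ} (hT : 0 < T) (hε : 0 < ε) (hr : 0 < r)
    {G : ℝ → ℝ} (hG : Continuous G)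
    (hrate : ∀ x : ℕ, ∀ v, 0 ≤ v → v ≤ T → |(x : ℝ) - scaledCurve f T v| ≤ ε * T →
      G v ≤ tiltRate lam mu r x)
    (hN : ∀ x : ℕ, |(x : ℝ) - scaledCurve f T T| ≤ ε * T → (x : ℝ) ≤ N) :
    ballProb P (scaledPath xi) f ε T ≤
      ENNReal.ofReal (Real.exp (-((∫ v in (0 : ℝ)..T, G v) - |Real.log r| * N))) := by
  set B := (∫ v in (0 : ℝ)..T, G v) - |Real.log r| * N with hB
  have hm : ∀ x, Measurable fun q : ℝ × ℝ => tiltWeight lam mu r x q.1 q.2 := by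
    intro x
    unfold tiltWeight
    fun_prop
  set Z : Ω → ℝ≥0∞ := fun ω => ∑' n, fkTerm (tiltWeight lam mu r) (fun x => ENNReal.ofReal (r ^ x)) T
    (fun j => Y j ω) (fun j => S j ω) n with hZ
  have hZm : Measurable Z := Measurable.tsum fun n => measurable_fkTerm_path hm H n
  have hZ1 : ∫⁻ ω, Z ω ∂P ≤ 1 := by
    rw [hZ, lintegral_tsum fun n => (measurable_fkTerm_path hm H n).aemeasurable,
      ENNReal.tsum_eq_iSup_nat]
    refine iSup_le fun k => ?_
    rw [sum_lintegral_fkTerm hlam hmu hmu0 hm hT.le H k]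
    simpa using fkIter_tilt_le hlam hmu hmu0 hr k 0 hT.le
  have hsub : ballProb P (scaledPath xi) f ε T ≤ P {ω | ENNReal.ofReal (Real.exp B) ≤ Z ω} := by
    refine measure_mono_ae ?_
    filter_upwards [hxi, ae_hold_pos hlam hmu hmu0 H] with ω hω hS hball
    obtain ⟨n, hn, htube⟩ := tube_of_exists_mem_cadlagBall hω hT hε hball
    exact (fkTerm_tilt_lower hG hr hT.le hrate hN hS hn htube).trans (ENNReal.le_tsum n)
  have hmark := (mul_meas_ge_le_lintegral (μ := P) hZm (ENNReal.ofReal (Real.exp B))).trans hZ1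
  refine hsub.trans ?_
  rw [Real.exp_neg, ENNReal.ofReal_inv_of_pos (Real.exp_pos _)]
  rw [ENNReal.le_inv_iff_mul_le, mul_comm]
  exact hmark

end Link

/-! ### Concatenation over time cells -/

section Grid
variable {F : ℝ → ℝ} {ρ : ℝ} {lam mu : ℕ → ℝ} {T : ℝ}

/-- Lower bound along a time grid of `K` cells: in each cell the process moves within one unit of
time to the next target `z j` and then stays in `[z j, z j + W]`. -/
theorem fkLimit_grid_lower (hlam : ∀ x, 0 < lam x) (hmu : ∀ x, 0 ≤ mu x)
    (hF : Continuous F) {c₀ : ℝ} (hc₀ : 0 < c₀) (hlc : ∀ x, c₀ ≤ lam x)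
    (hmc : ∀ x, 1 ≤ x → c₀ ≤ mu x) {K W : ℕ} (hK : 0 < K) (hTK : (K : ℝ) ≤ T) {r H β : ℝ}
    (hr : 0 < r) (z : ℕ → ℕ) (σ Θ : ℕ → ℝ)
    (htube : ∀ j < K, ∀ x ∈ Set.Icc (min (z (j - 1)) (z j)) (max (z (j - 1)) (z j) + W),
      ∀ v, j * (T / K) ≤ v → v ≤ (j + 1) * (T / K) → |(x : ℝ) - F v| ≤ ρ)
    (hH : ∀ j < K, ∀ x ∈ Set.Icc (min (z (j - 1)) (z j)) (max (z (j - 1)) (z j) + W),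
      lam x + mu x ≤ H)
    (hmove : ∀ j < K, ∀ x ∈ Set.Icc (min (z (j - 1)) (z j)) (max (z (j - 1)) (z j) + W),
      Real.exp (-β) ≤ Real.exp (-H) * (c₀ ^ (x - z j + (z j - x)) / (x - z j + (z j - x)).factorial))
    (hκ : Real.exp (-β) ≤ 1 / ((W + 1) * max 1 r ^ W))
    (hΘ : ∀ j < K, 0 ≤ Θ j) (hσ : ∀ j < K, 0 ≤ σ j)
    (hσl : ∀ j < K, ∀ x ∈ Set.Icc (z j) (z j + W), σ j ≤ lam x * r)
    (hσm : ∀ j < K, ∀ x ∈ Set.Icc (z j) (z j + W), σ j * r ≤ mu x)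
    (hcost : ∀ j < K, ∀ x ∈ Set.Icc (z j) (z j + W),
      lam x + mu x - 2 * σ j * (1 - 1 / (W + 1)) ≤ Θ j) {n : ℕ} (hn : n ≤ K) :
    ∀ x ∈ Set.Icc (z (K - n - 1)) (z (K - n - 1) + W),
      ENNReal.ofReal (Real.exp (-∑ i ∈ Finset.Ico (K - n) K, (2 * β + Θ i * (T / K)))) ≤
        fkLimit lam mu (tubeWeight F ρ) (fun _ => 1) T x ((K - n : ℕ) * (T / K)) := by
  have hK' : (0 : ℝ) < K := by exact_mod_cast hK
  have hT0 : 0 < T := hK'.trans_le hTK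
  have hcell : 1 ≤ T / K := (one_le_div hK').2 hTK
  have hKT : (K : ℝ) * (T / K) = T := by field_simp
  -- Backward induction over the cells. At the start of cell j the process sits in the window of
  -- cell j - 1; for j = 0 truncated subtraction makes this the window of `z 0`.
  induction n with
  | zero =>
    intro x hx
    simp only [Nat.sub_zero, Finset.Ico_self, Finset.sum_empty, neg_zero, Real.exp_zero,
      ENNReal.ofReal_one, hKT] at hx ⊢
    rw [fkLimit_eq (measurable_tubeWeight hF)]
    refine le_add_right ?_
    rw [tubeWeight_eq_one]
    · simp
    · intro v hv1 hv2
      have hlast : ((K - 1 : ℕ) : ℝ) + 1 = K := by exact_mod_cast Nat.sub_add_cancel hK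
      refine htube (K - 1) (by omega) x ⟨(min_le_right _ _).trans hx.1,
        hx.2.trans (Nat.add_le_add_right (le_max_right _ _) W)⟩ v ?_ ?_
      · nlinarith
      · rw [hlast, hKT]; exact hv2
  | succ n ih =>
    have ih := ih (by omega)
    set j := K - (n + 1) with hj
    have hjK : j < K := by omega
    have hjn : K - n = j + 1 := by omega
    rw [hjn, Nat.add_sub_cancel] at ih
    have hjT : ((j : ℝ) + 1) * (T / K) ≤ T := by
      have : (j : ℝ) + 1 ≤ K := by exact_mod_cast hjK
      calc _ ≤ (K : ℝ) * (T / K) := by gcongr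
        _ = T := hKT
    push_cast at ih
    intro x hx
    set A := Real.exp (-∑ i ∈ Finset.Ico (j + 1) K, (2 * β + Θ i * (T / K))) with hA
    have hwin : ∀ x ∈ Set.Icc (z j) (z j + W),
        x ∈ Set.Icc (min (z (j - 1)) (z j)) (max (z (j - 1)) (z j) + W) := fun x hx =>
      ⟨(min_le_right _ _).trans hx.1, hx.2.trans (Nat.add_le_add_right (le_max_right _ _) W)⟩
    have hstay := fkLimit_stay_lower (e := fun _ => 1) (ρ := ρ) (T := T) hlam hmu hF (z := z j)
      (W := W) (a := j * (T / K) + 1) (b := (j + 1) * (T / K)) (A := A) (by linarith) hjT hr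
      (hΘ j hjK)
      (fun x hx v hv1 hv2 => htube j hjK x (hwin x hx) v (by linarith) hv2)
      (hσl j hjK) (hσm j hjK) (hσ j hjK) (hcost j hjK) (Real.exp_pos _).le ih
    -- One factor exp(-β) pays for the normalising constant of the stay, the other one below for the
    -- journey. As Θ ≥ 0, charging the stay for the entire cell only lowers the bound.
    have hbase : A * Real.exp (-β) * Real.exp (-(Θ j * (T / K))) ≤
        A * (1 / ((W + 1) * max 1 r ^ W)) *
          Real.exp (-Θ j * ((j + 1) * (T / K) - (j * (T / K) + 1))) := by
      gcongr
      have := hΘ j hjK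
      nlinarith
    have hx' : x ∈ Set.Icc (min (z (j - 1)) (z j)) (max (z (j - 1)) (z j) + W) :=
      ⟨(min_le_left _ _).trans hx.1, hx.2.trans (Nat.add_le_add_right (le_max_left _ _) W)⟩
    have hmv := fkLimit_move_lower (e := fun _ => 1) (ρ := ρ) (T := T) hlam hmu hF hc₀ hlc hmc
      (z := z j) (lo := min (z (j - 1)) (z j)) (hi := max (z (j - 1)) (z j) + W)
      ⟨min_le_right _ _, (le_max_right _ _).trans (Nat.le_add_right _ _)⟩
      (a := j * (T / K)) (b := j * (T / K) + 1) (H := H)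
      (A := A * Real.exp (-β) * Real.exp (-(Θ j * (T / K)))) (by linarith) (by linarith)
      (fun x hx v hv1 hv2 => htube j hjK x hx v hv1 (by linarith)) (hH j hjK) (by positivity)
      ((ENNReal.ofReal_le_ofReal hbase).trans hstay) hx'
    refine le_trans (ENNReal.ofReal_le_ofReal ?_) hmv
    rw [add_sub_cancel_left, mul_one, mul_one, ← Finset.sum_Ioo_add_eq_sum_Ico hjK]
    have hIoo : Finset.Ioo j K = Finset.Ico (j + 1) K := by ext; simp
    rw [hIoo]
    calc _ = A * Real.exp (-β) * Real.exp (-(Θ j * (T / K))) * Real.exp (-β) := by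
          rw [hA, ← Real.exp_add, ← Real.exp_add, ← Real.exp_add]
          congr 1
          ring
      _ ≤ _ := by
          gcongr
          exact hmove j hjK x hx'

end Grid

/-! ### Rate asymptotics and the cost of moving -/

section Asymptotics

/-- The additive constant absorbs the finitely many x where the limit says nothing, including 0. -/
theorem exists_abs_sub_le_of_tendsto {a : ℕ → ℝ} {k L : ℝ}
    (h : Tendsto (fun x : ℕ => a x / (x : ℝ) ^ k) atTop (𝓝 L)) {δ : ℝ} (hδ : 0 < δ) :
    ∃ C, 0 ≤ C ∧ ∀ x : ℕ, |a x - L * (x : ℝ) ^ k| ≤ δ * (x : ℝ) ^ k + C := by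
  obtain ⟨N, hN⟩ := (Metric.tendsto_atTop.1 h) δ hδ
  refine ⟨∑ x ∈ Finset.range (N + 1), |a x - L * (x : ℝ) ^ k|,
    Finset.sum_nonneg fun _ _ => abs_nonneg _, fun x => ?_⟩
  have hxk : 0 ≤ (x : ℝ) ^ k := Real.rpow_nonneg (Nat.cast_nonneg x) k
  have hC : 0 ≤ ∑ x ∈ Finset.range (N + 1), |a x - L * (x : ℝ) ^ k| :=
    Finset.sum_nonneg fun _ _ => abs_nonneg _
  rcases Nat.lt_or_ge x (N + 1) with hx | hx
  · have := Finset.single_le_sum (f := fun x : ℕ => |a x - L * (x : ℝ) ^ k|)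
      (fun _ _ => abs_nonneg _) (Finset.mem_range.2 hx)
    have h2 : 0 ≤ δ * (x : ℝ) ^ k := by positivity
    linarith
  · have hx0 : (0 : ℝ) < x := by exact_mod_cast (show 0 < x by omega)
    have hpos : 0 < (x : ℝ) ^ k := Real.rpow_pos_of_pos hx0 k
    have h1 := hN x (by omega)
    rw [Real.dist_eq] at h1
    have h2 : a x - L * (x : ℝ) ^ k = (a x / (x : ℝ) ^ k - L) * (x : ℝ) ^ k := by field_simp
    rw [h2, abs_mul, abs_of_pos hpos]
    have := mul_le_mul_of_nonneg_right h1.le hpos.le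
    linarith

theorem eventually_const_le_mul_rpow {k : ℝ} (hk : 0 < k) (C : ℝ) {δ : ℝ} (hδ : 0 < δ) :
    ∀ᶠ T : ℝ in atTop, C ≤ δ * T ^ k :=
  ((tendsto_rpow_atTop hk).const_mul_atTop hδ).eventually_ge_atTop C

/-- Sites in the window divided by T converge to y, and u ↦ u^k is continuous. For y = 0 the sites
need not tend to infinity, but bounded errors are absorbed by δ T^k. -/
theorem eventually_window_rate {a : ℕ → ℝ} {k L : ℝ} (hk : 0 < k)
    (h : Tendsto (fun x : ℕ => a x / (x : ℝ) ^ k) atTop (𝓝 L)) {y : ℝ} (hy : 0 ≤ y) (W : ℕ) {δ : ℝ}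
    (hδ : 0 < δ) : ∀ᶠ T : ℝ in atTop, ∀ x ∈ Set.Icc ⌊T * y⌋₊ (⌊T * y⌋₊ + W),
      |a x - L * (y ^ k * T ^ k)| ≤ δ * T ^ k := by
  have hyk : 0 ≤ y ^ k := Real.rpow_nonneg hy k
  obtain ⟨C, hC0, hC⟩ := exists_abs_sub_le_of_tendsto h (δ := δ / (3 * (y ^ k + 1))) (by positivity)
  set δ₂ := min 1 (δ / (3 * (|L| + 1))) with hδ₂
  have hδ₂0 : 0 < δ₂ := lt_min one_pos (by positivity)
  have hcont : ContinuousAt (fun u : ℝ => u ^ k) y := (Real.continuous_rpow_const hk.le).continuousAt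
  obtain ⟨s, hs0, hs⟩ := Metric.continuousAt_iff.1 hcont δ₂ hδ₂0
  have hbig : ∀ᶠ T : ℝ in atTop, ((W : ℝ) + 1) / s < T := eventually_gt_atTop _
  filter_upwards [hbig, eventually_gt_atTop 0,
    eventually_const_le_mul_rpow hk C (show 0 < δ / 3 by positivity)] with T hT hT0 hTC x hx
  have hTy : 0 ≤ T * y := by positivity
  have hx1 : T * y - 1 ≤ x := by
    have h1 := Nat.lt_floor_add_one (T * y)
    have h2 : ((⌊T * y⌋₊ : ℕ) : ℝ) ≤ x := by exact_mod_cast hx.1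
    linarith
  have hx2 : (x : ℝ) ≤ T * y + W := by
    have h1 := Nat.floor_le hTy
    have h2 : (x : ℝ) ≤ ((⌊T * y⌋₊ : ℕ) : ℝ) + W := by exact_mod_cast hx.2
    linarith
  have hTk : 0 < T ^ k := Real.rpow_pos_of_pos hT0 k
  have hdist : dist ((x : ℝ) / T) y < s := by
    rw [Real.dist_eq, show (x : ℝ) / T - y = (x - T * y) / T by field_simp, abs_div, abs_of_pos hT0,
      div_lt_iff₀ hT0]
    rw [div_lt_iff₀ hs0] at hT
    have : |(x : ℝ) - T * y| ≤ W + 1 := by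
      rw [abs_le]
      constructor
      · linarith [Nat.cast_nonneg (α := ℝ) W]
      · linarith
    linarith
  have hxk := hs hdist
  rw [Real.dist_eq, Real.div_rpow (Nat.cast_nonneg x) hT0.le] at hxk
  have hxk' : |(x : ℝ) ^ k - y ^ k * T ^ k| ≤ δ₂ * T ^ k := by
    rw [show (x : ℝ) ^ k - y ^ k * T ^ k = ((x : ℝ) ^ k / T ^ k - y ^ k) * T ^ k by field_simp,
      abs_mul, abs_of_pos hTk]
    exact mul_le_mul_of_nonneg_right hxk.le hTk.le
  have hxk1 : (x : ℝ) ^ k ≤ (y ^ k + 1) * T ^ k := by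
    have h1 := (abs_le.1 hxk').2
    have h2 : δ₂ * T ^ k ≤ 1 * T ^ k := mul_le_mul_of_nonneg_right (min_le_left _ _) hTk.le
    linarith
  have hA : δ / (3 * (y ^ k + 1)) * (x : ℝ) ^ k ≤ δ / 3 * T ^ k := by
    calc _ ≤ δ / (3 * (y ^ k + 1)) * ((y ^ k + 1) * T ^ k) := by gcongr
      _ = δ / 3 * T ^ k := by field_simp
  have hB : |L * (x : ℝ) ^ k - L * (y ^ k * T ^ k)| ≤ δ / 3 * T ^ k := by
    rw [← mul_sub, abs_mul]
    calc |L| * |(x : ℝ) ^ k - y ^ k * T ^ k| ≤ (|L| + 1) * (δ / (3 * (|L| + 1)) * T ^ k) := by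
          gcongr
          · linarith
          · exact hxk'.trans (mul_le_mul_of_nonneg_right (min_le_right _ _) hTk.le)
      _ = δ / 3 * T ^ k := by
          have : 0 < |L| + 1 := by positivity
          field_simp
  have h1 := hC x
  calc |a x - L * (y ^ k * T ^ k)| ≤ |a x - L * (x : ℝ) ^ k| +
        |L * (x : ℝ) ^ k - L * (y ^ k * T ^ k)| := abs_sub_le _ _ _
    _ ≤ δ * T ^ k := by linarith

theorem eventually_rate_le {a : ℕ → ℝ} {k L : ℝ} (hk : 0 < k)
    (h : Tendsto (fun x : ℕ => a x / (x : ℝ) ^ k) atTop (𝓝 L)) {N : ℝ} (hN : 0 ≤ N) :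
    ∃ H : ℝ, ∀ᶠ T : ℝ in atTop, ∀ x : ℕ, (x : ℝ) ≤ N * T → a x ≤ H * T ^ k := by
  obtain ⟨C, hC0, hC⟩ := exists_abs_sub_le_of_tendsto h one_pos
  refine ⟨(|L| + 1) * N ^ k + 1, ?_⟩
  filter_upwards [eventually_gt_atTop 0, eventually_const_le_mul_rpow hk C one_pos]
    with T hT hTC x hx
  have h1 := (abs_le.1 (hC x)).2
  have h2 : (x : ℝ) ^ k ≤ N ^ k * T ^ k := by
    rw [← Real.mul_rpow hN hT.le]
    exact Real.rpow_le_rpow (Nat.cast_nonneg x) hx hk.le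
  have h3 : 0 ≤ (x : ℝ) ^ k := Real.rpow_nonneg (Nat.cast_nonneg x) k
  have h4 : L * (x : ℝ) ^ k ≤ |L| * (x : ℝ) ^ k := mul_le_mul_of_nonneg_right (le_abs_self L) h3
  have h5 : (|L| + 1) * (x : ℝ) ^ k ≤ (|L| + 1) * (N ^ k * T ^ k) :=
    mul_le_mul_of_nonneg_left h2 (by positivity)
  linarith

/-- From d! ≤ (NT)^d the travel cost is at most NT log(NT/c₀) + H T^k, and k > 0 makes both terms
o(T^(k+1)). -/
theorem eventually_move_cost {k : ℝ} (hk : 0 < k) (H N : ℝ) (hN : 0 < N) {c₀ η : ℝ} (hc₀ : 0 < c₀)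
    (hη : 0 < η) : ∀ᶠ T : ℝ in atTop, ∀ d : ℕ, (d : ℝ) ≤ N * T →
      Real.exp (-(η * T ^ (k + 1))) ≤ Real.exp (-(H * T ^ k)) * (c₀ ^ d / d.factorial) := by
  have hlog : ∀ᶠ T : ℝ in atTop, Real.log T ≤ η / (3 * N) * T ^ k := by
    have := (isLittleO_log_rpow_atTop hk).bound (show 0 < η / (3 * N) by positivity)
    filter_upwards [this, eventually_gt_atTop 0] with T h1 h2
    rw [Real.norm_eq_abs, Real.norm_of_nonneg (Real.rpow_nonneg h2.le k)] at h1
    exact (le_abs_self _).trans h1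
  filter_upwards [hlog, eventually_gt_atTop 0, eventually_ge_atTop (c₀ / N),
    eventually_ge_atTop (3 * H / η),
    eventually_const_le_mul_rpow hk (N * Real.log (N / c₀)) (show 0 < η / 3 by positivity)]
    with T h1 hT h2 h3 h4 d hd
  have hTk : 0 < T ^ k := Real.rpow_pos_of_pos hT k
  have hTk1 : T ^ (k + 1) = T ^ k * T := by rw [Real.rpow_add hT, Real.rpow_one]
  have hratio : 1 ≤ N * T / c₀ := by
    rw [one_le_div hc₀]
    rw [div_le_iff₀ hN] at h2
    linarith
  have hfac : Real.exp (-(N * T * Real.log (N * T / c₀))) ≤ c₀ ^ d / d.factorial := by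
    have e1 : (d.factorial : ℝ) ≤ (N * T) ^ d := by
      calc (d.factorial : ℝ) ≤ (d : ℝ) ^ d := by exact_mod_cast Nat.factorial_le_pow d
        _ ≤ _ := pow_le_pow_left₀ (Nat.cast_nonneg d) hd d
    have e2 : Real.exp (-(d * Real.log (N * T / c₀))) = c₀ ^ d / (N * T) ^ d := by
      rw [Real.exp_neg, ← Real.log_pow, Real.exp_log (by positivity), div_pow, inv_div]
    calc _ ≤ Real.exp (-(d * Real.log (N * T / c₀))) :=
          Real.exp_le_exp.2 (neg_le_neg (mul_le_mul_of_nonneg_right hd (Real.log_nonneg hratio)))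
      _ = c₀ ^ d / (N * T) ^ d := e2
      _ ≤ _ := by gcongr
  calc _ ≤ Real.exp (-(H * T ^ k)) * Real.exp (-(N * T * Real.log (N * T / c₀))) := by
        rw [← Real.exp_add]
        refine Real.exp_le_exp.2 ?_
        have e3 : Real.log (N * T / c₀) = Real.log (N / c₀) + Real.log T := by
          rw [show N * T / c₀ = N / c₀ * T by ring, Real.log_mul (by positivity) hT.ne']
        have e4 : H * T ^ k ≤ η / 3 * (T ^ k * T) := by
          rw [div_le_iff₀ hη] at h3
          have := mul_le_mul_of_nonneg_right h3 hTk.le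
          linarith
        have e5 : N * T * Real.log T ≤ η / 3 * (T ^ k * T) := by
          calc _ ≤ N * T * (η / (3 * N) * T ^ k) := by gcongr
            _ = _ := by field_simp
        have e6 := mul_le_mul_of_nonneg_right h4 hT.le
        rw [e3, hTk1]
        linarith
    _ ≤ _ := by gcongr

end Asymptotics

/-- Birth and death rates asymptotic to `p x ^ k` and `q x ^ k` (where `p` or `q` may vanish) and
bounded away from zero. -/
structure HasPowerRates (lam mu : ℕ → ℝ) (k p q c₀ : ℝ) : Prop where
  lam_pos : ∀ x, 0 < lam x
  mu_nonneg : ∀ x, 0 ≤ mu x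
  mu_zero : mu 0 = 0
  exponent_pos : 0 < k
  p_nonneg : 0 ≤ p
  q_nonneg : 0 ≤ q
  lam_lim : Tendsto (fun x : ℕ => lam x / (x : ℝ) ^ k) atTop (𝓝 p)
  mu_lim : Tendsto (fun x : ℕ => mu x / (x : ℝ) ^ k) atTop (𝓝 q)
  bound_pos : 0 < c₀
  le_lam : ∀ x, c₀ ≤ lam x
  le_mu : ∀ x, 1 ≤ x → c₀ ≤ mu x

/-! ### Choice of the tilt parameter -/

section Tilt

theorem sq_sqrt_sub_sqrt {p q : ℝ} (hp : 0 ≤ p) (hq : 0 ≤ q) :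
    (√p - √q) ^ 2 = p + q - 2 * (√p * √q) := by
  nlinarith [Real.sq_sqrt hp, Real.sq_sqrt hq]

/-- The choice r = √q/√p gives equality in both bounds. If p or q is 0 the geometric mean vanishes
and r = 1 will do. -/
theorem exists_tilt_lower {p q : ℝ} (hp : 0 ≤ p) (hq : 0 ≤ q) :
    ∃ r : ℝ, 0 < r ∧ √p * √q ≤ p * r ∧ √p * √q * r ≤ q := by
  rcases hp.eq_or_lt with rfl | hp'
  · exact ⟨1, one_pos, by simp, by simpa using hq⟩
  rcases hq.eq_or_lt with rfl | hq'
  · exact ⟨1, one_pos, by simpa using hp, by simp⟩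
  have h1 := Real.sqrt_pos.2 hp'
  have h2 := Real.sqrt_pos.2 hq'
  refine ⟨√q / √p, by positivity, le_of_eq ?_, le_of_eq ?_⟩
  · field_simp
    nlinarith [Real.sq_sqrt hp]
  · field_simp
    nlinarith [Real.sq_sqrt hq]

/-- By the AM-GM inequality p r + q/r has infimum 2√(pq). It may fail to be attained when p or q is
0; then r is taken large (p = 0) or small (q = 0), at the price of η. -/
theorem exists_tilt_upper {p q : ℝ} (hp : 0 ≤ p) (hq : 0 ≤ q) {η : ℝ} (hη : 0 < η) :
    ∃ r : ℝ, 0 < r ∧ (√p - √q) ^ 2 - η ≤ p + q - p * r - q / r := by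
  rcases hp.eq_or_lt with rfl | hp'
  · refine ⟨(q + 1) / η, by positivity, ?_⟩
    have h1 : q / ((q + 1) / η) ≤ η := by
      rw [div_div_eq_mul_div, div_le_iff₀ (by positivity)]
      nlinarith
    rw [sq_sqrt_sub_sqrt le_rfl hq]
    simp only [Real.sqrt_zero, zero_mul]
    linarith
  rcases hq.eq_or_lt with rfl | hq'
  · refine ⟨η / (p + 1), by positivity, ?_⟩
    have h1 : p * (η / (p + 1)) ≤ η := by
      rw [← mul_div_assoc, div_le_iff₀ (by positivity)]
      nlinarith
    rw [sq_sqrt_sub_sqrt hp le_rfl]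
    simp only [Real.sqrt_zero, mul_zero, zero_div]
    linarith
  have h1 := Real.sqrt_pos.2 hp'
  have h2 := Real.sqrt_pos.2 hq'
  refine ⟨√q / √p, by positivity, ?_⟩
  have h3 : p * (√q / √p) = √p * √q := by
    field_simp
    nlinarith [Real.sq_sqrt hp]
  have h4 : q / (√q / √p) = √p * √q := by
    field_simp
    nlinarith [Real.sq_sqrt hq]
  rw [h3, h4, sq_sqrt_sub_sqrt hp hq]
  linarith

end Tilt

/-! ### Riemann sums -/

section Riemann

/-- The modulus is for distance 2/K because during a cell the process may lie between the current
target and the previous one. -/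
theorem exists_grid_modulus {g G : ℝ → ℝ} (hg : Continuous g) (hG : Continuous G) {a b : ℝ}
    (ha : 0 < a) (hb : 0 < b) : ∃ K : ℕ, 0 < K ∧ ∀ s ∈ Set.Icc (0 : ℝ) 1, ∀ t ∈ Set.Icc (0 : ℝ) 1,
      |s - t| ≤ 2 / K → |g s - g t| ≤ a ∧ |G s - G t| ≤ b := by
  have h1 := Metric.uniformContinuousOn_iff.1
    (isCompact_Icc.uniformContinuousOn_of_continuous (hg.continuousOn (s := Set.Icc (0 : ℝ) 1))) a ha
  have h2 := Metric.uniformContinuousOn_iff.1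
    (isCompact_Icc.uniformContinuousOn_of_continuous (hG.continuousOn (s := Set.Icc (0 : ℝ) 1))) b hb
  obtain ⟨d1, hd1, h1⟩ := h1
  obtain ⟨d2, hd2, h2⟩ := h2
  obtain ⟨K, hK⟩ := exists_nat_gt (2 / min d1 d2)
  have hd : 0 < min d1 d2 := lt_min hd1 hd2
  have hK0 : (0 : ℝ) < K := (by positivity : (0 : ℝ) < 2 / min d1 d2).trans hK
  refine ⟨K, by exact_mod_cast hK0, fun s hs t ht hst => ?_⟩
  have hlt : |s - t| < min d1 d2 := by
    refine hst.trans_lt ?_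
    rw [div_lt_iff₀ hd] at hK
    rw [div_lt_iff₀ hK0]
    linarith
  exact ⟨(h1 s hs t ht (hlt.trans_le (min_le_left _ _))).le,
    (h2 s hs t ht (hlt.trans_le (min_le_right _ _))).le⟩

theorem riemann_sum_le {G : ℝ → ℝ} (hG : Continuous G) {b : ℝ} {K : ℕ} (hK : 0 < K)
    (hmod : ∀ s ∈ Set.Icc (0 : ℝ) 1, ∀ t ∈ Set.Icc (0 : ℝ) 1, |s - t| ≤ 2 / K → |G s - G t| ≤ b) :
    (∑ j ∈ Finset.range K, G (j / K)) / K ≤ (∫ s in (0 : ℝ)..1, G s) + b := by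
  have hK0 : (0 : ℝ) < K := by exact_mod_cast hK
  have h1 : ∑ j ∈ Finset.range K, ∫ s in ((j : ℕ) : ℝ) / K..((j + 1 : ℕ) : ℝ) / K, G s =
      ∫ s in ((0 : ℕ) : ℝ) / K..((K : ℕ) : ℝ) / K, G s :=
    intervalIntegral.sum_integral_adjacent_intervals (a := fun j : ℕ => (j : ℝ) / K)
      fun j _ => hG.intervalIntegrable _ _
  rw [Nat.cast_zero, zero_div, div_self hK0.ne'] at h1
  have h2 : ∀ j ∈ Finset.range K, (G (j / K) - b) / K ≤
      ∫ s in ((j : ℕ) : ℝ) / K..((j + 1 : ℕ) : ℝ) / K, G s := by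
    intro j hj
    have hjK : ((j + 1 : ℕ) : ℝ) ≤ K := by exact_mod_cast Finset.mem_range.1 hj
    have hlen : ((j + 1 : ℕ) : ℝ) / K - (j : ℝ) / K = 1 / K := by push_cast; field_simp; ring
    have hle : (j : ℝ) / K ≤ ((j + 1 : ℕ) : ℝ) / K := by
      have : 0 < 1 / (K : ℝ) := by positivity
      linarith
    calc (G (j / K) - b) / K = ∫ s in ((j : ℕ) : ℝ) / K..((j + 1 : ℕ) : ℝ) / K, (G (j / K) - b) := by
          rw [intervalIntegral.integral_const, hlen, smul_eq_mul]; ring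
      _ ≤ _ := by
          refine intervalIntegral.integral_mono_on hle (by simp) (hG.intervalIntegrable _ _)
            fun s hs => ?_
          have hj0 : 0 ≤ (j : ℝ) / K := by positivity
          have hj1 : ((j + 1 : ℕ) : ℝ) / K ≤ 1 := (div_le_one hK0).2 hjK
          have := hmod (j / K) ⟨hj0, hle.trans hj1⟩ s ⟨hj0.trans hs.1, hs.2.trans hj1⟩ (by
            rw [abs_sub_comm, abs_of_nonneg (by linarith [hs.1])]
            have : 1 / (K : ℝ) ≤ 2 / K := by gcongr; norm_num
            linarith [hs.2])
          linarith [(abs_le.1 this).2]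
  have h3 := Finset.sum_le_sum h2
  rw [h1, ← Finset.sum_div, Finset.sum_sub_distrib, Finset.sum_const, Finset.card_range,
    nsmul_eq_mul, sub_div, mul_div_cancel_left₀ b hK0.ne'] at h3
  linarith

end Riemann

/-! ### Probability bounds for large T -/

section Bounds
variable {Ω : Type*} [MeasurableSpace Ω] {P : Measure Ω} [IsProbabilityMeasure P]
  {lam mu : ℕ → ℝ} {Y : ℕ → Ω → ℕ} {S : ℕ → Ω → ℝ} {xi : ℝ → Ω → ℕ∞} {k p q c₀ : ℝ}

theorem HasPowerRates.eventually_stay (R : HasPowerRates lam mu k p q c₀) {r κ : ℝ} (hr : 0 < r)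
    (hκ : 0 ≤ κ) (hrp : κ ≤ p * r) (hrq : κ * r ≤ q) {y : ℝ} (hy : 0 ≤ y) {W : ℕ} {η : ℝ}
    (hη : 0 < η) (hW : 2 * κ * y ^ k / (W + 1) ≤ η / 2) :
    ∀ᶠ T : ℝ in atTop, ∃ σ, 0 ≤ σ ∧ ∀ x ∈ Set.Icc ⌊T * y⌋₊ (⌊T * y⌋₊ + W),
      σ ≤ lam x * r ∧ σ * r ≤ mu x ∧
        lam x + mu x - 2 * σ * (1 - 1 / (W + 1)) ≤ T ^ k * ((p + q - 2 * κ) * y ^ k + η) := by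
  have hyk : 0 ≤ y ^ k := Real.rpow_nonneg hy k
  set δ := min (η / 8) (min (η / 8 / r) (η / 8 * r)) with hδ
  have hδ0 : 0 < δ := lt_min (by positivity) (lt_min (by positivity) (by positivity))
  have hδ1 : δ ≤ η / 8 := min_le_left _ _
  have hδ2 : δ * r ≤ η / 8 := by
    rw [← le_div_iff₀ hr]; exact (min_le_right _ _).trans (min_le_left _ _)
  have hδ3 : δ ≤ η / 8 * r := (min_le_right _ _).trans (min_le_right _ _)
  filter_upwards [eventually_window_rate R.exponent_pos R.lam_lim hy W hδ0,
    eventually_window_rate R.exponent_pos R.mu_lim hy W hδ0, eventually_gt_atTop 0] with T h1 h2 hT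
  have hTk : 0 < T ^ k := Real.rpow_pos_of_pos hT k
  -- Slightly less than the limiting geometric mean, so that both rate bounds hold on the entire
  -- window, and truncated at 0 for small y. The error η is spent as η/4 on the rates, η/4 on this
  -- loss and η/2 on the finite window.
  set s := max 0 (κ * y ^ k - η / 8) with hs
  have hs0 : 0 ≤ s := le_max_left _ _
  have hs1 : κ * y ^ k - η / 8 ≤ s := le_max_right _ _
  have hs2 : s ≤ κ * y ^ k := max_le (by positivity) (by linarith)
  refine ⟨s * T ^ k, by positivity, fun x hx => ⟨?_, ?_, ?_⟩⟩
  · rcases le_total (κ * y ^ k - η / 8) 0 with h | h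
    · rw [hs, max_eq_left h, zero_mul]
      exact mul_nonneg (R.lam_pos x).le hr.le
    · rw [hs, max_eq_right h]
      have h3 : (p * y ^ k - δ) * T ^ k ≤ lam x := by linarith [(abs_le.1 (h1 x hx)).1]
      have h4 := mul_le_mul_of_nonneg_right h3 hr.le
      have h5 : κ * y ^ k - η / 8 ≤ (p * y ^ k - δ) * r := by
        have := mul_le_mul_of_nonneg_right hrp hyk
        linarith
      have h6 := mul_le_mul_of_nonneg_right h5 hTk.le
      linarith
  · rcases le_total (κ * y ^ k - η / 8) 0 with h | h
    · rw [hs, max_eq_left h, zero_mul, zero_mul]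
      exact R.mu_nonneg x
    · rw [hs, max_eq_right h]
      have h3 : (q * y ^ k - δ) * T ^ k ≤ mu x := by linarith [(abs_le.1 (h2 x hx)).1]
      have h5 : (κ * y ^ k - η / 8) * r ≤ q * y ^ k - δ := by
        have := mul_le_mul_of_nonneg_right hrq hyk
        linarith
      have h6 := mul_le_mul_of_nonneg_right h5 hTk.le
      linarith
  · have h3 := (abs_le.1 (h1 x hx)).2
    have h4 := (abs_le.1 (h2 x hx)).2
    have h5 := mul_le_mul_of_nonneg_right hs1 hTk.le
    have h6 : 2 * (s * T ^ k) * (1 / (W + 1)) ≤ η / 2 * T ^ k := by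
      calc 2 * (s * T ^ k) * (1 / (W + 1)) = 2 * s / (W + 1) * T ^ k := by ring
        _ ≤ 2 * (κ * y ^ k) / (W + 1) * T ^ k := by gcongr
        _ ≤ η / 2 * T ^ k := by
            refine mul_le_mul_of_nonneg_right ?_ hTk.le
            rwa [← mul_assoc]
    have h7 : δ * T ^ k ≤ η / 8 * T ^ k := by gcongr
    nlinarith

theorem HasPowerRates.eventually_ballProb_le (R : HasPowerRates lam mu k p q c₀)
    (H : IsBDJumpHold P lam mu Y S)
    (hxi : ∀ᵐ ω ∂P, IsJumpPath (fun i => Y i ω) (fun i => S i ω) (fun t => xi t ω))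
    {f : unitInterval → ℝ} (hf : Continuous f) (hf0 : ∀ t, 0 ≤ f t) {ε δ : ℝ} (hε : 0 < ε)
    (hδ : 0 < δ) : ∀ᶠ T : ℝ in atTop, ballProb P (scaledPath xi) f ε T ≤
      ENNReal.ofReal (Real.exp (-(T ^ (k + 1) * ((√p - √q) ^ 2 *
        (∫ s in (0 : ℝ)..1, max (f (Set.projIcc 0 1 zero_le_one s) - ε) 0 ^ k) - δ)))) := by
  set c := (√p - √q) ^ 2 with hc
  have hk := R.exponent_pos
  obtain ⟨M, hM⟩ : ∃ M, ∀ t, f t ≤ M := by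
    obtain ⟨M, hM⟩ := (isCompact_univ.image hf).bddAbove
    exact ⟨M, fun t => hM ⟨t, Set.mem_univ t, rfl⟩⟩
  have hM0 : 0 ≤ M := (hf0 0).trans (hM 0)
  have hMk : 0 ≤ (M + ε) ^ k := Real.rpow_nonneg (by positivity) k
  set η := δ / (4 * ((M + ε) ^ k + 1)) with hη
  have hη0 : 0 < η := by positivity
  obtain ⟨r, hr, hrc⟩ := exists_tilt_upper R.p_nonneg R.q_nonneg hη0
  have htilt : Tendsto (fun x : ℕ => tiltRate lam mu r x / (x : ℝ) ^ k) atTop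
      (𝓝 (p + q - p * r - q / r)) := by
    refine (((R.lam_lim.add R.mu_lim).sub (R.lam_lim.mul_const r)).sub
      (R.mu_lim.div_const r)).congr fun x => ?_
    simp only [tiltRate]
    ring
  obtain ⟨C, hC0, hC⟩ := exists_abs_sub_le_of_tendsto htilt hη0
  set g : ℝ → ℝ := fun s => max (f (Set.projIcc 0 1 zero_le_one s) - ε) 0 ^ k with hg
  have hgc : Continuous g := by
    have h1 : Continuous fun s => max (f (Set.projIcc 0 1 zero_le_one s) - ε) 0 :=
      ((hf.comp continuous_projIcc).sub continuous_const).max continuous_const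
    exact h1.rpow_const fun s => Or.inr hk.le
  filter_upwards [eventually_gt_atTop 0, eventually_const_le_mul_rpow hk
    (C + |Real.log r| * (M + ε)) (show 0 < δ / 2 by positivity)] with T hT hTC
  have hTk : 0 < T ^ k := Real.rpow_pos_of_pos hT k
  have hTk1 : T ^ (k + 1) = T ^ k * T := by rw [Real.rpow_add hT, Real.rpow_one]
  -- One η accounts for the rate asymptotics, the other for the non-optimal r; `C` comes from small
  -- states. Its contribution and the boundary term |log r|(M + ε)T are o(T^(k+1)).
  set G : ℝ → ℝ := fun v => T ^ k * (c * g (v / T) - 2 * η * (M + ε) ^ k) - C with hG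
  have hGc : Continuous G := by rw [hG]; fun_prop
  have hI : ∫ v in (0 : ℝ)..T, G v = T * (T ^ k * (c * (∫ s in (0 : ℝ)..1, g s) -
      2 * η * (M + ε) ^ k) - C) := by
    have h1 := intervalIntegral.integral_comp_div (a := 0) (b := T)
      (fun s => T ^ k * (c * g s - 2 * η * (M + ε) ^ k) - C) hT.ne'
    rw [zero_div, div_self hT.ne', smul_eq_mul] at h1
    rw [h1]
    congr 1
    have i1 : IntervalIntegrable (fun s => c * g s) volume 0 1 :=
      (hgc.const_mul c).intervalIntegrable _ _
    rw [intervalIntegral.integral_sub ((i1.sub (by simp)).const_mul _) (by simp),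
      intervalIntegral.integral_const_mul, intervalIntegral.integral_sub i1 (by simp),
      intervalIntegral.integral_const_mul]
    simp
  have hbd := ballProb_le (N := (M + ε) * T) R.lam_pos R.mu_nonneg R.mu_zero H hxi hT hε hr hGc
    (f := f) ?_ ?_
  · refine hbd.trans (ENNReal.ofReal_le_ofReal (Real.exp_le_exp.2 ?_))
    rw [hI, hTk1]
    have h1 : 2 * η * (M + ε) ^ k ≤ δ / 2 := by
      rw [hη]
      have : 2 * (δ / (4 * ((M + ε) ^ k + 1))) * (M + ε) ^ k =
        δ / 2 * ((M + ε) ^ k / ((M + ε) ^ k + 1)) := by field_simp; norm_num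
      rw [this]
      have h2 : (M + ε) ^ k / ((M + ε) ^ k + 1) ≤ 1 := (div_le_one (by positivity)).2 (by linarith)
      nlinarith
    have h2 := mul_le_mul_of_nonneg_right h1 (mul_pos hTk hT).le
    have h3 := mul_le_mul_of_nonneg_right hTC hT.le
    linarith
  · intro x v hv0 hvT hx
    set u := f (Set.projIcc 0 1 zero_le_one (v / T)) with hu
    have hcurve : scaledCurve f T v = T * u := rfl
    rw [hcurve, abs_le] at hx
    have hx1 : T * max (u - ε) 0 ≤ x := by
      rcases le_total (u - ε) 0 with h | h
      · rw [max_eq_right h, mul_zero]; exact Nat.cast_nonneg x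
      · rw [max_eq_left h]; linarith
    have hx2 : (x : ℝ) ≤ T * (M + ε) := by
      have := mul_le_mul_of_nonneg_left (hM (Set.projIcc 0 1 zero_le_one (v / T))) hT.le
      linarith
    have hk1 : T ^ k * g (v / T) ≤ (x : ℝ) ^ k := by
      rw [hg, ← Real.mul_rpow hT.le (le_max_right _ _)]
      exact Real.rpow_le_rpow (mul_nonneg hT.le (le_max_right _ _)) hx1 hk.le
    have hk2 : (x : ℝ) ^ k ≤ T ^ k * (M + ε) ^ k := by
      rw [← Real.mul_rpow hT.le (by positivity)]
      exact Real.rpow_le_rpow (Nat.cast_nonneg x) hx2 hk.le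
    have hxk : 0 ≤ (x : ℝ) ^ k := Real.rpow_nonneg (Nat.cast_nonneg x) k
    have h1 := (abs_le.1 (hC x)).1
    have h2 := mul_le_mul_of_nonneg_right hrc hxk
    have h3 := mul_le_mul_of_nonneg_left hk1 (show 0 ≤ c from sq_nonneg _)
    have h4 := mul_le_mul_of_nonneg_left hk2 hη0.le
    simp only [hG]
    linarith
  · intro x hx
    have hcurve : scaledCurve f T T = T * f (Set.projIcc 0 1 zero_le_one (T / T)) := rfl
    rw [hcurve, abs_le] at hx
    have := mul_le_mul_of_nonneg_left (hM (Set.projIcc 0 1 zero_le_one (T / T))) hT.le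
    linarith

theorem HasPowerRates.eventually_le_ballProb (R : HasPowerRates lam mu k p q c₀)
    (H : IsBDJumpHold P lam mu Y S)
    (hxi : ∀ᵐ ω ∂P, IsJumpPath (fun i => Y i ω) (fun i => S i ω) (fun t => xi t ω))
    {f : unitInterval → ℝ} (hf : Continuous f) (hf0 : ∀ t, 0 ≤ f t) (hf00 : f 0 = 0) {ε δ : ℝ}
    (hε : 0 < ε) (hδ : 0 < δ) : ∀ᶠ T : ℝ in atTop,
      ENNReal.ofReal (Real.exp (-(T ^ (k + 1) * ((√p - √q) ^ 2 *
        (∫ s in (0 : ℝ)..1, f (Set.projIcc 0 1 zero_le_one s) ^ k) + δ)))) ≤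
      ballProb P (scaledPath xi) f ε T := by
  set c := (√p - √q) ^ 2 with hc
  have hc0 : 0 ≤ c := sq_nonneg _
  have hk := R.exponent_pos
  obtain ⟨M, hM⟩ : ∃ M, ∀ t, f t ≤ M := by
    obtain ⟨M, hM⟩ := (isCompact_univ.image hf).bddAbove
    exact ⟨M, fun t => hM ⟨t, Set.mem_univ t, rfl⟩⟩
  have hM0 : 0 ≤ M := (hf0 0).trans (hM 0)
  set g : ℝ → ℝ := fun s => f (Set.projIcc 0 1 zero_le_one s) with hg
  have hgc : Continuous g := hf.comp continuous_projIcc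
  have hg0 : ∀ s, 0 ≤ g s := fun s => hf0 _
  have hgM : ∀ s, g s ≤ M := fun s => hM _
  have hgkc : Continuous fun s => g s ^ k := hgc.rpow_const fun s => Or.inr hk.le
  -- Budget: 2η for the factors exp(-β) over all cells, η for the stays, cη for the Riemann sum.
  set η := δ / (3 + c) with hη
  have hη0 : 0 < η := by positivity
  obtain ⟨K, hK, hmod⟩ := exists_grid_modulus hgc hgkc (show 0 < ε / 8 by positivity) hη0
  have hK0 : (0 : ℝ) < K := by exact_mod_cast hK
  obtain ⟨r, hr, hrp, hrq⟩ := exists_tilt_lower R.p_nonneg R.q_nonneg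
  set κ := √p * √q with hκ
  have hκ0 : 0 ≤ κ := by positivity
  have hcκ : p + q - 2 * κ = c := (sq_sqrt_sub_sqrt R.p_nonneg R.q_nonneg).symm
  -- `K` and `W` are fixed before T grows, so the stay's normalising constant does not depend on T.
  obtain ⟨W, hW⟩ := exists_nat_gt (2 * κ * M ^ k / (η / 2))
  have hMk : 0 ≤ M ^ k := Real.rpow_nonneg hM0 k
  have hWy : ∀ s, 2 * κ * g s ^ k / (W + 1) ≤ η / 2 := by
    intro s
    have h1 : g s ^ k ≤ M ^ k := Real.rpow_le_rpow (hg0 s) (hgM s) hk.le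
    rw [div_lt_iff₀ (by positivity)] at hW
    rw [div_le_iff₀ (by positivity)]
    have := mul_le_mul_of_nonneg_left h1 (show 0 ≤ 2 * κ by positivity)
    nlinarith
  have hstay : ∀ᶠ T : ℝ in atTop, ∀ j ∈ Finset.range K, ∃ σ, 0 ≤ σ ∧
      ∀ x ∈ Set.Icc ⌊T * g (j / K)⌋₊ (⌊T * g (j / K)⌋₊ + W), σ ≤ lam x * r ∧ σ * r ≤ mu x ∧
        lam x + mu x - 2 * σ * (1 - 1 / (W + 1)) ≤ T ^ k * (c * g (j / K) ^ k + η) := by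
    rw [Filter.eventually_all_finset]
    intro j _
    have := R.eventually_stay hr hκ0 hrp hrq (hg0 (j / K)) hη0 (hWy (j / K))
    rwa [hcκ] at this
  have hM1 : 0 < M + 1 := by positivity
  obtain ⟨HR, hHR⟩ := eventually_rate_le (a := fun x => lam x + mu x) (L := p + q) hk
    ((R.lam_lim.add R.mu_lim).congr fun x => by ring) hM1.le
  have hKη : 0 < η / K := by positivity
  have hk1 : 0 < k + 1 := by positivity
  filter_upwards [hstay, hHR, eventually_move_cost hk HR (M + 1) hM1 R.bound_pos hKη,
    eventually_const_le_mul_rpow hk1 (-Real.log (1 / ((W + 1) * max 1 r ^ W))) hKη,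
    eventually_gt_atTop 0, eventually_ge_atTop (K : ℝ), eventually_ge_atTop (W : ℝ),
    eventually_ge_atTop ((W + 1) / (ε / 4))] with T hst hrate hmove hκT hT hTK hTW hTε
  have hTk : 0 < T ^ k := Real.rpow_pos_of_pos hT k
  have hTk1 : T ^ (k + 1) = T ^ k * T := by rw [Real.rpow_add hT, Real.rpow_one]
  choose! σ hσ using hst
  set z : ℕ → ℕ := fun j => ⌊T * g (j / K)⌋₊ with hz
  have hz1 : ∀ j, (z j : ℝ) ≤ T * g (j / K) := fun j =>
    Nat.floor_le (mul_nonneg hT.le (hg0 _))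
  have hz2 : ∀ j : ℕ, T * g (j / K) - 1 ≤ z j := fun j => by
    have := Nat.lt_floor_add_one (T * g (j / K))
    linarith
  have hzM : ∀ j, (z j : ℝ) ≤ M * T := fun j => by
    have := mul_le_mul_of_nonneg_left (hgM (j / K)) hT.le
    linarith [hz1 j]
  have hcast : ∀ j x, x ∈ Set.Icc (min (z (j - 1)) (z j)) (max (z (j - 1)) (z j) + W) →
      (min (z (j - 1) : ℝ) (z j) ≤ x) ∧ ((x : ℝ) ≤ max (z (j - 1) : ℝ) (z j) + W) := by
    intro j x hx
    exact ⟨by exact_mod_cast hx.1, by exact_mod_cast hx.2⟩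
  have hxM : ∀ j x, x ∈ Set.Icc (min (z (j - 1)) (z j)) (max (z (j - 1)) (z j) + W) →
      (x : ℝ) ≤ (M + 1) * T := by
    intro j x hx
    have h1 := (hcast j x hx).2
    have h2 : max (z (j - 1) : ℝ) (z j) ≤ M * T := max_le (hzM _) (hzM _)
    linarith
  -- The half-width ε/2 · T covers the oscillation ε/8 · T of the curve and the W + 1 ≤ ε/4 · T lost
  -- to the window and to rounding.
  have hgrid := fkLimit_grid_lower (ρ := ε / 2 * T) (T := T) R.lam_pos R.mu_nonneg
    (continuous_scaledCurve hf T) R.bound_pos R.le_lam R.le_mu (K := K) (W := W) (r := r)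
    (H := HR * T ^ k) (β := η / K * T ^ (k + 1)) hK hTK hr z σ
    (fun j => T ^ k * (c * g (j / K) ^ k + η)) ?_ ?_ ?_ ?_ ?_ ?_ ?_ ?_ ?_ (n := K) le_rfl 0 ?_
  · have hsum : ∑ i ∈ Finset.Ico (K - K) K, (2 * (η / K * T ^ (k + 1)) +
        T ^ k * (c * g (i / K) ^ k + η) * (T / K)) ≤
        T ^ (k + 1) * (c * (∫ s in (0 : ℝ)..1, g s ^ k) + δ) := by
      have hR := riemann_sum_le hgkc hK fun s hs t ht hst => (hmod s hs t ht hst).2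
      have e1 : ∑ i ∈ Finset.Ico (K - K) K, (2 * (η / K * T ^ (k + 1)) +
          T ^ k * (c * g (i / K) ^ k + η) * (T / K)) =
          T ^ (k + 1) * (c * ((∑ i ∈ Finset.range K, g (i / K) ^ k) / K) + 3 * η) := by
        have e2 : ∀ i ∈ Finset.range K, 2 * (η / K * T ^ (k + 1)) +
            T ^ k * (c * g (i / K) ^ k + η) * (T / K) =
            T ^ (k + 1) * c / K * g (i / K) ^ k + 3 * η * T ^ (k + 1) / K := by
          intro i _
          rw [hTk1]
          ring
        rw [Nat.sub_self, ← Finset.range_eq_Ico, Finset.sum_congr rfl e2, Finset.sum_add_distrib,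
          ← Finset.mul_sum, Finset.sum_const, Finset.card_range, nsmul_eq_mul]
        field_simp
      rw [e1]
      have e3 : δ = (3 + c) * η := by rw [hη]; field_simp
      have := mul_le_mul_of_nonneg_left hR hc0
      refine mul_le_mul_of_nonneg_left ?_ (Real.rpow_nonneg hT.le _)
      rw [e3]
      linarith
    refine le_trans (ENNReal.ofReal_le_ofReal (Real.exp_le_exp.2 (neg_le_neg hsum))) (hgrid.trans ?_)
    rw [Nat.sub_self, Nat.cast_zero, zero_mul]
    exact fkLimit_tube_le_ballProb R.lam_pos R.mu_nonneg R.mu_zero H hxi hf hT (by positivity)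
      (by linarith)
  · intro j hj x hx v hv1 hv2
    obtain ⟨h1, h2⟩ := hcast j x hx
    have hjK : (j : ℝ) + 1 ≤ K := by exact_mod_cast hj
    have hcurve : scaledCurve f T v = T * g (v / T) := rfl
    have hj1 : ((j - 1 : ℕ) : ℝ) ≤ j := by exact_mod_cast Nat.sub_le j 1
    have hj2 : (j : ℝ) ≤ ((j - 1 : ℕ) : ℝ) + 1 := by exact_mod_cast (by omega : j ≤ j - 1 + 1)
    have hj3 : (0 : ℝ) ≤ ((j - 1 : ℕ) : ℝ) := Nat.cast_nonneg _
    have hv3 : (j : ℝ) / K ≤ v / T := by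
      rw [div_le_div_iff₀ hK0 hT]
      have := mul_le_mul_of_nonneg_right hv1 hK0.le
      rw [mul_assoc, div_mul_cancel₀ T hK0.ne'] at this
      exact this
    have hv4 : v / T ≤ ((j : ℝ) + 1) / K := by
      rw [div_le_div_iff₀ hT hK0]
      have := mul_le_mul_of_nonneg_right hv2 hK0.le
      rw [mul_assoc, div_mul_cancel₀ T hK0.ne'] at this
      exact this
    have hmem : ∀ i : ℝ, 0 ≤ i → i ≤ K → i / K ∈ Set.Icc (0 : ℝ) 1 := fun i hi0 hi1 =>
      ⟨by positivity, (div_le_one hK0).2 hi1⟩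
    have hvm : v / T ∈ Set.Icc (0 : ℝ) 1 :=
      ⟨(hmem j (Nat.cast_nonneg j) (by linarith)).1.trans hv3,
        hv4.trans (hmem (j + 1) (by positivity) hjK).2⟩
    have hnear : ∀ i : ℝ, 0 ≤ i → i ≤ j → (j : ℝ) ≤ i + 1 → |g (v / T) - g (i / K)| ≤ ε / 8 := by
      intro i hi0 hi1 hi2
      refine (hmod _ hvm _ (hmem i hi0 (by linarith)) ?_).1
      have e1 : i / K ≤ (j : ℝ) / K := by gcongr
      rw [abs_of_nonneg (by linarith)]
      have e2 : ((j : ℝ) + 1) / K - i / K ≤ 2 / K := by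
        rw [← sub_div]
        gcongr
        linarith
      linarith
    have n1 := abs_le.1 (hnear j (Nat.cast_nonneg j) le_rfl (by linarith))
    have n2 := abs_le.1 (hnear _ hj3 hj1 hj2)
    have hTε' : (W : ℝ) + 1 ≤ ε / 4 * T := by
      rw [div_le_iff₀ (by positivity)] at hTε
      linarith
    have m1 : T * g (v / T) - ε / 8 * T - 1 ≤ min (z (j - 1) : ℝ) (z j) := by
      refine le_min ?_ ?_
      · have := mul_le_mul_of_nonneg_left n2.2 hT.le
        linarith [hz2 (j - 1)]
      · have := mul_le_mul_of_nonneg_left n1.2 hT.le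
        linarith [hz2 j]
    have m2 : max (z (j - 1) : ℝ) (z j) ≤ T * g (v / T) + ε / 8 * T := by
      refine max_le ?_ ?_
      · have := mul_le_mul_of_nonneg_left n2.1 hT.le
        linarith [hz1 (j - 1)]
      · have := mul_le_mul_of_nonneg_left n1.1 hT.le
        linarith [hz1 j]
    have hεT : 0 < ε * T := by positivity
    have hW0 : (0 : ℝ) ≤ W := Nat.cast_nonneg W
    rw [hcurve, abs_le]
    constructor <;> linarith
  · exact fun j hj x hx => hrate x (hxM j x hx)
  · intro j hj x hx
    refine hmove _ ?_
    have h1 := hxM j x hx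
    have h2 : (z j : ℝ) ≤ (M + 1) * T := by linarith [hzM j]
    rcases le_total x (z j) with h | h
    · rw [Nat.sub_eq_zero_of_le h, zero_add]
      exact le_trans (by exact_mod_cast Nat.sub_le _ _) h2
    · rw [Nat.sub_eq_zero_of_le h, add_zero]
      exact le_trans (by exact_mod_cast Nat.sub_le _ _) h1
  · have hpos : (0 : ℝ) < 1 / ((W + 1) * max 1 r ^ W) := by positivity
    rw [← Real.le_log_iff_exp_le hpos]
    linarith
  · intro j _
    have := Real.rpow_nonneg (hg0 (j / K)) k
    positivity
  · exact fun j hj => (hσ j (Finset.mem_range.2 hj)).1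
  · exact fun j hj x hx => ((hσ j (Finset.mem_range.2 hj)).2 x hx).1
  · exact fun j hj x hx => ((hσ j (Finset.mem_range.2 hj)).2 x hx).2.1
  · exact fun j hj x hx => ((hσ j (Finset.mem_range.2 hj)).2 x hx).2.2
  · have hz0 : z (K - K - 1) = 0 := by
      simp [hz, hg, hf00]
    rw [hz0]
    exact ⟨le_rfl, Nat.zero_le _⟩

end Bounds

/-! ### The large deviation principle -/

section LLDP

theorem integral_unitInterval_eq (h : unitInterval → ℝ) :
    ∫ t : unitInterval, h t = ∫ s in (0 : ℝ)..1, h (Set.projIcc 0 1 zero_le_one s) := by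
  rw [intervalIntegral.integral_of_le zero_le_one, ← integral_Icc_eq_integral_Ioc,
    ← integral_subtype_comap measurableSet_Icc]
  refine integral_congr_ae (ae_of_all _ fun t => ?_)
  simp only [Set.projIcc_val]

theorem log_ofReal_exp_neg_div {ψ a : ℝ} (hψ : 0 < ψ) :
    ENNReal.log (ENNReal.ofReal (Real.exp (-(ψ * a)))) / (ψ : EReal) = ((-a : ℝ) : EReal) := by
  rw [ENNReal.log_ofReal_of_pos (Real.exp_pos _), Real.log_exp, ← EReal.coe_div]
  congr 1
  field_simp

theorem log_div_mono {x y : ℝ≥0∞} (h : x ≤ y) {ψ : ℝ} (hψ : 0 < ψ) :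
    ENNReal.log x / (ψ : EReal) ≤ ENNReal.log y / (ψ : EReal) :=
  EReal.div_le_div_right_of_nonneg (by exact_mod_cast hψ.le) (ENNReal.log_monotone h)

variable {Ω : Type*} [MeasurableSpace Ω] {P : Measure Ω} [IsProbabilityMeasure P]
  {lam mu : ℕ → ℝ} {xi : ℝ → Ω → ℕ∞} {k p q c₀ : ℝ}

/-- For every ε the lower limit is at least -c J(0) and the upper limit at most -c J(ε); continuity
of J at 0 squeezes both. -/
theorem HasPowerRates.satisfiesLLDP (R : HasPowerRates lam mu k p q c₀)
    (hxi : IsBirthDeathProcess P lam mu xi) {c : ℝ} (hc : c = (√p - √q) ^ 2) :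
    SatisfiesLLDP P (scaledPath xi) positivePaths (fun f => c * ∫ t : unitInterval, f t ^ k)
      (fun T => T ^ (k + 1)) := by
  obtain ⟨Y, S, H, hpath⟩ := hxi
  have hk := R.exponent_pos
  have hc0 : 0 ≤ c := hc ▸ sq_nonneg _
  have hnonneg : ∀ f ∈ positivePaths, ∀ t, 0 ≤ f t := by
    rintro f ⟨-, h0, hpos⟩ t
    rcases eq_or_lt_of_le (show (0 : unitInterval) ≤ t from t.2.1) with h | h
    · rw [← h, h0]
    · exact (hpos t h).le
  -- Truncation at 0 is needed because f - ε is negative near time 0.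
  set J : (unitInterval → ℝ) → ℝ → ℝ := fun f ε =>
    ∫ s in (0 : ℝ)..1, max (f (Set.projIcc 0 1 zero_le_one s) - ε) 0 ^ k with hJ
  have hJ0 : ∀ f ∈ positivePaths, J f 0 = ∫ t : unitInterval, f t ^ k := by
    intro f hf
    rw [integral_unitInterval_eq]
    simp only [hJ, sub_zero]
    refine intervalIntegral.integral_congr fun s _ => ?_
    simp only [max_eq_left (hnonneg f hf _)]
  have hJc : ∀ f ∈ positivePaths, Continuous (J f) := by
    intro f hf
    have h1 : Continuous fun z : ℝ × ℝ => f (Set.projIcc 0 1 zero_le_one z.2) - z.1 :=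
      (hf.1.comp (continuous_projIcc.comp continuous_snd)).sub continuous_fst
    exact intervalIntegral.continuous_parametric_intervalIntegral_of_continuous'
      (f := fun ε s => max (f (Set.projIcc 0 1 zero_le_one s) - ε) 0 ^ k)
      ((h1.max continuous_const).rpow_const fun z => Or.inr hk.le) 0 1
  have hup : ∀ f ∈ positivePaths, ∀ ε > 0,
      limsup (fun T : ℝ => ENNReal.log (ballProb P (scaledPath xi) f ε T) /
        ((T ^ (k + 1) : ℝ) : EReal)) atTop ≤ ((-(c * J f ε) : ℝ) : EReal) := by
    intro f hf ε hε
    have hlim : Tendsto (fun δ : ℝ => ((-(c * J f ε - δ) : ℝ) : EReal)) (𝓝[>] 0)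
        (𝓝 ((-(c * J f ε - 0) : ℝ) : EReal)) :=
      ((continuous_coe_real_ereal.comp (by fun_prop : Continuous fun δ : ℝ =>
        -(c * J f ε - δ))).tendsto 0).mono_left nhdsWithin_le_nhds
    rw [sub_zero] at hlim
    refine ge_of_tendsto hlim ?_
    filter_upwards [self_mem_nhdsWithin] with δ hδ
    refine limsup_le_of_le (by isBoundedDefault) ?_
    filter_upwards [R.eventually_ballProb_le H hpath hf.1 (hnonneg f hf) hε hδ,
      eventually_gt_atTop 0] with T h1 hT
    rw [← hc] at h1
    have hψ : 0 < T ^ (k + 1) := Real.rpow_pos_of_pos hT _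
    rw [← log_ofReal_exp_neg_div hψ]
    exact log_div_mono h1 hψ
  have hlow : ∀ f ∈ positivePaths, ∀ ε > 0, ((-(c * J f 0) : ℝ) : EReal) ≤
      liminf (fun T : ℝ => ENNReal.log (ballProb P (scaledPath xi) f ε T) /
        ((T ^ (k + 1) : ℝ) : EReal)) atTop := by
    intro f hf ε hε
    have hlim : Tendsto (fun δ : ℝ => ((-(c * J f 0 + δ) : ℝ) : EReal)) (𝓝[>] 0)
        (𝓝 ((-(c * J f 0 + 0) : ℝ) : EReal)) :=
      ((continuous_coe_real_ereal.comp (by fun_prop : Continuous fun δ : ℝ =>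
        -(c * J f 0 + δ))).tendsto 0).mono_left nhdsWithin_le_nhds
    rw [add_zero] at hlim
    refine le_of_tendsto hlim ?_
    filter_upwards [self_mem_nhdsWithin] with δ hδ
    refine le_liminf_of_le (by isBoundedDefault) ?_
    filter_upwards [R.eventually_le_ballProb H hpath hf.1 (hnonneg f hf) hf.2.1 hε hδ,
      eventually_gt_atTop 0] with T h1 hT
    rw [← hc, ← integral_unitInterval_eq fun t => f t ^ k, ← hJ0 f hf] at h1
    have hψ : 0 < T ^ (k + 1) := Real.rpow_pos_of_pos hT _
    rw [← log_ofReal_exp_neg_div hψ]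
    exact log_div_mono h1 hψ
  have hle : ∀ f ε, liminf (fun T : ℝ => ENNReal.log (ballProb P (scaledPath xi) f ε T) /
        ((T ^ (k + 1) : ℝ) : EReal)) atTop ≤
      limsup (fun T : ℝ => ENNReal.log (ballProb P (scaledPath xi) f ε T) /
        ((T ^ (k + 1) : ℝ) : EReal)) atTop := fun f ε => liminf_le_limsup
  have hupper : ∀ f ∈ positivePaths, Tendsto (fun ε : ℝ => ((-(c * J f ε) : ℝ) : EReal)) (𝓝[>] 0)
      (𝓝 ((-(c * J f 0) : ℝ) : EReal)) := by
    intro f hf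
    have h1 := hJc f hf
    exact ((continuous_coe_real_ereal.comp (by fun_prop : Continuous fun ε : ℝ =>
        -(c * J f ε))).tendsto 0).mono_left nhdsWithin_le_nhds
  refine ⟨?_, ?_, ?_, ?_, ?_, ?_⟩
  · intro f hf t
    exact ⟨hf.1.continuousWithinAt, f t, hf.1.continuousWithinAt⟩
  · intro f hf
    exact mul_nonneg hc0 (integral_nonneg fun t => Real.rpow_nonneg (hnonneg f hf t) k)
  · exact fun T hT => Real.rpow_pos_of_pos hT _
  · exact tendsto_rpow_atTop (by positivity)
  · intro f hf
    simp only [← hJ0 f hf]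
    refine tendsto_of_tendsto_of_tendsto_of_le_of_le' tendsto_const_nhds (hupper f hf) ?_ ?_
    · filter_upwards [self_mem_nhdsWithin] with ε hε
      exact (hlow f hf ε hε).trans (hle f ε)
    · filter_upwards [self_mem_nhdsWithin] with ε hε
      exact hup f hf ε hε
  · intro f hf
    simp only [← hJ0 f hf]
    refine tendsto_of_tendsto_of_tendsto_of_le_of_le' tendsto_const_nhds (hupper f hf) ?_ ?_
    · filter_upwards [self_mem_nhdsWithin] with ε hε
      exact hlow f hf ε hε
    · filter_upwards [self_mem_nhdsWithin] with ε hε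
      exact (hle f ε).trans (hup f hf ε hε)

end LLDP

/-! ### Reduction to a common exponent -/

section PowerRates

theorem tendsto_div_rpow {a : ℕ → ℝ} {A l : ℝ} (hA : 0 < A)
    (h : Tendsto (fun x : ℕ => a x / (A * (x : ℝ) ^ l)) atTop (𝓝 1)) :
    Tendsto (fun x : ℕ => a x / (x : ℝ) ^ l) atTop (𝓝 A) := by
  have h1 := h.const_mul A
  rw [mul_one] at h1
  refine h1.congr fun x => ?_
  rw [← mul_div_assoc, mul_div_mul_left _ _ hA.ne']

theorem tendsto_div_rpow_zero {a : ℕ → ℝ} {A l k : ℝ} (hA : 0 < A) (hlk : l < k)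
    (h : Tendsto (fun x : ℕ => a x / (A * (x : ℝ) ^ l)) atTop (𝓝 1)) :
    Tendsto (fun x : ℕ => a x / (x : ℝ) ^ k) atTop (𝓝 0) := by
  have h1 := tendsto_div_rpow hA h
  have h2 := (tendsto_rpow_neg_atTop (sub_pos.2 hlk)).comp tendsto_natCast_atTop_atTop
  have h3 := h1.mul h2
  rw [mul_zero] at h3
  refine h3.congr' ?_
  filter_upwards [eventually_gt_atTop 0] with x hx
  have hx' : (0 : ℝ) < x := by exact_mod_cast hx
  simp only [Function.comp]
  rw [neg_sub, Real.rpow_sub hx']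
  have := (Real.rpow_pos_of_pos hx' l).ne'
  field_simp

/-- Beyond some N the rate exceeds A/2, because x^l ≥ 1; finitely many positive values remain. -/
theorem exists_pos_le_rate {a : ℕ → ℝ} {A l : ℝ} (hA : 0 < A) (hl : 0 ≤ l)
    (h : Tendsto (fun x : ℕ => a x / (A * (x : ℝ) ^ l)) atTop (𝓝 1)) (hpos : ∀ x, 1 ≤ x → 0 < a x) :
    ∃ c > 0, ∀ x, 1 ≤ x → c ≤ a x := by
  obtain ⟨N, hN⟩ := eventually_atTop.1 ((tendsto_div_rpow hA h).eventually_const_lt (half_lt_self hA))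
  have hlarge : ∀ x, N ≤ x → 1 ≤ x → A / 2 ≤ a x := by
    intro x hx hx1
    have hx1' : (1 : ℝ) ≤ x := by exact_mod_cast hx1
    have h1 := hN x hx
    have h2 : 1 ≤ (x : ℝ) ^ l := Real.one_le_rpow hx1' hl
    rw [lt_div_iff₀ (by positivity)] at h1
    nlinarith
  have hfin : ∀ M : ℕ, ∃ c > 0, ∀ x, 1 ≤ x → x < M → c ≤ a x := by
    intro M
    induction M with
    | zero => exact ⟨1, one_pos, fun x _ hx => absurd hx (Nat.not_lt_zero x)⟩
    | succ M ih =>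
      obtain ⟨c, hc, hcx⟩ := ih
      rcases Nat.eq_zero_or_pos M with rfl | hM
      · exact ⟨1, one_pos, fun x h1 hx => by omega⟩
      · refine ⟨min c (a M), lt_min hc (hpos M hM), fun x h1 hx => ?_⟩
        rcases (Nat.le_of_lt_succ hx).eq_or_lt with rfl | h2
        · exact min_le_right _ _
        · exact (min_le_left _ _).trans (hcx x h1 h2)
  obtain ⟨c, hc, hcx⟩ := hfin N
  refine ⟨min c (A / 2), lt_min hc (half_pos hA), fun x hx => ?_⟩
  rcases Nat.lt_or_ge x N with h1 | h1
  · exact (min_le_left _ _).trans (hcx x hx h1)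
  · exact (min_le_right _ _).trans (hlarge x h1 hx)

end PowerRates

theorem theorem2p1 {Ω : Type*} [MeasurableSpace Ω] (P : Measure Ω) [IsProbabilityMeasure P]
    (lam mu : ℕ → ℝ) (l m Pl Qm : ℝ)
    (hlam : ∀ x, 0 < lam x) (hmu : ∀ x, 1 ≤ x → 0 < mu x) (hmu0 : mu 0 = 0)
    (hPl : 0 < Pl) (hQm : 0 < Qm) (hl : 0 ≤ l) (hm : 0 ≤ m) (hlm : 0 < max l m)
    (hlam_lim : Tendsto (fun x : ℕ => lam x / (Pl * (x : ℝ) ^ l)) atTop (𝓝 1))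
    (hmu_lim : Tendsto (fun x : ℕ => mu x / (Qm * (x : ℝ) ^ m)) atTop (𝓝 1))
    (xi : ℝ → Ω → ℕ∞) (hxi : IsBirthDeathProcess P lam mu xi) :
    (m < l → SatisfiesLLDP P (scaledPath xi) positivePaths
      (fun f => Pl * ∫ t : unitInterval, f t ^ l) (fun T => T ^ (l + 1))) ∧
    (l = m → Pl ≠ Qm → SatisfiesLLDP P (scaledPath xi) positivePaths
      (fun f => (Real.sqrt Pl - Real.sqrt Qm) ^ 2 * ∫ t : unitInterval, f t ^ l)
      (fun T => T ^ (l + 1))) ∧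
    (l < m → SatisfiesLLDP P (scaledPath xi) positivePaths
      (fun f => Qm * ∫ t : unitInterval, f t ^ m) (fun T => T ^ (m + 1))) := by
  obtain ⟨c₁, hc₁, hc₁x⟩ := exists_pos_le_rate hPl hl hlam_lim fun x _ => hlam x
  obtain ⟨c₂, hc₂, hc₂x⟩ := exists_pos_le_rate hQm hm hmu_lim hmu
  have hmu' : ∀ x, 0 ≤ mu x := by
    intro x
    rcases Nat.eq_zero_or_pos x with rfl | hx
    · exact hmu0.ge
    · exact (hmu x hx).le
  have hrates : ∀ {k p q : ℝ}, 0 < k → 0 ≤ p → 0 ≤ q →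
      Tendsto (fun x : ℕ => lam x / (x : ℝ) ^ k) atTop (𝓝 p) →
      Tendsto (fun x : ℕ => mu x / (x : ℝ) ^ k) atTop (𝓝 q) →
      HasPowerRates lam mu k p q (min (min c₁ (lam 0)) c₂) := fun hk hp hq hp' hq' =>
    { lam_pos := hlam
      mu_nonneg := hmu'
      mu_zero := hmu0
      exponent_pos := hk
      p_nonneg := hp
      q_nonneg := hq
      lam_lim := hp'
      mu_lim := hq'
      bound_pos := lt_min (lt_min hc₁ (hlam 0)) hc₂
      le_lam := by
        intro x
        refine (min_le_left _ _).trans ?_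
        rcases Nat.eq_zero_or_pos x with rfl | hx
        · exact min_le_right _ _
        · exact (min_le_left _ _).trans (hc₁x x hx)
      le_mu := fun x hx => (min_le_right _ _).trans (hc₂x x hx) }
  refine ⟨fun h => ?_, fun h _ => ?_, fun h => ?_⟩
  -- With q = 0 the constant (√p - √q)² reduces to `Pl`; the last case is symmetric, with p = 0.
  · exact (hrates (hm.trans_lt h) hPl.le le_rfl (tendsto_div_rpow hPl hlam_lim)
      (tendsto_div_rpow_zero hQm h hmu_lim)).satisfiesLLDP hxi (by simp [Real.sq_sqrt hPl.le])
  · subst h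
    rw [max_self] at hlm
    exact (hrates hlm hPl.le hQm.le (tendsto_div_rpow hPl hlam_lim)
      (tendsto_div_rpow hQm hmu_lim)).satisfiesLLDP hxi rfl
  · exact (hrates (hl.trans_lt h) le_rfl hQm.le (tendsto_div_rpow_zero hPl h hlam_lim)
      (tendsto_div_rpow hQm hmu_lim)).satisfiesLLDP hxi (by simp [Real.sq_sqrt hQm.le])
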